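/- **Conventions.** Surfaces are smooth, Hausdorff and without boundary; on a surface every $2$-form is closed. Let $m\ge 1$, let $\Sigma$ be a compact orientable surface and $Z\subset\Sigma$ a closed embedded curve (possibly empty or disconnected). A $b^m$-symplectic form $\omega$ on $(\Sigma,Z)$ is a symplectic form on $\Sigma\setminus Z$ such that, for local defining functions $z$ of $Z$, $z^m\omega$ extends to a smooth nowhere vanishing $2$-form near $Z$. Fix a tubular neighbourhood $(z,\pi):\mathcal N\cong(-\delta,\delta)\times Z$, with $z$ a defining function of $Z$ and $\pi$ the projection onto $Z$, such that $\omega=\sum_{i=1}^m \frac{dz}{z^i}\wedge\pi^*\alpha_i$ on $\mathcal N$, with $\alpha_i$ smooth $1$-forms on $Z$; put $\mathcal N_\varepsilon(Z)=\{|z|<\varepsilon\}$. Let $R$ be the vector field on $\mathcal N$ with $dz(R)=0$ and $\pi^*\alpha_m(R)=1$ (Reeb field). A normal $b^m$-vector field is a smooth vector field $X^\sigma$ on $\mathcal N$ that vanishes on $Z$ and satisfies $dz(X^\sigma)=u\,z^m$ with $u$ smooth and $u\neq0$ on $Z$. (It is customary to ask also that $X^\sigma$ preserve $\omega$; this is not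 needed.) Time-dependent objects are $1$-periodic and smooth in time $t$. A $b^m$-function is a function $H_t$, smooth on $\Sigma\setminus Z$, of the form $k(t)\log|z|+\sum_{i=1}^{m-1}g_i(t,z)z^{-i}+h_t$ near each point of $Z$, with $k,g_i,h$ smooth. Its Hamiltonian vector field $X_H$, given by $\iota_{X_H}\omega=-dH_t$, is extended smoothly over $Z$. $H$ is *admissible* if it is a $b^m$-function such that on the part of $\mathcal N\setminus Z$ lying over each component $Z_i$ of $Z$ one has $\mathcal L_{X^\sigma}H_t=k_i(t)$, a smooth function of $t$ alone, such that $\mathcal L_RH_t=0$ on $\mathcal N\setminus Z$, and such that some neighbourhood of $Z$ contains no $1$-periodic orbit of $X_H$. Let $\Sigma_v$ be a connected component of $\Sigma\setminus Z$. Let $I$ be the set of pairs $(C,s)$ of a component $C$ of $Z$ and a sign $s=\pm$ such that $\Sigma_v$ lies on the side $sz>0$ of $C$; $\deg(v)=|I|$ is the degree of $v$ in the associated graph, a curve bounded by $\Sigma_v$ on both sides counting twice. The genus of a connected surface is the maximal number of disjoint simple closed curves whose union does not disconnect it; let $g_v$ be the genus of $\Sigma_v$ (equivalently, of $\Sigma_v$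 with each end filled in by a disk). Put $\mathrm{Int}_\varepsilon(\Sigma_v)=\Sigma_v\setminus\mathcal N_\varepsilon(Z)$. **Proposition.** Let $H$ be admissible. The set $I$ is finite, and there is $\varepsilon_0\in(0,\delta]$ such that for every $0<\varepsilon<\varepsilon_0$ the following holds. There is a closed connected symplectic surface $(\overline\Sigma_v,\omega_v)$ of genus $g_v$, with smoothly embedded open disks $D_i$ $(i\in I)$ whose closures are pairwise disjoint smoothly embedded closed disks, and a symplectomorphism $$\Phi:(\mathrm{Int}_\varepsilon(\Sigma_v),\omega)\to\Big(\overline\Sigma_v\setminus\bigsqcup_{i\in I}D_i,\ \omega_v\Big),$$ extending to a symplectomorphism from an open neighbourhood of $\mathrm{Int}_\varepsilon(\Sigma_v)$ in $\Sigma_v$ onto an open subset of $\overline\Sigma_v$, and carrying the curve $\{x\in\mathcal N:\pi(x)\in C,\ s\,z(x)=\varepsilon\}$ onto $\partial D_i$ for each $i=(C,s)\in I$. Furthermore, there is a smooth time-dependent ($1$-periodic) Hamiltonian $\overline H_t$ on $\overline\Sigma_v$ with Hamiltonian vector field $X_{\overline H}$ and flow $\overline\psi^t$ such that $X_{\overline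 H}\circ\Phi=d\Phi(X_H)$ on $\mathrm{Int}_\varepsilon(\Sigma_v)$; through every $x\in \mathrm{Int}_\varepsilon(\Sigma_v)$ there is an integral curve $\gamma:\mathbb R\to \mathrm{Int}_\varepsilon(\Sigma_v)$ of $X_H$ with $\gamma(0)=x$ and $\Phi(\gamma(t))=\overline\psi^t(\Phi(x))$ for all $t\in\mathbb R$. Moreover, each disk $D_i$ contains exactly one fixed point of the time-one map $\overline\psi^1$, and this point is stationary: $\overline\psi^t$ fixes it for all $t$. -/

import Mathlib

open Set Function Topology Manifold
open scoped ContDiff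

universe u

namespace BmSurface

/-! Throughout, surfaces are smooth manifolds modelled on the Euclidean plane, hence without
boundary. A time-dependent object on the time circle `ℝ/ℤ` is an object depending 1-periodically
on `t : ℝ`. -/

/-- A bilinear form on every tangent space. -/
abbrev TwoTensor (M : Type*) [TopologicalSpace M] [ChartedSpace (EuclideanSpace ℝ (Fin 2)) M] :=
  ∀ x : M, TangentSpace (𝓡 2) x →L[ℝ] TangentSpace (𝓡 2) x →L[ℝ] ℝ

/-- A linear form on every tangent space. -/
abbrev OneTensor (M : Type*) [TopologicalSpace M] [ChartedSpace (EuclideanSpace ℝ (Fin 2)) M] :=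
  ∀ x : M, TangentSpace (𝓡 2) x →L[ℝ] ℝ

/-- A (not necessarily continuous) vector field. -/
abbrev VField (M : Type*) [TopologicalSpace M] [ChartedSpace (EuclideanSpace ℝ (Fin 2)) M] :=
  ∀ x : M, TangentSpace (𝓡 2) x

section Forms

variable {M : Type*} [TopologicalSpace M] [ChartedSpace (EuclideanSpace ℝ (Fin 2)) M]
  [IsManifold (𝓡 2) ∞ M]

/-- `Ω` is a smooth differential 2-form on the set `U`. (On a surface every 2-form is closed,
since there are no nonzero 3-forms.) -/
def IsSmoothTwoFormOn (Ω : TwoTensor M) (U : Set M) : Prop :=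
  (∀ x ∈ U, ∀ v, Ω x v v = 0) ∧
  ContMDiffOn (𝓡 2) ((𝓡 2).prod 𝓘(ℝ, EuclideanSpace ℝ (Fin 2) →L[ℝ]
      EuclideanSpace ℝ (Fin 2) →L[ℝ] ℝ)) ∞
    (fun x => Bundle.TotalSpace.mk' (EuclideanSpace ℝ (Fin 2) →L[ℝ] EuclideanSpace ℝ (Fin 2) →L[ℝ] ℝ)
      (E := fun x : M => TangentSpace (𝓡 2) x →L[ℝ] TangentSpace (𝓡 2) x →L[ℝ] ℝ) x (Ω x)) U

/-- `Ω` is a symplectic form on `U`: a smooth (automatically closed) nondegenerate 2-form. -/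
def IsSymplecticOn (Ω : TwoTensor M) (U : Set M) : Prop :=
  IsSmoothTwoFormOn Ω U ∧ ∀ x ∈ U, ∀ v, (∀ w, Ω x v w = 0) → v = 0

/-- `α` is a smooth 1-form on `U`. -/
def IsSmoothOneFormOn (α : OneTensor M) (U : Set M) : Prop :=
  ContMDiffOn (𝓡 2) ((𝓡 2).prod 𝓘(ℝ, EuclideanSpace ℝ (Fin 2) →L[ℝ] ℝ)) ∞
    (fun x => Bundle.TotalSpace.mk' (EuclideanSpace ℝ (Fin 2) →L[ℝ] ℝ)
      (E := fun x : M => TangentSpace (𝓡 2) x →L[ℝ] ℝ) x (α x)) U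

/-- `X` is a smooth vector field on `U`. -/
def IsSmoothVFieldOn (X : VField M) (U : Set M) : Prop :=
  ContMDiffOn (𝓡 2) (𝓡 2).tangent ∞ (fun x => (⟨x, X x⟩ : TangentBundle (𝓡 2) M)) U

/-- The time-dependent vector field `X` is smooth jointly in time and space. -/
def IsSmoothTimeVField (X : ℝ → VField M) : Prop :=
  ContMDiff (𝓘(ℝ, ℝ).prod (𝓡 2)) (𝓡 2).tangent ∞
    (fun p : ℝ × M => (⟨p.2, X p.1 p.2⟩ : TangentBundle (𝓡 2) M))

/-- The time-dependent function `H` is smooth in `(t, x)` for `t` real and `x` in `U`. -/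
def IsSmoothTimeFunOn (H : ℝ → M → ℝ) (U : Set M) : Prop :=
  ContMDiffOn (𝓘(ℝ, ℝ).prod (𝓡 2)) 𝓘(ℝ, ℝ) ∞ (fun p : ℝ × M => H p.1 p.2) (univ ×ˢ U)

/-- The differential of a real function at `x`. -/
noncomputable def diff (f : M → ℝ) (x : M) : TangentSpace (𝓡 2) x →L[ℝ] ℝ :=
  mfderiv (𝓡 2) 𝓘(ℝ, ℝ) f x

variable (M) in
/-- Orientability: there is a nowhere vanishing smooth 2-form. -/
def Orientable : Prop :=
  ∃ μ : TwoTensor M, IsSmoothTwoFormOn μ univ ∧ ∀ x, μ x ≠ 0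

/-- `z` is a defining function of `Z` on the open set `U`: smooth, regular along `Z`, and `Z` is
its zero set in `U`. -/
def IsDefiningFunctionOn (Z U : Set M) (z : M → ℝ) : Prop :=
  ContMDiffOn (𝓡 2) 𝓘(ℝ, ℝ) ∞ z U ∧ (∀ x ∈ U, x ∈ Z ↔ z x = 0) ∧ ∀ x ∈ U ∩ Z, diff z x ≠ 0

/-- `Z` is a closed embedded hypersurface (a curve). It may be empty. -/
def IsHypersurface (Z : Set M) : Prop :=
  IsClosed Z ∧ ∀ p ∈ Z, ∃ U : Set M, IsOpen U ∧ p ∈ U ∧ ∃ z, IsDefiningFunctionOn Z U z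

/-- `Ω` is a `b^m`-symplectic form on `(M, Z)`. The top exterior power of the `b^m`-cotangent
bundle of a surface is the line bundle which, near a point of `Z`, is generated by
`(dz ∧ dθ) / z^m`, where `z` is a local defining function. Thus `Ω` is a symplectic form off `Z`
and near each point of `Z` it is `z^{-m}` times an ordinary nondegenerate smooth 2-form `η`.
The values of `Ω` at points of `Z` are irrelevant. -/
def IsBmSymplectic (m : ℕ) (Z : Set M) (Ω : TwoTensor M) : Prop :=
  IsSymplecticOn Ω Zᶜ ∧
  ∀ p ∈ Z, ∃ U : Set M, IsOpen U ∧ p ∈ U ∧ ∃ (z : M → ℝ) (η : TwoTensor M),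
    IsDefiningFunctionOn Z U z ∧ IsSymplecticOn η U ∧ ∀ x ∈ U \ Z, η x = (z x) ^ m • Ω x

/-- A trivialised tubular neighbourhood `(z, π) : N ≅ (-δ, δ) × Z` in which `Ω` is given by its
Laurent series `Ω = ∑_{i=1}^m (dz / z^i) ∧ π^* α_i`, together with the Reeb vector field `R` of the
cosymplectic structure `(α_m, 0)` of `Z`, extended to `N` by means of the trivialisation. The
1-forms `α_i` on `Z` are given as restrictions of smooth 1-forms on `N`; only their values on
vectors tangent to `Z` matter. -/
structure AdaptedTube (m : ℕ) (Z : Set M) (Ω : TwoTensor M) where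
  N : Set M
  δ : ℝ
  z : M → ℝ
  π : M → M
  α : ℕ → OneTensor M
  R : VField M
  isOpen : IsOpen N
  subset : Z ⊆ N
  δ_pos : 0 < δ
  z_def : IsDefiningFunctionOn Z N z
  π_smooth : ContMDiffOn (𝓡 2) (𝓡 2) ∞ π N
  π_id : ∀ x ∈ Z, π x = x
  bijOn : BijOn (fun x => (z x, π x)) N (Ioo (-δ) δ ×ˢ Z)
  immersive : ∀ x ∈ N, ∀ v, diff z x v = 0 → mfderiv (𝓡 2) (𝓡 2) π x v = 0 → v = 0
  α_smooth : ∀ i, IsSmoothOneFormOn (α i) N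
  laurent : ∀ x ∈ N \ Z, ∀ v w, Ω x v w = ∑ i ∈ Finset.Icc 1 m, ((z x) ^ i)⁻¹ *
    (diff z x v * α i (π x) (mfderiv (𝓡 2) (𝓡 2) π x w) -
      diff z x w * α i (π x) (mfderiv (𝓡 2) (𝓡 2) π x v))
  R_smooth : IsSmoothVFieldOn R N
  dz_R : ∀ x ∈ N, diff z x (R x) = 0
  α_R : ∀ x ∈ N, α m (π x) (mfderiv (𝓡 2) (𝓡 2) π x (R x)) = 1

variable {m : ℕ} {Z : Set M} {Ω : TwoTensor M}

/-- The `ε`-neighbourhood `N_ε(Z) = {|z| < ε}`. -/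
def AdaptedTube.nhd (T : AdaptedTube m Z Ω) (ε : ℝ) : Set M := {x ∈ T.N | |T.z x| < ε}

/-- `C` is a connected component of `Z`. -/
def IsComponentOf (C Z : Set M) : Prop := ∃ p ∈ Z, C = connectedComponentIn Z p

/-- `X` is a normal `b^m`-vector field on the tube: a smooth vector field on `N` of the form
`u z^m ∂_z + (tangential part)` which, as a section of the `b^m`-tangent bundle along `Z`, is
nowhere zero (`u ≠ 0`) and lies in the kernel of the projection to `TZ` (its tangential part
vanishes on `Z`). Usually `X` is moreover asked to be symplectic; this is not required here, which
only enlarges the class of admissible Hamiltonians below. -/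
def AdaptedTube.IsNormalBmField (T : AdaptedTube m Z Ω) (X : VField M) : Prop :=
  IsSmoothVFieldOn X T.N ∧ (∀ x ∈ Z, X x = 0) ∧
  ∃ u : M → ℝ, ContMDiffOn (𝓡 2) 𝓘(ℝ, ℝ) ∞ u T.N ∧ (∀ x ∈ Z, u x ≠ 0) ∧
    ∀ x ∈ T.N, diff T.z x (X x) = u x * (T.z x) ^ m

/-- `H` is a time-dependent `b^m`-function on `(M, Z)`: 1-periodic in time, smooth off `Z`, and
of the form `k(t) log |z| + ∑_{i=1}^{m-1} g_i(t, z) z^{-i} + h(t, x)` near `Z`. -/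
def AdaptedTube.IsBmFunction (T : AdaptedTube m Z Ω) (H : ℝ → M → ℝ) : Prop :=
  (∀ t, H (t + 1) = H t) ∧ IsSmoothTimeFunOn H Zᶜ ∧
  ∀ p ∈ Z, ∃ U : Set M, IsOpen U ∧ p ∈ U ∧ U ⊆ T.N ∧
    ∃ (k : ℝ → ℝ) (g : ℕ → ℝ → ℝ → ℝ) (h : ℝ → M → ℝ),
      ContDiff ℝ ∞ k ∧ (∀ t, k (t + 1) = k t) ∧
      (∀ i, ContDiff ℝ ∞ (fun q : ℝ × ℝ => g i q.1 q.2) ∧ ∀ t, g i (t + 1) = g i t) ∧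
      IsSmoothTimeFunOn h U ∧ (∀ t, h (t + 1) = h t) ∧
      ∀ t, ∀ x ∈ U \ Z, H t x = k t * Real.log |T.z x| +
        ∑ i ∈ Finset.Icc 1 (m - 1), g i t (T.z x) * ((T.z x) ^ i)⁻¹ + h t x

/-- `X` is the Hamiltonian vector field of `H` with respect to the symplectic form `Ω` on the
complement of `Z`, that is `Ω(X, ·) = -dH`, extended smoothly over `Z`. For `Z = ∅` this is the
usual Hamiltonian vector field. -/
def IsHamiltonianField (Ω : TwoTensor M) (Z : Set M) (H : ℝ → M → ℝ) (X : ℝ → VField M) : Prop :=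
  IsSmoothTimeVField X ∧ ∀ t, ∀ x ∈ Zᶜ, ∀ w, Ω x (X t x) w = - diff (H t) x w

/-- `γ` is an integral curve, defined for all times, of the time-dependent vector field `X`. -/
def IsOrbit (X : ℝ → VField M) (γ : ℝ → M) : Prop :=
  ∀ t, HasMFDerivAt 𝓘(ℝ, ℝ) (𝓡 2) γ t ((1 : ℝ →L[ℝ] ℝ).smulRight (X t (γ t)))

/-- `H`, with Hamiltonian vector field `X`, is admissible with respect to the tube `T` and the
normal field `Xσ`: it is a `b^m`-function which on the tube is linear along `Xσ` and
invariant under the Reeb field, and which has no 1-periodic orbits near `Z`. The function `k`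
may depend on the connected component of `Z`. -/
def AdaptedTube.IsAdmissible (T : AdaptedTube m Z Ω) (Xσ : VField M) (H : ℝ → M → ℝ)
    (X : ℝ → VField M) : Prop :=
  T.IsBmFunction H ∧
  (∀ C, IsComponentOf C Z → ∃ k : ℝ → ℝ, ContDiff ℝ ∞ k ∧ (∀ t, k (t + 1) = k t) ∧
    ∀ t, ∀ x ∈ T.N \ Z, T.π x ∈ C → diff (H t) x (Xσ x) = k t) ∧
  (∀ t, ∀ x ∈ T.N \ Z, diff (H t) x (T.R x) = 0) ∧
  ∃ W : Set M, IsOpen W ∧ Z ⊆ W ∧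
    ¬ ∃ γ : ℝ → M, IsOrbit X γ ∧ (∀ t, γ (t + 1) = γ t) ∧ ∀ t, γ t ∈ W

/-- The ends of a component `V` of `M \ Z`: pairs of a component `C` of `Z` and a side of it
(a sign) on which `V` lies. Their number is the degree of `V` as a vertex of the graph whose
vertices and edges are the components of `M \ Z` and of `Z`; a curve with `V` on both sides (a loop
of the graph) counts twice. -/
def AdaptedTube.ends (T : AdaptedTube m Z Ω) (V : Set M) : Set (Set M × ℤˣ) :=
  {e | IsComponentOf e.1 Z ∧
    {x ∈ T.N | T.π x ∈ e.1 ∧ 0 < ((e.2 : ℤ) : ℝ) * T.z x} ⊆ V}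

/-- The parallel curve at height `ε` on the given side of the given component of `Z`. -/
def AdaptedTube.parallel (T : AdaptedTube m Z Ω) (e : Set M × ℤˣ) (ε : ℝ) : Set M :=
  {x ∈ T.N | T.π x ∈ e.1 ∧ ((e.2 : ℤ) : ℝ) * T.z x = ε}

/-- `D` is a smoothly embedded open disk whose closure is a smoothly embedded closed disk. -/
def IsSmoothDisk (D : Set M) : Prop :=
  ∃ c ∈ IsManifold.maximalAtlas (𝓡 2) ∞ M,
    Metric.closedBall 0 1 ⊆ c.target ∧ D = c.symm '' Metric.ball 0 1

/-- `ψ` is the flow, starting at time `0`, of the time-dependent vector field `X`. -/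
def IsFlow (X : ℝ → VField M) (ψ : ℝ → M → M) : Prop :=
  (∀ x, ψ 0 x = x) ∧ ∀ x, IsOrbit X (fun t => ψ t x)

end Forms

/-- The genus of a connected surface: the largest number of pairwise disjoint simple closed curves
whose union does not disconnect it. It is defined for closed and for open surfaces; filling in
disks at the ends of an orientable surface does not change it. -/
noncomputable def genus (X : Type*) [TopologicalSpace X] : ℕ∞ :=
  ⨆ n ∈ {n : ℕ | ∃ c : Fin n → C(Circle, X), (∀ i, Injective (c i)) ∧
    Pairwise (fun i j => Disjoint (range (c i)) (range (c j))) ∧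
    IsConnected (⋃ i, range (c i))ᶜ}, (n : ℕ∞)

end BmSurface

set_option linter.unusedSectionVars false
namespace BmSurface

/-! The ends of `V` are sides of components of `Z`. Each component is a closed Reeb orbit of some
period P (`IsReebCurve.range_eq`, `IsReebCurve.exists_period`), so an end has coordinates (w, τ):
the height w = s z > 0 and the Reeb time τ modulo P. There Ω = f(w, τ) dw ∧ dτ with f nowhere zero.
Put B(w) = (1/2π) ∫₀^P f dτ and θ = (1/B) ∫₀^τ f dτ. Then θ is an angle, whatever the sign of f, and
Ω = B(w) dw ∧ dθ.

Let a = ε/2 and trade the height for a radius by w = a + a r². In the Cartesian coordinates of (r,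
θ) the form becomes 2a B(a + a r²) dx ∧ dy. Its density is smooth and nonzero even at r = 0, because
w stays at least a and so away from the singularity at w = 0. The part of an end above height ε/2 is
therefore a punctured disk whose symplectic form extends over the puncture (`exists_capChart`). The
closed surface is V minus {|z| ≤ ε/2} with one point added per end (`CapData.Capped`, `exists_cut`),
and Φ is the inclusion. The circle r = 1 lies at height ε, so the unit disks are the caps.

Invariance under the Reeb field makes H on an end a function of (t, w), hence of (t, r²). It extends
smoothly over the centre, which is a critical point, and its Hamiltonian field is tangent to the
circles around the centre (`CapData.Ham`). Hence centres are stationary, while the caps and their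
complement are invariant. A second fixed point of the time-one map in a cap would yield, by
uniqueness of orbits, a 1-periodic orbit of the original field in ε/2 < |z| < ε (`exists_flow`).
This is excluded once {|z| < ε₀} lies in the neighbourhood of Z free of 1-periodic orbits.

For the genus, V is homeomorphic to V minus {|z| ≤ ε/2} by stretching heights
(`exists_homeo_shrunk`), and adding finitely many points leaves the genus alone
(`genus_compl_finite`). Indeed, the points can be moved off any finite system of simple closed
curves by an ambient homeomorphism, and deleting finitely many points does not disconnect a
connected open subset of a surface. -/

/-- The Euclidean plane. -/
abbrev Plane := EuclideanSpace ℝ (Fin 2)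

lemma one_lt_rank_plane : 1 < Module.rank ℝ Plane := by
  rw [← Module.finrank_eq_rank, finrank_euclideanSpace]
  simp

/-! ### Topological invariance of the genus. -/

section GenusInvariance

/-- A family of `n` disjoint simple closed curves with connected complement. -/
def HasCutSystem (X : Type*) [TopologicalSpace X] (n : ℕ) : Prop :=
  ∃ c : Fin n → C(Circle, X), (∀ i, Injective (c i)) ∧
    Pairwise (fun i j => Disjoint (range (c i)) (range (c j))) ∧
    IsConnected (⋃ i, range (c i))ᶜ

lemma genus_le_of_hasCutSystem {X Y : Type*} [TopologicalSpace X] [TopologicalSpace Y]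
    (h : ∀ n, HasCutSystem X n → HasCutSystem Y n) : genus X ≤ genus Y :=
  iSup₂_mono' fun n hn => ⟨n, h n hn, le_rfl⟩

lemma HasCutSystem.map_homeomorph {X Y : Type*} [TopologicalSpace X] [TopologicalSpace Y]
    (e : X ≃ₜ Y) {n : ℕ} (h : HasCutSystem X n) : HasCutSystem Y n := by
  obtain ⟨c, h1, h2, h3⟩ := h
  have hr : ∀ i, range ((⟨e, e.continuous⟩ : C(X, Y)).comp (c i)) = e '' range (c i) := by
    intro i
    rw [ContinuousMap.coe_comp, range_comp]
    rfl
  refine ⟨fun i => (⟨e, e.continuous⟩ : C(X, Y)).comp (c i), fun i => ?_, fun i j hij => ?_, ?_⟩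
  · exact e.injective.comp (h1 i)
  · change Disjoint (range _) (range _)
    rw [hr i, hr j]
    exact (disjoint_image_iff e.injective).2 (h2 hij)
  · simp_rw [hr]
    rw [← image_iUnion, ← image_compl_eq e.bijective]
    exact h3.image _ e.continuous.continuousOn

lemma genus_congr {X Y : Type*} [TopologicalSpace X] [TopologicalSpace Y] (e : X ≃ₜ Y) :
    genus X = genus Y :=
  le_antisymm (genus_le_of_hasCutSystem fun _ h => h.map_homeomorph e)
    (genus_le_of_hasCutSystem fun _ h => h.map_homeomorph e.symm)

end GenusInvariance

/-! ### Deleting finitely many points from a connected open set. -/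

section Punctures

variable {S : Type*} [TopologicalSpace S] [T2Space S] [ChartedSpace Plane S]

/-- Every neighbourhood of a point of a surface contains a coordinate ball around the point. -/
lemma exists_coordinate_ball {q : S} {U : Set S} (hU : U ∈ 𝓝 q) :
    ∃ r > 0, Metric.closedBall (chartAt Plane q q) r ⊆ (chartAt Plane q).target ∧
      (chartAt Plane q).symm '' Metric.closedBall (chartAt Plane q q) r ⊆ U := by
  set c := chartAt Plane q
  have hq : q ∈ c.source := mem_chart_source _ q
  have h1 : c.target ∩ c.symm ⁻¹' U ∈ 𝓝 (c q) := by
    refine Filter.inter_mem (c.open_target.mem_nhds (c.map_source hq)) ?_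
    apply (c.continuousAt_symm (c.map_source hq)).preimage_mem_nhds
    rwa [c.left_inv hq]
  obtain ⟨r, hr, hs⟩ := Metric.nhds_basis_closedBall.mem_iff.1 h1
  exact ⟨r, hr, fun x hx => (hs hx).1, image_subset_iff.2 fun x hx => (hs hx).2⟩

lemma isConnected_ball_diff_center (x : Plane) {r : ℝ} (hr : 0 < r) :
    IsConnected (Metric.ball x r \ {x}) := by
  set e := OpenPartialHomeomorph.univBall x r
  have h0 : e 0 = x := OpenPartialHomeomorph.univBall_apply_zero x r
  have hs : e.source = univ := OpenPartialHomeomorph.univBall_source x r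
  have ht : e.target = Metric.ball x r := OpenPartialHomeomorph.univBall_target x hr
  have : Metric.ball x r \ {x} = e '' {0}ᶜ := by
    rw [← ht, ← e.image_source_eq_target, hs, ← h0, ← image_singleton,
      ← image_sdiff (by rw [← injOn_univ, ← hs]; exact e.injOn), compl_eq_univ_sdiff]
  rw [this]
  refine (isConnected_compl_singleton_of_one_lt_rank one_lt_rank_plane 0).image _ ?_
  exact e.continuousOn.mono (by simp [hs])

/-- A small punctured coordinate ball. -/
lemma exists_punctured_ball {q : S} {U : Set S} (hU : U ∈ 𝓝 q) :
    ∃ B : Set S, IsOpen B ∧ q ∈ B ∧ B ⊆ U ∧ IsConnected B ∧ IsConnected (B \ {q}) := by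
  obtain ⟨r, hr, h1, h2⟩ := exists_coordinate_ball hU
  set c := chartAt Plane q
  have hq : q ∈ c.source := mem_chart_source _ q
  have h1' : Metric.ball (c q) r ⊆ c.target := Metric.ball_subset_closedBall.trans h1
  refine ⟨c.symm '' Metric.ball (c q) r,
    c.symm.isOpen_image_of_subset_source Metric.isOpen_ball h1',
    ⟨c q, Metric.mem_ball_self hr, c.left_inv hq⟩,
    (image_mono Metric.ball_subset_closedBall).trans h2,
    (Metric.isConnected_ball hr).image _ (c.continuousOn_symm.mono h1'), ?_⟩
  have : c.symm '' Metric.ball (c q) r \ {q} = c.symm '' (Metric.ball (c q) r \ {c q}) := by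
    ext x
    constructor
    · rintro ⟨⟨y, hy, rfl⟩, hx⟩
      refine ⟨y, ⟨hy, fun h => hx ?_⟩, rfl⟩
      rw [mem_singleton_iff] at h ⊢
      rw [h, c.left_inv hq]
    · rintro ⟨y, ⟨hy, hy'⟩, rfl⟩
      refine ⟨⟨y, hy, rfl⟩, fun h => hy' ?_⟩
      rw [mem_singleton_iff] at h ⊢
      rw [← h, c.right_inv (h1' hy)]
  rw [this]
  exact (isConnected_ball_diff_center _ hr).image _
    (c.continuousOn_symm.mono (sdiff_subset.trans h1'))

lemma nhdsNE_neBot_of_surface (q : S) : (𝓝[≠] q).NeBot := by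
  rw [← mem_closure_iff_nhdsWithin_neBot, mem_closure_iff_nhds]
  intro U hU
  obtain ⟨B, -, -, hBU, -, ⟨x, hx⟩, -⟩ := exists_punctured_ball hU
  exact ⟨x, hBU hx.1, hx.2⟩

/-- A small punctured ball around the point is connected, so it lies in one half of any separation
of the punctured set. Filling the ball back into that half would separate the original set. -/
lemma IsConnected.diff_singleton_of_isOpen {U : Set S} (hU : IsOpen U) (hc : IsConnected U)
    (q : S) : IsConnected (U \ {q}) := by
  by_cases hq : q ∈ U
  swap
  · rwa [sdiff_singleton_eq_self hq]
  obtain ⟨B, hB, hqB, hBU, -, hBc⟩ := exists_punctured_ball (hU.mem_nhds hq)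
  refine ⟨hBc.nonempty.mono fun x hx => ⟨hBU hx.1, hx.2⟩, ?_⟩
  -- The half containing the punctured ball is enlarged by the ball and the other half is kept off
  -- `q`. Connectedness of `U` then gives a common point, necessarily different from `q`.
  have key : ∀ A A' : Set S, IsOpen A → IsOpen A' → U \ {q} ⊆ A ∪ A' → B \ {q} ⊆ A →
      (U \ {q} ∩ A').Nonempty → (U \ {q} ∩ (A ∩ A')).Nonempty := by
    intro A A' hA hA' hs hBA ⟨y, hy, hyA'⟩
    have hq1 : IsOpen ({q}ᶜ : Set S) := isOpen_compl_singleton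
    have hcov : U ⊆ (A ∪ B) ∪ (A' ∩ {q}ᶜ) := by
      intro x hx
      by_cases hxq : x = q
      · exact Or.inl (Or.inr (hxq ▸ hqB))
      · rcases hs ⟨hx, hxq⟩ with h | h
        · exact Or.inl (Or.inl h)
        · exact Or.inr ⟨h, hxq⟩
    obtain ⟨x, hxU, hx1, hx2⟩ := hc.isPreconnected (A ∪ B) (A' ∩ {q}ᶜ) (hA.union hB)
      (hA'.inter hq1) hcov ⟨q, hq, Or.inr hqB⟩ ⟨y, hy.1, hyA', hy.2⟩
    refine ⟨x, ⟨hxU, hx2.2⟩, ?_, hx2.1⟩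
    rcases hx1 with h | h
    · exact h
    · exact hBA ⟨h, hx2.2⟩
  intro A A' hA hA' hs hne hne'
  by_contra hcon
  rw [not_nonempty_iff_eq_empty] at hcon
  have hsub : B \ {q} ⊆ U \ {q} := sdiff_subset_sdiff_left hBU
  rcases isPreconnected_iff_subset_of_disjoint.1 hBc.isPreconnected A A' hA hA' (hsub.trans hs)
    (subset_eq_empty (inter_subset_inter_left _ hsub) hcon) with h | h
  · exact (key A A' hA hA' hs h hne').ne_empty hcon
  · exact (key A' A hA' hA (by rwa [union_comm]) h hne).ne_empty (by rwa [inter_comm A'])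

lemma IsConnected.diff_finite_of_isOpen {U F : Set S} (hU : IsOpen U) (hc : IsConnected U)
    (hF : F.Finite) : IsConnected (U \ F) := by
  induction F, hF using Set.Finite.induction_on with
  | empty => simpa
  | @insert a s _ hs ih =>
    have : U \ insert a s = (U \ s) \ {a} := by ext; simp; tauto
    rw [this]
    exact IsConnected.diff_singleton_of_isOpen (hU.sdiff hs.isClosed) ih a

end Punctures

/-! ### Simple closed curves in a surface have empty interior. -/

section Circle

/-- Two points disconnect the circle and one does not. If `W` punctured at `x` were connected, it
would sit in one half of a separation of the circle minus `x` and `w`. Adding `W` to that half would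
separate the circle minus `w`. -/
lemma Circle.not_isPreconnected_diff_singleton {W : Set Circle} (hW : IsOpen W) {x w : Circle}
    (hx : x ∈ W) (hw : w ∉ W) : ¬ IsPreconnected (W \ {x}) := by
  intro hp
  have hxw : x ≠ w := fun h => hw (h ▸ hx)
  refine Circle.not_isPreconnected_compl_pair hxw ?_
  have key : ∀ A A' : Set Circle, IsOpen A → IsOpen A' → {x, w}ᶜ ⊆ A ∪ A' → W \ {x} ⊆ A →
      ({x, w}ᶜ ∩ A').Nonempty → ({x, w}ᶜ ∩ (A ∩ A')).Nonempty := by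
    intro A A' hA hA' hs hWA ⟨y, hy, hyA'⟩
    have h1 : IsOpen ({x, w}ᶜ : Set Circle) := (Set.toFinite _).isClosed.isOpen_compl
    have hcov : {w}ᶜ ⊆ (A ∪ W) ∪ (A' ∩ {x, w}ᶜ) := by
      intro u hu
      by_cases hux : u = x
      · exact Or.inl (Or.inr (hux ▸ hx))
      · have hu' : u ∈ ({x, w}ᶜ : Set Circle) := by
          intro h
          rcases h with h | h
          exacts [hux h, hu h]
        rcases hs hu' with h | h
        · exact Or.inl (Or.inl h)
        · exact Or.inr ⟨h, hu'⟩
    obtain ⟨u, hu, hu1, hu2⟩ := (Circle.isPathConnected_compl_singleton w).isConnected.isPreconnected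
      (A ∪ W) (A' ∩ {x, w}ᶜ) (hA.union hW) (hA'.inter h1) hcov
      ⟨x, hxw, Or.inr hx⟩ ⟨y, fun h => hy (Or.inr h), hyA', hy⟩
    refine ⟨u, hu2.2, ?_, hu2.1⟩
    rcases hu1 with h | h
    · exact h
    · exact hWA ⟨h, fun h' => hu2.2 (Or.inl h')⟩
  intro A A' hA hA' hs hne hne'
  by_contra hcon
  rw [not_nonempty_iff_eq_empty] at hcon
  have hsub : W \ {x} ⊆ {x, w}ᶜ := by
    rintro y ⟨hy, hyx⟩ (h | h)
    exacts [hyx h, hw (h ▸ hy)]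
  rcases isPreconnected_iff_subset_of_disjoint.1 hp A A' hA hA' (hsub.trans hs)
    (subset_eq_empty (inter_subset_inter_left _ hsub) hcon) with h | h
  · exact (key A A' hA hA' hs h hne').ne_empty hcon
  · exact (key A' A hA' hA (by rwa [union_comm]) h hne).ne_empty (by rwa [inter_comm A'])

variable {S : Type*} [TopologicalSpace S] [T2Space S] [ChartedSpace Plane S]

/-- A simple closed curve in a surface has empty interior. -/
lemma interior_range_circle_eq_empty (c : C(Circle, S)) (hc : Injective c) :
    interior (range c) = ∅ := by
  by_contra hne
  obtain ⟨q, hq⟩ := nonempty_iff_ne_empty.2 hne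
  obtain ⟨B, hB, hqB, hBU, hBc, -⟩ := exists_punctured_ball (isOpen_interior.mem_nhds hq)
  have hBr : B ⊆ range c := hBU.trans interior_subset
  have hemb : IsInducing c := (c.continuous.isClosedEmbedding hc).isInducing
  have hpre : ∀ A ⊆ B, IsConnected A → IsPreconnected (c ⁻¹' A) := by
    intro A hA h
    -- The curve is an embedding of a compact space, so connected subsets of the ball pull back to
    -- connected subsets of the circle. A disk stays connected after deleting points, whereas pieces
    -- of the circle do not.
    rw [← hemb.isPreconnected_image, image_preimage_eq_of_subset (hA.trans hBr)]
    exact h.isPreconnected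
  have hWo : IsOpen (c ⁻¹' B) := hB.preimage c.continuous
  obtain ⟨x, rfl⟩ := hBr hqB
  have hsing : ∀ y, c ⁻¹' {c y} = {y} := fun y => by
    ext z
    exact hc.eq_iff
  have h1 : IsConnected (B \ {c x}) := IsConnected.diff_singleton_of_isOpen hB hBc _
  by_cases hW : ∃ w, w ∉ c ⁻¹' B
  · obtain ⟨w, hw⟩ := hW
    have := hpre _ sdiff_subset h1
    rw [preimage_sdiff, hsing] at this
    exact Circle.not_isPreconnected_diff_singleton hWo hqB hw this
  -- Here the preimage of the ball is the whole circle, which survives the loss of one point, so two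
  -- points are deleted.
  · push Not at hW
    obtain ⟨y, hxy⟩ : ∃ y, x ≠ y := by
      obtain ⟨p, hp⟩ := h1.nonempty
      obtain ⟨y, rfl⟩ := hBr hp.1
      exact ⟨y, fun h => hp.2 (h ▸ rfl)⟩
    have h2 : IsConnected ((B \ {c x}) \ {c y}) :=
      IsConnected.diff_singleton_of_isOpen (hB.sdiff isClosed_singleton) h1 _
    have := hpre _ (sdiff_subset.trans sdiff_subset) h2
    rw [preimage_sdiff, preimage_sdiff, hsing, hsing] at this
    refine Circle.not_isPreconnected_compl_pair hxy ?_
    convert this using 1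
    ext z
    simp [hW z]

lemma isClosed_iUnion_range_circle {n : ℕ} (c : Fin n → C(Circle, S)) :
    IsClosed (⋃ i, range (c i)) :=
  isClosed_iUnion_of_finite fun i => (isCompact_range (c i).continuous).isClosed

lemma interior_iUnion_range_circle_eq_empty {n : ℕ} (c : Fin n → C(Circle, S))
    (hc : ∀ i, Injective (c i)) : interior (⋃ i, range (c i)) = ∅ := by
  have : ∀ s : Finset (Fin n), interior (⋃ i ∈ s, range (c i)) = ∅ := by
    intro s
    induction s using Finset.induction_on with
    | empty => simp
    | insert a s _ ih =>
      rw [Finset.set_biUnion_insert, interior_union_isClosed_of_interior_empty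
        (isCompact_range (c a).continuous).isClosed ih]
      exact interior_range_circle_eq_empty _ (hc a)
  simpa using this Finset.univ

end Circle

/-! ### Moving points by compactly supported homeomorphisms; genus and punctures. -/

section PointPushing

/-- A homeomorphism of a normed space moving the origin to a given point of the open unit ball and
fixing all points outside of this ball. -/
lemma exists_homeomorph_fixing_compl_unit_ball {E : Type*} [NormedAddCommGroup E]
    [NormedSpace ℝ E] [CompleteSpace E] {p : E} (hp : ‖p‖ < 1) :
    ∃ h : E ≃ₜ E, h 0 = p ∧ ∀ x, 1 ≤ ‖x‖ → h x = x := by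
  -- A perturbation of the identity with Lipschitz constant at most `‖p‖ < 1`, hence a homeomorphism
  -- by the Lipschitz inverse function theorem.
  set f : E → E := fun x => x + max 0 (1 - ‖x‖) • p with hf
  have happ : ApproximatesLinearOn f ((ContinuousLinearEquiv.refl ℝ E : E ≃L[ℝ] E) : E →L[ℝ] E)
      univ ‖p‖₊ := by
    intro x _ y _
    have h1 : f x - f y - ((ContinuousLinearEquiv.refl ℝ E : E ≃L[ℝ] E) : E →L[ℝ] E) (x - y) =
        (max 0 (1 - ‖x‖) - max 0 (1 - ‖y‖)) • p := by
      simp only [hf, ContinuousLinearEquiv.coe_refl, ContinuousLinearMap.id_apply, sub_smul]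
      abel
    rw [h1, norm_smul, mul_comm, coe_nnnorm]
    gcongr
    rw [Real.norm_eq_abs]
    calc |max 0 (1 - ‖x‖) - max 0 (1 - ‖y‖)| ≤ |(1 - ‖x‖) - (1 - ‖y‖)| :=
          abs_max_sub_max_le_abs _ _ _ |>.trans_eq'
            (by rw [max_comm, max_comm 0 (1 - ‖y‖)])
      _ = |‖y‖ - ‖x‖| := by ring_nf
      _ ≤ ‖y - x‖ := abs_norm_sub_norm_le y x
      _ = ‖x - y‖ := norm_sub_rev _ _
  have hc : Subsingleton E ∨ ‖p‖₊ < ‖((ContinuousLinearEquiv.refl ℝ E).symm : E →L[ℝ] E)‖₊⁻¹ := by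
    rcases subsingleton_or_nontrivial E with h | h
    · exact Or.inl h
    · right
      simp only [ContinuousLinearEquiv.refl_symm, ContinuousLinearEquiv.coe_refl]
      rw [show ‖ContinuousLinearMap.id ℝ E‖₊ = 1 from NNReal.eq ContinuousLinearMap.norm_id,
        inv_one]
      exact_mod_cast hp
  refine ⟨happ.toHomeomorph f hc, ?_, fun x hx => ?_⟩
  · change f 0 = p
    simp [hf]
  · change f x = x
    simp [hf, max_eq_left (sub_nonpos.2 hx)]

variable {S : Type*} [TopologicalSpace S] [T2Space S]

open Classical in
/-- A self-map of the model space, carried to the domain of a chart and extended by the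
identity. -/
noncomputable def extendChart {E : Type*} [TopologicalSpace E] (c : OpenPartialHomeomorph S E)
    (f : E → E) (x : S) : S := if x ∈ c.source then c.symm (f (c x)) else x

/-- A point of `T` sent outside `T` would have a fixed image. By injectivity it would equal that
image. -/
lemma mapsTo_target_of_fixes {E : Type*} {A T : Set E} (hAT : A ⊆ T) {f : E → E}
    (hf : Injective f) (hfA : ∀ x ∉ A, f x = x) : MapsTo f T T := by
  intro x hx
  by_contra h
  have h1 := hf (hfA (f x) fun h' => h (hAT h'))
  rw [h1] at h
  exact h hx

/-- The image of the compact support is closed since the surface is Hausdorff. Off it the extension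
is the identity, and the chart domain covers the rest. -/
lemma continuous_extendChart {E : Type*} [TopologicalSpace E] (c : OpenPartialHomeomorph S E)
    {f : E → E} (hf : Continuous f) (hi : Injective f) {A : Set E} (hA : IsCompact A)
    (hAt : A ⊆ c.target) (hfA : ∀ x ∉ A, f x = x) : Continuous (extendChart c f) := by
  have hcl : IsClosed (c.symm '' A) :=
    (hA.image_of_continuousOn (c.continuousOn_symm.mono hAt)).isClosed
  have hmaps := mapsTo_target_of_fixes hAt hi hfA
  rw [continuous_iff_continuousAt]
  intro x
  by_cases hx : x ∈ c.source
  · have : ContinuousOn (extendChart c f) c.source := by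
      refine ContinuousOn.congr (f := fun x => c.symm (f (c x))) ?_ fun y hy => if_pos hy
      exact c.continuousOn_symm.comp (hf.comp_continuousOn c.continuousOn)
        fun y hy => hmaps (c.map_source hy)
    exact this.continuousAt (c.open_source.mem_nhds hx)
  · have hx' : x ∈ (c.symm '' A)ᶜ := by
      rintro ⟨y, hy, rfl⟩
      exact hx (c.map_target (hAt hy))
    refine continuousAt_id.congr ?_
    filter_upwards [hcl.isOpen_compl.mem_nhds hx'] with y hy
    unfold extendChart
    split_ifs with h
    · rw [hfA, c.left_inv h]
      · rfl
      · exact fun h' => hy ⟨_, h', c.left_inv h⟩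
    · rfl

lemma extendChart_leftInverse {E : Type*} [TopologicalSpace E] (c : OpenPartialHomeomorph S E)
    {f g : E → E} (hgf : ∀ x, g (f x) = x) (hm : MapsTo f c.target c.target) (x : S) :
    extendChart c g (extendChart c f x) = x := by
  by_cases hx : x ∈ c.source
  · have h1 : extendChart c f x = c.symm (f (c x)) := if_pos hx
    have h2 := hm (c.map_source hx)
    have h3 : extendChart c g (c.symm (f (c x))) = c.symm (g (c (c.symm (f (c x))))) :=
      if_pos (c.map_target h2)
    rw [h1, h3, c.right_inv h2, hgf, c.left_inv hx]
  · have h1 : extendChart c f x = x := if_neg hx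
    have h2 : extendChart c g x = x := if_neg hx
    rw [h1, h2]

variable [ChartedSpace Plane S]

/-- A point of a surface can be moved off a closed set with empty interior by a homeomorphism
supported in a given neighbourhood. -/
lemma exists_homeomorph_moving_point {K : Set S} (hK : interior K = ∅) {q : S} {U : Set S}
    (hU : U ∈ 𝓝 q) : ∃ h : S ≃ₜ S, h q ∉ K ∧ ∀ x ∉ U, h x = x := by
  obtain ⟨r, hr, h1, h2⟩ := exists_coordinate_ball hU
  set c := chartAt Plane q
  have hq : q ∈ c.source := mem_chart_source _ q
  set a := c q
  have hb : Metric.ball a r ⊆ c.target := Metric.ball_subset_closedBall.trans h1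
  have hop : IsOpen (c.symm '' Metric.ball a r) :=
    c.symm.isOpen_image_of_subset_source Metric.isOpen_ball hb
  obtain ⟨p, hp, hpK⟩ : ∃ p ∈ Metric.ball a r, c.symm p ∉ K := by
    by_contra! hcon
    have : c.symm '' Metric.ball a r ⊆ interior K :=
      hop.subset_interior_iff.2 (image_subset_iff.2 hcon)
    rw [hK] at this
    exact this ⟨a, Metric.mem_ball_self hr, rfl⟩
  obtain ⟨g, hg0, hg⟩ := exists_homeomorph_fixing_compl_unit_ball (p := r⁻¹ • (p - a)) (by
    rw [norm_smul, norm_inv, Real.norm_of_nonneg hr.le, inv_mul_lt_iff₀ hr, mul_one]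
    simpa [dist_eq_norm] using hp)
  let s : Plane ≃ₜ Plane := (Homeomorph.subRight a).trans (Homeomorph.smulOfNeZero r⁻¹ (by positivity))
  have hs : ∀ x, s x = r⁻¹ • (x - a) := fun x => rfl
  let f : Plane ≃ₜ Plane := (s.trans g).trans s.symm
  have hfA : ∀ x ∉ Metric.closedBall a r, f x = x := by
    intro x hx
    change s.symm (g (s x)) = x
    rw [hg, s.symm_apply_apply]
    rw [hs, norm_smul, norm_inv, Real.norm_of_nonneg hr.le, ← div_eq_inv_mul, one_le_div hr]
    simp only [Metric.mem_closedBall, dist_eq_norm, not_le] at hx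
    exact hx.le
  have hfA' : ∀ x ∉ Metric.closedBall a r, f.symm x = x := fun x hx => by
    rw [Homeomorph.symm_apply_eq, hfA x hx]
  have hfa : f a = p := by
    change s.symm (g (s a)) = p
    rw [hs, sub_self, smul_zero, hg0, Homeomorph.symm_apply_eq, hs]
  have hcomp : IsCompact (Metric.closedBall a r) := isCompact_closedBall a r
  have m1 := mapsTo_target_of_fixes h1 f.injective hfA
  have m2 := mapsTo_target_of_fixes h1 f.symm.injective hfA'
  refine ⟨{ toFun := extendChart c f
            invFun := extendChart c f.symm
            left_inv := extendChart_leftInverse c f.symm_apply_apply m1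
            right_inv := extendChart_leftInverse c f.apply_symm_apply m2
            continuous_toFun := continuous_extendChart c f.continuous f.injective hcomp h1 hfA
            continuous_invFun :=
              continuous_extendChart c f.symm.continuous f.symm.injective hcomp h1 hfA' }, ?_, ?_⟩
  · change extendChart c f q ∉ K
    rw [extendChart, if_pos hq, hfa]
    exact hpK
  · intro x hx
    change extendChart c f x = x
    unfold extendChart
    split_ifs with h
    · rw [hfA, c.left_inv h]
      exact fun h' => hx (h2 ⟨_, h', c.left_inv h⟩)
    · rfl

/-- The points are moved one at a time, each push being supported away from the present positions of
the points already treated. -/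
lemma exists_homeomorph_moving_finite {K : Set S} (hK : interior K = ∅) {F : Set S}
    (hF : F.Finite) : ∃ h : S ≃ₜ S, ∀ q ∈ F, h q ∉ K := by
  induction F, hF using Set.Finite.induction_on with
  | empty => exact ⟨Homeomorph.refl S, by simp⟩
  | @insert a s ha hs ih =>
    obtain ⟨h, hh⟩ := ih
    obtain ⟨h', h1, h2⟩ := exists_homeomorph_moving_point hK (q := h a) (U := (h '' s)ᶜ)
      ((hs.image h).isClosed.isOpen_compl.mem_nhds fun ⟨x, hx, hxa⟩ => ha (h.injective hxa ▸ hx))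
    refine ⟨h.trans h', fun q hq => ?_⟩
    rcases hq with rfl | hq
    · exact h1
    · change h' (h q) ∉ K
      rw [h2 _ fun h3 => h3 ⟨q, hq, rfl⟩]
      exact hh q hq

/-- Removing finitely many points does not change the genus. -/
theorem genus_compl_finite {F : Set S} (hF : F.Finite) :
    genus (Fᶜ : Set S) = genus S := by
  refine le_antisymm (genus_le_of_hasCutSystem ?_) (genus_le_of_hasCutSystem ?_)
  · rintro n ⟨c, h1, h2, h3⟩
    let c' : Fin n → C(Circle, S) := fun i => (⟨Subtype.val, continuous_subtype_val⟩ :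
      C((Fᶜ : Set S), S)).comp (c i)
    have hr : ∀ i, range (c' i) = Subtype.val '' range (c i) := fun i => by
      rw [← range_comp]
      rfl
    have hK : (⋃ i, range (c' i)) = Subtype.val '' ⋃ i, range (c i) := by
      rw [image_iUnion]
      exact iUnion_congr hr
    refine ⟨c', fun i => Subtype.val_injective.comp (h1 i), fun i j hij => ?_, ?_⟩
    · change Disjoint (range (c' i)) (range (c' j))
      rw [hr, hr]
      exact (disjoint_image_iff Subtype.val_injective).2 (h2 hij)
    · have hcl := isClosed_iUnion_range_circle c'
      have hne : ∀ x : S, (𝓝[≠] x).NeBot := nhdsNE_neBot_of_surface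
      have hA := h3.image _ (continuous_subtype_val (p := fun x => x ∈ Fᶜ)).continuousOn
      have hAeq : Subtype.val '' (⋃ i, range (c i))ᶜ = (⋃ i, range (c' i))ᶜ ∩ Fᶜ := by
        rw [hK]
        ext x
        simp only [mem_image, mem_compl_iff, Subtype.exists, mem_inter_iff]
        constructor
        · rintro ⟨y, hy, h, rfl⟩
          exact ⟨fun ⟨z, _, h', hz⟩ => h (by convert h'; exact hz.symm), hy⟩
        · rintro ⟨h, hx⟩
          exact ⟨x, hx, fun h' => h ⟨x, hx, h', rfl⟩, rfl⟩
      -- The complement of the curves in `S` lies between the connected complement with `F` deleted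
      -- and its closure, because `Fᶜ` is dense.
      refine IsConnected.subset_closure hA ?_ ?_
      · rw [hAeq]
        exact inter_subset_left
      · rw [hAeq]
        have hd : Dense Fᶜ := by
          simpa [compl_eq_univ_sdiff] using dense_univ.sdiff_finite hF
        exact hd.open_subset_closure_inter hcl.isOpen_compl
  · rintro n ⟨c, h1, h2, h3⟩
    have hKi := interior_iUnion_range_circle_eq_empty c h1
    have hKc := isClosed_iUnion_range_circle c
    -- Moving `F` off the curves by `h` amounts to moving the curves off `F` by `h.symm`.
    obtain ⟨h, hh⟩ := exists_homeomorph_moving_finite hKi hF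
    have hmem : ∀ i θ, h.symm (c i θ) ∈ Fᶜ := fun i θ hF' =>
      hh _ hF' (by rw [h.apply_symm_apply]; exact mem_iUnion.2 ⟨i, θ, rfl⟩)
    let c' : Fin n → C(Circle, (Fᶜ : Set S)) := fun i =>
      ⟨fun θ => ⟨h.symm (c i θ), hmem i θ⟩, by fun_prop⟩
    have hc' : ∀ i θ, (c' i θ : S) = h.symm (c i θ) := fun i θ => rfl
    refine ⟨c', fun i θ θ' hθ => h1 i (h.symm.injective (congrArg Subtype.val hθ)),
      fun i j hij => ?_, ?_⟩
    · refine disjoint_left.2 ?_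
      rintro x ⟨θ, rfl⟩ ⟨θ', hθ⟩
      exact disjoint_left.1 (h2 hij) ⟨θ, rfl⟩
        ⟨θ', h.symm.injective (congrArg Subtype.val hθ)⟩
    · have hc1 : IsConnected (h.symm '' (⋃ i, range (c i))ᶜ \ F) :=
        IsConnected.diff_finite_of_isOpen (h.symm.isOpenMap _ hKc.isOpen_compl)
          (h3.image _ h.symm.continuous.continuousOn) hF
      have heq : h.symm '' (⋃ i, range (c i))ᶜ \ F = Subtype.val '' (⋃ i, range (c' i))ᶜ := by
        ext x
        simp only [mem_image, mem_compl_iff, mem_iUnion, mem_range, not_exists, mem_sdiff]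
        constructor
        · rintro ⟨⟨y, hy, rfl⟩, hx⟩
          exact ⟨⟨h.symm y, hx⟩, fun i θ hθ =>
            hy i θ (h.symm.injective (congrArg Subtype.val hθ)), rfl⟩
        · rintro ⟨⟨y, hyF⟩, hy, rfl⟩
          exact ⟨⟨h y, fun i θ hθ => hy i θ (Subtype.ext (by rw [hc', hθ, h.symm_apply_apply])),
            h.symm_apply_apply y⟩, hyF⟩
      rw [heq] at hc1
      exact ⟨hc1.nonempty.of_image, IsInducing.subtypeVal.isPreconnected_image.1 hc1.isPreconnected⟩

end PointPushing

/-! ### Existence, completeness and regularity of integral curves on manifolds. -/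

section IntegralCurves

variable {E : Type*} [NormedAddCommGroup E] [NormedSpace ℝ E] [CompleteSpace E]
  {H : Type*} [TopologicalSpace H] {I : ModelWithCorners ℝ E H}
  {M : Type*} [TopologicalSpace M] [ChartedSpace H M] [IsManifold I ∞ M]
  [BoundarylessManifold I M]

/-- Integral curves of a `C^1` vector field starting near a given point exist for a uniform time. -/
lemma exists_uniform_integralCurve {v : (x : M) → TangentSpace I x}
    (hv : ContMDiff I I.tangent 1 (fun x ↦ (⟨x, v x⟩ : TangentBundle I M))) (x₀ : M) :
    ∃ ε > 0, ∀ᶠ x in 𝓝 x₀, ∃ γ : ℝ → M, γ 0 = x ∧ IsMIntegralCurveOn γ v (Ioo (-ε) ε) := by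
  have : IsManifold I 1 M := IsManifold.of_le (n := ∞) (by exact_mod_cast le_top)
  have hx : I.IsInteriorPoint x₀ := BoundarylessManifold.isInteriorPoint
  have hv' := hv x₀
  rw [contMDiffAt_iff] at hv'
  obtain ⟨-, hv'⟩ := hv'
  have hF := (hv'.contDiffAt (range_mem_nhds_isInteriorPoint hx)).snd
  obtain ⟨ε, hε, a, r, _, _, hr, hpl⟩ := IsPicardLindelof.of_contDiffAt_one hF
  obtain ⟨α, hα, hcont⟩ := (hpl 0).exists_forall_mem_closedBall_eq_hasDerivWithinAt_continuousOn
  have htgt : interior (extChartAt I x₀).target ∈ 𝓝 (extChartAt I x₀ x₀) :=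
    isOpen_interior.mem_nhds ((I.isInteriorPoint_iff).mp hx)
  have hr' : (0 : ℝ) < r := hr
  have hball : Metric.closedBall (extChartAt I x₀ x₀) r ×ˢ Icc (0 - ε) (0 + ε) ∈
      𝓝 (extChartAt I x₀ x₀, (0 : ℝ)) :=
    prod_mem_nhds (Metric.closedBall_mem_nhds _ hr')
      (Icc_mem_nhds (by linarith) (by linarith))
  have hc0 : ContinuousAt α (extChartAt I x₀ x₀, 0) := hcont.continuousAt hball
  have hα0 : α (extChartAt I x₀ x₀, 0) = extChartAt I x₀ x₀ :=
    (hα _ (Metric.mem_closedBall_self hr'.le)).1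
  -- Joint continuity of the local flow in initial point and time gives one time during which all
  -- nearby solutions stay inside the chart.
  have hev : ∀ᶠ p in 𝓝 (extChartAt I x₀ x₀, (0 : ℝ)),
      α p ∈ interior (extChartAt I x₀).target ∧
        p ∈ Metric.closedBall (extChartAt I x₀ x₀) r ×ˢ Icc (0 - ε) (0 + ε) :=
    (hc0.eventually_mem (by rwa [hα0])).and hball
  rw [nhds_prod_eq, Filter.eventually_prod_iff] at hev
  obtain ⟨pa, hpa, pb, hpb, hab⟩ := hev
  obtain ⟨η, hη, hηb⟩ := Metric.eventually_nhds_iff_ball.1 hpb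
  refine ⟨min η ε, lt_min hη hε, ?_⟩
  have hcx : ContinuousAt (extChartAt I x₀) x₀ := continuousAt_extChartAt x₀
  filter_upwards [hcx.eventually hpa, extChartAt_source_mem_nhds (I := I) x₀] with x hxa hxs
  set y := extChartAt I x₀ x
  have hmem : ∀ t ∈ Ioo (-(min η ε)) (min η ε),
      α (y, t) ∈ interior (extChartAt I x₀).target ∧
        (y, t) ∈ Metric.closedBall (extChartAt I x₀ x₀) r ×ˢ Icc (0 - ε) (0 + ε) := by
    intro t ht
    refine hab hxa (hηb t ?_)
    rw [Real.ball_eq_Ioo]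
    exact ⟨by linarith [ht.1, min_le_left η ε], by linarith [ht.2, min_le_left η ε]⟩
  have h0 := hmem 0 ⟨by linarith [lt_min hη hε], lt_min hη hε⟩
  refine ⟨fun t => (extChartAt I x₀).symm (α (y, t)), ?_, ?_⟩
  · change (extChartAt I x₀).symm (α (y, 0)) = x
    rw [(hα y h0.2.1).1, (extChartAt I x₀).left_inv hxs]
  · intro t ht
    have hf1 := hmem t ht
    have hder : HasDerivAt (fun t => α (y, t))
        ((fderivWithin ℝ (extChartAt I x₀ ∘ (extChartAt I ((extChartAt I x₀).symm (α (y, t)))).symm)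
          (range I) (extChartAt I ((extChartAt I x₀).symm (α (y, t)))
            ((extChartAt I x₀).symm (α (y, t)))))
          (v ((extChartAt I x₀).symm (α (y, t))))) t :=
      ((hα y hf1.2.1).2 t hf1.2.2).hasDerivAt
        (Icc_mem_nhds (by linarith [ht.1, min_le_right η ε]) (by linarith [ht.2, min_le_right η ε]))
    set xₜ : M := (extChartAt I x₀).symm (α (y, t)) with hxt
    rw [← tangentCoordChange_def] at hder
    have hf3 := hf1.1
    have hf3' := interior_subset hf3
    have hft1 := mem_preimage.mp <|
      mem_of_mem_of_subset hf3' (extChartAt I x₀).target_subset_preimage_source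
    have hft2 := mem_extChartAt_source (I := I) xₜ
    apply HasMFDerivAt.hasMFDerivWithinAt
    suffices hd : HasDerivAt ((extChartAt I xₜ ∘ (extChartAt I x₀).symm) ∘ (fun t => α (y, t)))
        (v xₜ : E) t by
      refine ⟨ContinuousAt.comp (f := fun t => α (y, t)) (continuousAt_extChartAt_symm'' hf3')
        hder.continuousAt, ?_⟩
      have hfd := hd.hasFDerivAt.hasFDerivWithinAt (s := range 𝓘(ℝ, ℝ))
      exact hfd
    have hvx : ∀ w : E, (tangentCoordChange I x₀ xₜ xₜ) ((tangentCoordChange I xₜ x₀ xₜ) w) =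
        w := fun w => by
      rw [tangentCoordChange_comp (x := x₀) ⟨⟨hft2, hft1⟩, hft2⟩,
        tangentCoordChange_self (I := I) (x := xₜ) (z := xₜ) hft2]
    refine HasDerivAt.congr_deriv (HasFDerivAt.comp_hasDerivAt (l' := tangentCoordChange I x₀ xₜ xₜ)
      _ ?_ hder) (hvx (v xₜ))
    apply HasFDerivWithinAt.hasFDerivAt (s := range I) _ <|
      mem_nhds_iff.mpr ⟨interior (extChartAt I x₀).target,
        subset_trans interior_subset (extChartAt_target_subset_range ..),
        isOpen_interior, hf3⟩
    have h4 := hasFDerivWithinAt_tangentCoordChange (I := I) (x := x₀) (y := xₜ) (z := xₜ)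
      ⟨hft1, hft2⟩
    rwa [show extChartAt I x₀ xₜ = α (y, t) from (extChartAt I x₀).right_inv hf3'] at h4

lemma exists_uniform_integralCurve_of_isCompact {v : (x : M) → TangentSpace I x}
    (hv : ContMDiff I I.tangent 1 (fun x ↦ (⟨x, v x⟩ : TangentBundle I M))) {K : Set M}
    (hK : IsCompact K) :
    ∃ ε > 0, ∀ x ∈ K, ∃ γ : ℝ → M, γ 0 = x ∧ IsMIntegralCurveOn γ v (Ioo (-ε) ε) := by
  refine hK.induction_on (p := fun K => ∃ ε > 0, ∀ x ∈ K, ∃ γ : ℝ → M, γ 0 = x ∧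
    IsMIntegralCurveOn γ v (Ioo (-ε) ε)) ⟨1, one_pos, by simp⟩ ?_ ?_ ?_
  · rintro s t hst ⟨ε, hε, h⟩
    exact ⟨ε, hε, fun x hx => h x (hst hx)⟩
  · rintro s t ⟨ε, hε, h⟩ ⟨ε', hε', h'⟩
    refine ⟨min ε ε', lt_min hε hε', ?_⟩
    rintro x (hx | hx)
    · obtain ⟨γ, h0, h1⟩ := h x hx
      exact ⟨γ, h0, h1.mono (Ioo_subset_Ioo (neg_le_neg (min_le_left _ _)) (min_le_left _ _))⟩
    · obtain ⟨γ, h0, h1⟩ := h' x hx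
      exact ⟨γ, h0, h1.mono (Ioo_subset_Ioo (neg_le_neg (min_le_right _ _)) (min_le_right _ _))⟩
  · intro x _
    obtain ⟨ε, hε, h⟩ := exists_uniform_integralCurve hv x
    exact ⟨_, mem_nhdsWithin_of_mem_nhds h, ε, hε, fun y hy => hy⟩

/-- A smooth vector field on a compact manifold is complete. -/
lemma exists_isMIntegralCurve_of_compact [T2Space M] [CompactSpace M]
    {v : (x : M) → TangentSpace I x}
    (hv : ContMDiff I I.tangent 1 (fun x ↦ (⟨x, v x⟩ : TangentBundle I M))) (x : M) :
    ∃ γ : ℝ → M, γ 0 = x ∧ IsMIntegralCurve γ v := by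
  have : IsManifold I 1 M := IsManifold.of_le (n := ∞) (by exact_mod_cast le_top)
  obtain ⟨ε, hε, h⟩ := exists_uniform_integralCurve_of_isCompact hv isCompact_univ
  exact exists_isMIntegralCurve_of_isMIntegralCurveOn hv hε (fun x => h x (mem_univ x)) x

/-- Integral curves of smooth vector fields are smooth. -/
lemma IsMIntegralCurve.contMDiff_of_contMDiffOn {v : (x : M) → TangentSpace I x} {U : Set M}
    (hU : IsOpen U)
    (hv : ContMDiffOn I I.tangent ∞ (fun x ↦ (⟨x, v x⟩ : TangentBundle I M)) U) {γ : ℝ → M}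
    (hγ : IsMIntegralCurve γ v) (hγU : ∀ t, γ t ∈ U) : ContMDiff 𝓘(ℝ, ℝ) I ∞ γ := by
  have : IsManifold I 1 M := IsManifold.of_le (n := ∞) (by exact_mod_cast le_top)
  have key : ∀ n : ℕ, ContMDiff 𝓘(ℝ, ℝ) I n γ := by
    intro n
    induction n with
    | zero => exact contMDiff_zero_iff.2 hγ.continuous
    | succ n ih =>
      intro t₀
      rw [contMDiffAt_iff_target]
      refine ⟨hγ.continuous.continuousAt, ?_⟩
      rw [contMDiffAt_iff_contDiffAt]
      have h1 := (hγ.isMIntegralCurveAt t₀).eventually_hasDerivAt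
      have hv1 := (hv.contMDiffAt (hU.mem_nhds (hγU t₀)))
      rw [Bundle.contMDiffAt_section] at hv1
      have h2 : ContMDiffAt 𝓘(ℝ, ℝ) 𝓘(ℝ, E) n (fun t =>
          (trivializationAt E (TangentSpace I) (γ t₀) ⟨γ t, v (γ t)⟩).2) t₀ :=
        (hv1.of_le (m := n) (by exact_mod_cast le_top)).comp t₀ (ih t₀)
      rw [contMDiffAt_iff_contDiffAt] at h2
      -- Bootstrapping: the velocity is the field along the curve, hence as regular as the curve, so
      -- the curve gains one derivative.
      refine contDiffAt_succ_iff_hasFDerivAt.2 ⟨fun t => ContinuousLinearMap.toSpanSingleton ℝ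
        (trivializationAt E (TangentSpace I) (γ t₀) ⟨γ t, v (γ t)⟩).2, ⟨_, h1, fun t ht => ?_⟩, ?_⟩
      · exact HasDerivAt.hasFDerivAt ht
      · exact (ContinuousLinearMap.toSpanSingletonCLE.contDiff).contDiffAt.comp t₀ h2
  exact contMDiff_infty.2 key

end IntegralCurves

/-! ### Time-periodic fields, treated as autonomous fields on space-time. -/

section TimeDependent

variable {S : Type*} [TopologicalSpace S] [T2Space S]
  [ChartedSpace (EuclideanSpace ℝ (Fin 2)) S] [IsManifold (𝓡 2) ∞ S]

/-- The autonomous vector field on space-time associated with a time-dependent one. -/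
def suspension (Y : ℝ → VField S) (p : ℝ × S) : TangentSpace (𝓘(ℝ, ℝ).prod (𝓡 2)) p :=
  ((1 : ℝ), (Y p.1 p.2 : EuclideanSpace ℝ (Fin 2)))

lemma contMDiff_suspension {Y : ℝ → VField S} (hY : IsSmoothTimeVField Y) :
    ContMDiff (𝓘(ℝ, ℝ).prod (𝓡 2)) (𝓘(ℝ, ℝ).prod (𝓡 2)).tangent ∞
      (fun p ↦ (⟨p, suspension Y p⟩ : TangentBundle (𝓘(ℝ, ℝ).prod (𝓡 2)) (ℝ × S))) := by
  have h1 : ContMDiff 𝓘(ℝ, ℝ) 𝓘(ℝ, ℝ).tangent ∞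
      (fun t : ℝ => (⟨t, (1 : ℝ)⟩ : TangentBundle 𝓘(ℝ, ℝ) ℝ)) := by
    exact contMDiff_vectorSpace_iff_contDiff (V := fun _ : ℝ => (1 : ℝ)).2 contDiff_const
  exact (contMDiff_equivTangentBundleProd_symm (I := 𝓘(ℝ, ℝ)) (M := ℝ) (I' := 𝓡 2) (M' := S)).comp
    ((h1.comp contMDiff_fst).prodMk hY)

lemma IsOrbit.suspension {Y : ℝ → VField S} {γ : ℝ → S} (hγ : IsOrbit Y γ) :
    IsMIntegralCurve (I := 𝓘(ℝ, ℝ).prod (𝓡 2)) (fun t => (t, γ t)) (suspension Y) := by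
  intro t
  have h := (hasMFDerivAt_id (I := 𝓘(ℝ, ℝ)) t).prodMk (hγ t)
  refine h.congr_mfderiv ?_
  ext1
  refine Prod.ext ?_ rfl
  change (1 : ℝ) = (1 : ℝ) • (1 : ℝ)
  simp

/-- Uniqueness of orbits. -/
lemma IsOrbit.eq_of_eq {Y : ℝ → VField S} (hY : IsSmoothTimeVField Y) {γ γ' : ℝ → S}
    (hγ : IsOrbit Y γ) (hγ' : IsOrbit Y γ') {t₀ : ℝ} (h : γ t₀ = γ' t₀) : γ = γ' := by
  have : IsManifold (𝓘(ℝ, ℝ).prod (𝓡 2)) 1 (ℝ × S) :=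
    IsManifold.of_le (n := ∞) (by exact_mod_cast le_top)
  have := isMIntegralCurve_Ioo_eq_of_contMDiff_boundaryless (t₀ := t₀)
    ((contMDiff_suspension hY).of_le (by exact_mod_cast le_top)) (hγ.suspension)
    (hγ'.suspension) (by simp [h])
  funext t
  exact congrArg Prod.snd (congrFun this t)

lemma IsOrbit.comp_add {Y : ℝ → VField S} {γ : ℝ → S} (hγ : IsOrbit Y γ) {a : ℝ}
    (hp : ∀ t, Y (t + a) = Y t) : IsOrbit Y (fun t => γ (t + a)) := by
  intro t
  have h2 : HasMFDerivAt 𝓘(ℝ, ℝ) 𝓘(ℝ, ℝ) (fun t : ℝ => t + a) t (ContinuousLinearMap.id ℝ ℝ) :=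
    ((hasFDerivAt_id t).add_const a).hasMFDerivAt
  have h := (hγ (t + a)).comp t h2
  rw [hp] at h
  exact h

/-- A smooth time-periodic vector field on a compact surface is complete. -/
lemma exists_isOrbit [CompactSpace S] {Y : ℝ → VField S} (hY : IsSmoothTimeVField Y)
    (hper : ∀ t, Y (t + 1) = Y t) (x : S) : ∃ γ : ℝ → S, γ 0 = x ∧ IsOrbit Y γ := by
  have : IsManifold (𝓘(ℝ, ℝ).prod (𝓡 2)) 1 (ℝ × S) :=
    IsManifold.of_le (n := ∞) (by exact_mod_cast le_top)
  have hv := (contMDiff_suspension hY).of_le (n := ∞) (m := 1) (by exact_mod_cast le_top)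
  obtain ⟨ε, hε, h⟩ := exists_uniform_integralCurve_of_isCompact hv
    ((isCompact_Icc (a := (0:ℝ)) (b := 1)).prod (isCompact_univ (X := S)))
  have hperZ : ∀ (n : ℤ) (t : ℝ), Y (t + n) = Y t := fun n t => by
    have : Periodic Y 1 := hper
    simpa using this.int_mul n t
  have hall : ∀ p : ℝ × S, ∃ γ : ℝ → ℝ × S, γ 0 = p ∧
      IsMIntegralCurveOn γ (suspension Y) (Ioo (-ε) ε) := by
    rintro ⟨t, x⟩
    -- Space-time is not compact. By periodicity, a curve starting at time `t` is a translate of one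
    -- starting at its fractional part, so a uniform time on [0, 1] × S suffices.
    obtain ⟨γ, h0, h1⟩ := h (Int.fract t, x)
      ⟨⟨Int.fract_nonneg t, (Int.fract_lt_one t).le⟩, mem_univ _⟩
    refine ⟨fun τ => ((γ τ).1 + ⌊t⌋, (γ τ).2), by simp [h0], fun τ hτ => ?_⟩
    have h2 := h1 τ hτ
    have ha := ((hasMFDerivAt_fst (I := 𝓘(ℝ, ℝ)) (I' := 𝓡 2) (γ τ)).comp_hasMFDerivWithinAt τ h2)
    have hb := ((hasMFDerivAt_snd (I := 𝓘(ℝ, ℝ)) (I' := 𝓡 2) (γ τ)).comp_hasMFDerivWithinAt τ h2)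
    have hadd : HasMFDerivAt 𝓘(ℝ, ℝ) 𝓘(ℝ, ℝ) (fun s : ℝ => s + ⌊t⌋) (γ τ).1
      (ContinuousLinearMap.id ℝ ℝ) := ((hasFDerivAt_id (γ τ).1).add_const _).hasMFDerivAt
    have ha' := hadd.comp_hasMFDerivWithinAt τ ha
    refine (ha'.prodMk hb).congr_mfderiv ?_
    ext1
    refine Prod.ext rfl ?_
    change (1 : ℝ) • Y (γ τ).1 (γ τ).2 = (1 : ℝ) • Y ((γ τ).1 + ⌊t⌋) (γ τ).2
    rw [hperZ]
  obtain ⟨γ, h0, h1⟩ := exists_isMIntegralCurve_of_isMIntegralCurveOn hv hε hall (0, x)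
  -- The time component has constant velocity 1, so the second component is an orbit of the original
  -- field.
  have hfst : ∀ t, (γ t).1 = t := by
    intro t
    have hd : ∀ t, HasDerivAt (fun t => (γ t).1) 1 t := fun t => by
      have h2 : HasMFDerivAt 𝓘(ℝ, ℝ) 𝓘(ℝ, ℝ) (fun t => (γ t).1) t
          (ContinuousLinearMap.toSpanSingleton ℝ (1 : ℝ)) :=
        ((hasMFDerivAt_fst (I := 𝓘(ℝ, ℝ)) (I' := 𝓡 2) (γ t)).comp t (h1 t)).congr_mfderiv (by
          ext1
          rfl)
      exact hasDerivAt_iff_hasFDerivAt.2 h2.hasFDerivAt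
    have hd' : ∀ t, HasDerivAt (fun t => (γ t).1 - t) 0 t := fun t => by
      have := (hd t).sub (hasDerivAt_id t)
      rw [sub_self] at this
      exact this
    have := is_const_of_deriv_eq_zero (fun t => (hd' t).differentiableAt)
      (fun t => (hd' t).deriv) t 0
    simp only [h0] at this
    linarith
  refine ⟨fun t => (γ t).2, by simp [h0], fun t => ?_⟩
  have := (hasMFDerivAt_snd (I := 𝓘(ℝ, ℝ)) (I' := 𝓡 2) (γ t)).comp t (h1 t)
  refine this.congr_mfderiv ?_
  ext1
  change (1 : ℝ) • Y (γ t).1 (γ t).2 = (1 : ℝ) • Y t (γ t).2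
  rw [hfst]

end TimeDependent

/-! ### Inverse function theorem for maps of surfaces. -/

section InverseFunction

/-- The inverse function theorem for self-maps of the plane, with smooth local inverse. -/
lemma exists_local_inverse_of_contDiffOn {F : Plane → Plane} {W : Set Plane} (hW : IsOpen W)
    (hF : ContDiffOn ℝ ∞ F W) {a : Plane} (ha : a ∈ W) (hinj : ∀ v, fderiv ℝ F a v = 0 → v = 0) :
    ∃ e : OpenPartialHomeomorph Plane Plane, a ∈ e.source ∧ e.source ⊆ W ∧
      (∀ x, e x = F x) ∧ ContDiffOn ℝ ∞ e.symm e.target := by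
  have hequiv : ∃ L : Plane ≃L[ℝ] Plane, (L : Plane →L[ℝ] Plane) = fderiv ℝ F a := by
    have hi : Injective (fderiv ℝ F a).toLinearMap :=
      (injective_iff_map_eq_zero _).2 hinj
    refine ⟨(LinearEquiv.ofInjectiveEndo _ hi).toContinuousLinearEquiv, ?_⟩
    ext1 x
    rfl
  obtain ⟨L, hL⟩ := hequiv
  have hFa : ContDiffAt ℝ ∞ F a := hF.contDiffAt (hW.mem_nhds ha)
  have hd : HasFDerivAt F (L : Plane →L[ℝ] Plane) a := by
    rw [hL]
    exact (hFa.differentiableAt (by simp)).hasFDerivAt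
  set e₁ := hFa.toOpenPartialHomeomorph F hd (by simp)
  have hcont : ContinuousOn (fderiv ℝ F) W := hF.continuousOn_fderiv_of_isOpen hW (by simp)
  -- Restricting to the open set where the derivative is invertible makes the inverse smooth on its
  -- whole domain, not merely at one point.
  set O := W ∩ fderiv ℝ F ⁻¹' (range ((↑) : (Plane ≃L[ℝ] Plane) → Plane →L[ℝ] Plane))
  have hO : IsOpen O := hcont.isOpen_inter_preimage hW (ContinuousLinearEquiv.isOpen)
  refine ⟨e₁.restrOpen O hO, ?_, ?_, fun x => rfl, ?_⟩
  · exact ⟨hFa.mem_toOpenPartialHomeomorph_source hd (by simp), ha, L, hL⟩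
  · exact fun x hx => hx.2.1
  · intro y hy
    have hy' : (e₁.restrOpen O hO).symm y ∈ (e₁.restrOpen O hO).source :=
      (e₁.restrOpen O hO).map_target hy
    obtain ⟨-, hyW, L', hL'⟩ := hy'
    refine ((e₁.restrOpen O hO).contDiffAt_symm (f₀' := L') hy ?_ ?_).contDiffWithinAt
    · rw [hL']
      exact ((hF.contDiffAt (hW.mem_nhds hyW)).differentiableAt (by simp)).hasFDerivAt
    · exact hF.contDiffAt (hW.mem_nhds hyW)

variable {A B : Type*} [TopologicalSpace A] [ChartedSpace Plane A] [IsManifold (𝓡 2) ∞ A]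
  [TopologicalSpace B] [ChartedSpace Plane B] [IsManifold (𝓡 2) ∞ B]

/-- The inverse function theorem for maps between surfaces. -/
lemma exists_local_inverse {f : A → B} {U : Set A} (hU : IsOpen U)
    (hf : ContMDiffOn (𝓡 2) (𝓡 2) ∞ f U) {a : A} (ha : a ∈ U)
    (hinj : ∀ v, mfderiv (𝓡 2) (𝓡 2) f a v = 0 → v = 0) :
    ∃ e : OpenPartialHomeomorph A B, a ∈ e.source ∧ e.source ⊆ U ∧ (∀ x ∈ e.source, e x = f x) ∧
      ContMDiffOn (𝓡 2) (𝓡 2) ∞ e.symm e.target := by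
  set c := chartAt Plane a
  set d := chartAt Plane (f a)
  have hac : a ∈ c.source := mem_chart_source _ a
  have hfd : f a ∈ d.source := mem_chart_source _ (f a)
  have hU' : IsOpen (U ∩ f ⁻¹' d.source) := hf.continuousOn.isOpen_inter_preimage hU d.open_source
  set W := c.target ∩ c.symm ⁻¹' (U ∩ f ⁻¹' d.source)
  have hW : IsOpen W := c.symm.isOpen_inter_preimage hU'
  have hcs : ContMDiffOn (𝓡 2) (𝓡 2) ∞ c.symm c.target := contMDiffOn_chart_symm
  have hds : ContMDiffOn (𝓡 2) (𝓡 2) ∞ d d.source := contMDiffOn_chart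
  have hF : ContDiffOn ℝ ∞ (d ∘ f ∘ c.symm) W := by
    rw [← contMDiffOn_iff_contDiffOn]
    exact hds.comp (hf.comp (hcs.mono inter_subset_left) fun x hx => hx.2.1) fun x hx => hx.2.2
  have haW : c a ∈ W := ⟨c.map_source hac, by
    change c.symm (c a) ∈ U ∧ f (c.symm (c a)) ∈ d.source
    rw [c.left_inv hac]
    exact ⟨ha, hfd⟩⟩
  have hmd : MDifferentiableAt (𝓡 2) (𝓡 2) f a :=
    (hf.contMDiffAt (hU.mem_nhds ha)).mdifferentiableAt (by simp)
  obtain ⟨L, hL⟩ : ∃ L : Plane →L[ℝ] Plane, L = mfderiv (𝓡 2) (𝓡 2) f a := ⟨_, rfl⟩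
  have hder : HasFDerivAt (d ∘ f ∘ c.symm) L (c a) := by
    have := hmd.hasMFDerivAt.2
    simp only [mfld_simps] at this
    have h2 : HasFDerivWithinAt (d ∘ f ∘ c.symm) L univ (c a) := hL ▸ this
    rwa [hasFDerivWithinAt_univ] at h2
  obtain ⟨e, hae, heW, heF, hes⟩ := exists_local_inverse_of_contDiffOn hW hF haW (by
    rw [hder.fderiv, hL]
    exact hinj)
  have hsub : ∀ x ∈ ((c.trans e).trans d.symm).source, x ∈ c.source ∧ c x ∈ e.source := by
    intro x hx
    rw [OpenPartialHomeomorph.trans_source, OpenPartialHomeomorph.trans_source] at hx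
    exact hx.1
  refine ⟨(c.trans e).trans d.symm, ?_, ?_, ?_, ?_⟩
  · rw [OpenPartialHomeomorph.trans_source, OpenPartialHomeomorph.trans_source]
    refine ⟨⟨hac, hae⟩, ?_⟩
    change e (c a) ∈ d.target
    rw [heF]
    change d (f (c.symm (c a))) ∈ d.target
    rw [c.left_inv hac]
    exact d.map_source hfd
  · intro x hx
    obtain ⟨h1, h2⟩ := hsub x hx
    have := (heW h2).2.1
    rwa [c.left_inv h1] at this
  · intro x hx
    obtain ⟨h1, h2⟩ := hsub x hx
    change d.symm (e (c x)) = f x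
    rw [heF]
    change d.symm (d (f (c.symm (c x)))) = f x
    have := (heW h2).2.2
    rw [mem_preimage, c.left_inv h1] at this
    rw [c.left_inv h1, d.left_inv this]
  · have hsub' : ∀ y ∈ ((c.trans e).trans d.symm).target, y ∈ d.source ∧ d y ∈ e.target ∧
        e.symm (d y) ∈ c.target := by
      intro y hy
      rw [OpenPartialHomeomorph.trans_target, OpenPartialHomeomorph.trans_target] at hy
      exact ⟨hy.1, hy.2.1, hy.2.2⟩
    exact hcs.comp (hes.contMDiffOn.comp (hds.mono fun y hy => (hsub' y hy).1)
      fun y hy => (hsub' y hy).2.1) fun y hy => (hsub' y hy).2.2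

end InverseFunction

/-! ### Curves tangent to level sets. -/

section Levels

variable {M : Type*} [TopologicalSpace M] [ChartedSpace (EuclideanSpace ℝ (Fin 2)) M]

/-- A curve tangent to the level sets of a function on an open set stays in any level set that is
closed. -/
lemma mem_level_of_tangent {N : Set M} (hN : IsOpen N) {f : M → ℝ}
    (hf : ContMDiffOn (𝓡 2) 𝓘(ℝ, ℝ) ∞ f N) {c : ℝ} (hcl : IsClosed {x ∈ N | f x = c})
    {γ : ℝ → M} {V : ∀ t, TangentSpace (𝓡 2) (γ t)}
    (hγ : ∀ t, HasMFDerivAt 𝓘(ℝ, ℝ) (𝓡 2) γ t ((1 : ℝ →L[ℝ] ℝ).smulRight (V t)))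
    (hV : ∀ t, γ t ∈ N → mfderiv (𝓡 2) 𝓘(ℝ, ℝ) f (γ t) (V t) = 0)
    {t₀ : ℝ} (h0 : γ t₀ ∈ N ∧ f (γ t₀) = c) (t : ℝ) : γ t ∈ N ∧ f (γ t) = c := by
  have hcont : Continuous γ := continuous_iff_continuousAt.2 fun t => (hγ t).continuousAt
  -- The times spent in the level form a closed set by hypothesis. The set is open because `f` has
  -- zero derivative along the curve as long as the curve is in `N`. Connectedness of the line
  -- concludes.
  have hclopen : IsClopen (γ ⁻¹' {x ∈ N | f x = c}) := by
    refine ⟨hcl.preimage hcont, ?_⟩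
    rw [isOpen_iff_mem_nhds]
    rintro t₁ ⟨h1, h2⟩
    obtain ⟨r, hr, hball⟩ := Metric.isOpen_iff.1 (hN.preimage hcont) t₁ h1
    have hder : ∀ s ∈ Metric.ball t₁ r, HasDerivAt (fun s => f (γ s)) 0 s := by
      intro s hs
      have hfs := ((hf.contMDiffAt (hN.mem_nhds (hball hs))).mdifferentiableAt
        (by simp)).hasMFDerivAt
      have h3 : HasMFDerivAt 𝓘(ℝ, ℝ) 𝓘(ℝ, ℝ) (fun s => f (γ s)) s
          (ContinuousLinearMap.toSpanSingleton ℝ (0 : ℝ)) :=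
        (hfs.comp s (hγ s)).congr_mfderiv (by
          ext1
          change mfderiv (𝓡 2) 𝓘(ℝ, ℝ) f (γ s) ((1 : ℝ) • V s) = (1 : ℝ) • (0 : ℝ)
          rw [one_smul, hV s (hball hs), smul_zero]
          rfl)
      exact hasDerivAt_iff_hasFDerivAt.2 h3.hasFDerivAt
    refine Filter.mem_of_superset (Metric.ball_mem_nhds t₁ hr) fun s hs => ⟨hball hs, ?_⟩
    have := (Metric.isOpen_ball (x := t₁) (ε := r)).is_const_of_deriv_eq_zero
      (convex_ball _ _).isPreconnected (fun s hs => (hder s hs).differentiableAt.differentiableWithinAt)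
      (fun s hs => (hder s hs).deriv) hs (Metric.mem_ball_self hr)
    exact this.trans h2
  have := hclopen.eq_univ ⟨t₀, h0⟩
  have h2 : t ∈ γ ⁻¹' {x ∈ N | f x = c} := this ▸ mem_univ t
  exact h2

end Levels

/-! ### Coordinates on the tube and smoothness of the inverse trivialisation. -/

section Tube

/-- The point of the plane with given coordinates. -/
noncomputable def pt (a b : ℝ) : Plane := !₂[a, b]

@[simp] lemma pt_zero (a b : ℝ) : pt a b 0 = a := rfl

@[simp] lemma pt_one (a b : ℝ) : pt a b 1 = b := rfl

lemma pt_eta (y : Plane) : pt (y 0) (y 1) = y := by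
  ext i
  fin_cases i <;> rfl

lemma pt_inj {a b a' b' : ℝ} (h : pt a b = pt a' b') : a = a' ∧ b = b' :=
  ⟨congrArg (fun y : Plane => y 0) h, congrArg (fun y : Plane => y 1) h⟩

lemma contDiff_pt : ContDiff ℝ ∞ (fun q : ℝ × ℝ => pt q.1 q.2) := by
  rw [contDiff_euclidean]
  intro i
  fin_cases i
  · exact contDiff_fst
  · exact contDiff_snd

lemma contDiff_coord (i : Fin 2) : ContDiff ℝ ∞ (fun y : Plane => y i) :=
  (EuclideanSpace.proj i : Plane →L[ℝ] ℝ).contDiff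

variable {M : Type*} [TopologicalSpace M] [ChartedSpace (EuclideanSpace ℝ (Fin 2)) M]
  [IsManifold (𝓡 2) ∞ M] {m : ℕ} {Z : Set M} {Ω : TwoTensor M}

namespace AdaptedTube

variable (T : AdaptedTube m Z Ω)

lemma π_mem {x : M} (hx : x ∈ T.N) : T.π x ∈ Z := (T.bijOn.mapsTo hx).2

lemma z_mem {x : M} (hx : x ∈ T.N) : T.z x ∈ Ioo (-T.δ) T.δ := (T.bijOn.mapsTo hx).1

lemma mdiff_z {x : M} (hx : x ∈ T.N) : MDifferentiableAt (𝓡 2) 𝓘(ℝ, ℝ) T.z x :=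
  (T.z_def.1.contMDiffAt (T.isOpen.mem_nhds hx)).mdifferentiableAt (by simp)

lemma mdiff_π {x : M} (hx : x ∈ T.N) : MDifferentiableAt (𝓡 2) (𝓡 2) T.π x :=
  (T.π_smooth.contMDiffAt (T.isOpen.mem_nhds hx)).mdifferentiableAt (by simp)

open Classical in
/-- The point of the tube with given height and given projection. -/
noncomputable def point (w : ℝ) (p : M) : M :=
  if h : ∃ x ∈ T.N, T.z x = w ∧ T.π x = p then h.choose else p

lemma point_spec {w : ℝ} {p : M} (hw : w ∈ Ioo (-T.δ) T.δ) (hp : p ∈ Z) :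
    T.point w p ∈ T.N ∧ T.z (T.point w p) = w ∧ T.π (T.point w p) = p := by
  obtain ⟨x, hx, hxe⟩ := T.bijOn.surjOn (show (w, p) ∈ Ioo (-T.δ) T.δ ×ˢ Z from ⟨hw, hp⟩)
  have h : ∃ x ∈ T.N, T.z x = w ∧ T.π x = p :=
    ⟨x, hx, congrArg Prod.fst hxe, congrArg Prod.snd hxe⟩
  rw [point, dif_pos h]
  exact h.choose_spec

lemma point_eq {x : M} (hx : x ∈ T.N) : T.point (T.z x) (T.π x) = x := by
  obtain ⟨h1, h2, h3⟩ := T.point_spec (T.z_mem hx) (T.π_mem hx)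
  exact T.bijOn.injOn h1 hx (Prod.ext h2 h3)

lemma eq_point {x : M} (hx : x ∈ T.N) {w : ℝ} {p : M} (hz : T.z x = w) (hπ : T.π x = p) :
    x = T.point w p := by rw [← hz, ← hπ, T.point_eq hx]

lemma z_eq_zero {x : M} (hx : x ∈ Z) : T.z x = 0 := (T.z_def.2.1 x (T.subset hx)).1 hx

lemma mem_Z {x : M} (hx : x ∈ T.N) (h : T.z x = 0) : x ∈ Z := (T.z_def.2.1 x hx).2 h

lemma R_ne_zero {x : M} (hx : x ∈ T.N) : T.R x ≠ 0 := by
  intro h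
  have := T.α_R x hx
  rw [h] at this
  simp at this

/-- The Reeb vector at a point, as a vector of the model space. -/
noncomputable def reebVec (p : M) : Plane := T.R p

/-- A chart coordinate at `p` which is regular on `Z`. -/
noncomputable def coord (p : M) (x : M) : ℝ :=
  inner ℝ (T.reebVec p) (chartAt (EuclideanSpace ℝ (Fin 2)) p x)

lemma contMDiffOn_coord (p : M) : ContMDiffOn (𝓡 2) 𝓘(ℝ, ℝ) ∞ (T.coord p)
    (chartAt (EuclideanSpace ℝ (Fin 2)) p).source := by
  have h : ContDiff ℝ ∞ (fun y : Plane => inner ℝ (T.reebVec p) y) :=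
    (innerSL ℝ (T.reebVec p)).contDiff
  exact h.contMDiff.comp_contMDiffOn contMDiffOn_chart

lemma hasMFDerivAt_coord (p : M) : HasMFDerivAt (𝓡 2) 𝓘(ℝ, ℝ) (T.coord p) p
    (innerSL ℝ (T.reebVec p)) := by
  refine ⟨(T.contMDiffOn_coord p).continuousOn.continuousAt
    ((chartAt Plane p).open_source.mem_nhds (mem_chart_source _ p)), ?_⟩
  have h1 : HasFDerivAt (fun y : Plane => inner ℝ (T.reebVec p) y) (innerSL ℝ (T.reebVec p))
    (chartAt Plane p p) := (innerSL ℝ (T.reebVec p)).hasFDerivAt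
  have h2 : HasFDerivAt (T.coord p ∘ (chartAt Plane p).symm) (innerSL ℝ (T.reebVec p))
      (chartAt Plane p p) := by
    refine h1.congr_of_eventuallyEq ?_
    filter_upwards [(chartAt Plane p).open_target.mem_nhds
      ((chartAt Plane p).map_source (mem_chart_source _ p))] with y hy
    change inner ℝ _ (chartAt Plane p ((chartAt Plane p).symm y)) = _
    rw [(chartAt Plane p).right_inv hy]
  simp only [mfld_simps]
  exact h2.hasFDerivWithinAt

/-- Local coordinates on the tube near the fibre over `p`. -/
noncomputable def tubeCoord (p : M) (x : M) : Plane := pt (T.z x) (T.coord p (T.π x))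

lemma isOpen_tubeCoord_domain (p : M) :
    IsOpen (T.N ∩ T.π ⁻¹' (chartAt (EuclideanSpace ℝ (Fin 2)) p).source) :=
  T.π_smooth.continuousOn.isOpen_inter_preimage T.isOpen (chartAt Plane p).open_source

lemma contMDiffOn_tubeCoord (p : M) : ContMDiffOn (𝓡 2) (𝓡 2) ∞ (T.tubeCoord p)
    (T.N ∩ T.π ⁻¹' (chartAt (EuclideanSpace ℝ (Fin 2)) p).source) :=
  contDiff_pt.contMDiff.comp_contMDiffOn
    ((T.z_def.1.mono inter_subset_left).prodMk_space ((T.contMDiffOn_coord p).comp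
      (T.π_smooth.mono inter_subset_left) fun _ hx => hx.2))

/-- The function `z ∘ π` vanishes identically on the tube. -/
lemma diff_z_mfderiv_π {x : M} (hx : x ∈ T.N) (v : TangentSpace (𝓡 2) x) :
    diff T.z (T.π x) (mfderiv (𝓡 2) (𝓡 2) T.π x v) = 0 := by
  have h1 := (T.mdiff_z (T.subset (T.π_mem hx))).hasMFDerivAt.comp x (T.mdiff_π hx).hasMFDerivAt
  have h2 : HasMFDerivAt (𝓡 2) 𝓘(ℝ, ℝ) (T.z ∘ T.π) x
      (0 : TangentSpace (𝓡 2) x →L[ℝ] TangentSpace 𝓘(ℝ, ℝ) (0 : ℝ)) := by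
    refine (hasMFDerivAt_const (0 : ℝ) x).congr_of_eventuallyEq ?_
    filter_upwards [T.isOpen.mem_nhds hx] with y hy
    exact T.z_eq_zero (T.π_mem hy)
  have := hasMFDerivAt_unique h1 h2
  exact congrArg (fun L : EuclideanSpace ℝ (Fin 2) →L[ℝ] ℝ => L v) this

/-- Vectors tangent to the level sets of `z` are multiples of the Reeb field. -/
lemma exists_smul_R {p : M} (hpN : p ∈ T.N) (hne : diff T.z p ≠ 0) {v : TangentSpace (𝓡 2) p}
    (hv : diff T.z p v = 0) : ∃ c : ℝ, v = c • T.R p := by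
  have hR := T.dz_R p hpN
  set L : Plane →ₗ[ℝ] ℝ := (diff T.z p : Plane →L[ℝ] ℝ).toLinearMap with hL
  have hLne : L ≠ 0 := by
    intro h
    apply hne
    ext w
    exact congrArg (fun L : Plane →ₗ[ℝ] ℝ => L w) h
  have hrank : Module.finrank ℝ (LinearMap.ker L) = 1 := by
    have h1 := LinearMap.finrank_range_add_finrank_ker L
    have h2 : LinearMap.range L = ⊤ := LinearMap.range_eq_top.2 (LinearMap.surjective hLne)
    rw [h2, finrank_top, Module.finrank_self, finrank_euclideanSpace, Fintype.card_fin] at h1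
    omega
  have hRk : (⟨T.R p, hR⟩ : LinearMap.ker L) ≠ 0 := fun h => T.R_ne_zero hpN (congrArg Subtype.val h)
  obtain ⟨c, hc⟩ := (finrank_eq_one_iff_of_nonzero' _ hRk).1 hrank ⟨v, hv⟩
  exact ⟨c, (congrArg Subtype.val hc).symm⟩

/-- For a vector in the kernel, the projected vector is tangent to Z, hence a multiple of the Reeb
vector. The second coordinate pairs it with that same Reeb vector, so the multiple is zero, and (z,
π) being immersive finishes. -/
lemma tubeCoord_immersive {x : M} (hx : x ∈ T.N) (v : TangentSpace (𝓡 2) x)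
    (hv : mfderiv (𝓡 2) (𝓡 2) (T.tubeCoord (T.π x)) x v = 0) : v = 0 := by
  have hxU : x ∈ T.N ∩ T.π ⁻¹' (chartAt (EuclideanSpace ℝ (Fin 2)) (T.π x)).source :=
    ⟨hx, mem_chart_source _ _⟩
  have hd := (((T.contMDiffOn_tubeCoord (T.π x)).contMDiffAt
    ((T.isOpen_tubeCoord_domain _).mem_nhds hxU)).mdifferentiableAt (by simp)).hasMFDerivAt
  have hproj : ∀ i : Fin 2, HasMFDerivAt (𝓡 2) 𝓘(ℝ, ℝ) (fun y : Plane => y i)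
      (T.tubeCoord (T.π x) x) (EuclideanSpace.proj i : Plane →L[ℝ] ℝ) := fun i =>
    (EuclideanSpace.proj i : Plane →L[ℝ] ℝ).hasFDerivAt.hasMFDerivAt
  have hz0 : diff T.z x v = 0 := by
    have h := (hproj 0).comp x hd
    have h' := hasMFDerivAt_unique h (T.mdiff_z hx).hasMFDerivAt
    have h2 := congrArg (fun L : EuclideanSpace ℝ (Fin 2) →L[ℝ] ℝ => L v) h'
    refine h2.symm.trans ?_
    change (EuclideanSpace.proj 0 : Plane →L[ℝ] ℝ)
      (mfderiv (𝓡 2) (𝓡 2) (T.tubeCoord (T.π x)) x v) = 0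
    rw [hv]
    exact map_zero _
  have hl0 : (innerSL ℝ (T.reebVec (T.π x))) (mfderiv (𝓡 2) (𝓡 2) T.π x v) = 0 := by
    have h := (hproj 1).comp x hd
    have h' := hasMFDerivAt_unique h
      ((T.hasMFDerivAt_coord (T.π x)).comp x (T.mdiff_π hx).hasMFDerivAt)
    have h2 := congrArg (fun L : EuclideanSpace ℝ (Fin 2) →L[ℝ] ℝ => L v) h'
    refine h2.symm.trans ?_
    change (EuclideanSpace.proj 1 : Plane →L[ℝ] ℝ)
      (mfderiv (𝓡 2) (𝓡 2) (T.tubeCoord (T.π x)) x v) = 0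
    rw [hv]
    exact map_zero _
  obtain ⟨c, hc⟩ := T.exists_smul_R (T.subset (T.π_mem hx))
    (T.z_def.2.2 _ ⟨T.subset (T.π_mem hx), T.π_mem hx⟩) (T.diff_z_mfderiv_π hx v)
  refine T.immersive x hx v hz0 ?_
  rw [hc] at hl0 ⊢
  have h3 : c * inner ℝ (T.reebVec (T.π x)) (T.reebVec (T.π x)) = 0 := by
    rw [← inner_smul_right]
    exact hl0
  rcases mul_eq_zero.1 h3 with h | h
  · rw [h, zero_smul]
  · exact absurd (inner_self_eq_zero.1 h) (T.R_ne_zero (T.subset (T.π_mem hx)))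

/-- Near a point of `Z`, the points of `Z` are determined by the coordinate `T.coord`. -/
lemma coord_injOn {p : M} (hp : p ∈ Z) : ∃ V : Set M, IsOpen V ∧ p ∈ V ∧
    V ⊆ (chartAt (EuclideanSpace ℝ (Fin 2)) p).source ∧ InjOn (T.coord p) (V ∩ Z) := by
  have hpN := T.subset hp
  have hπp : T.π p = p := T.π_id p hp
  obtain ⟨e, hae, heU, hef, -⟩ := exists_local_inverse (T.isOpen_tubeCoord_domain p)
    (T.contMDiffOn_tubeCoord p) (a := p) ⟨hpN, by
      rw [mem_preimage, hπp]
      exact mem_chart_source _ p⟩ (by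
      have := T.tubeCoord_immersive hpN
      rwa [hπp] at this)
  refine ⟨e.source ∩ (chartAt Plane p).source, e.open_source.inter (chartAt Plane p).open_source,
    ⟨hae, mem_chart_source _ p⟩, inter_subset_right, ?_⟩
  rintro x ⟨hx, hxZ⟩ y ⟨hy, hyZ⟩ hxy
  apply e.injOn hx.1 hy.1
  rw [hef x hx.1, hef y hy.1, tubeCoord, tubeCoord, T.z_eq_zero hxZ, T.z_eq_zero hyZ,
    T.π_id x hxZ, T.π_id y hyZ, hxy]

/-- The inverse of the trivialisation of the tube is smooth. -/
lemma contMDiffOn_point : ContMDiffOn (𝓘(ℝ, ℝ).prod (𝓡 2)) (𝓡 2) ∞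
    (fun q : ℝ × M => T.point q.1 q.2) (Ioo (-T.δ) T.δ ×ˢ Z) := by
  rintro ⟨w, p⟩ ⟨hw, hp⟩
  obtain ⟨hxN, hxz, hxπ⟩ := T.point_spec hw hp
  set x := T.point w p
  obtain ⟨V, hV, hpV, hVs, hVi⟩ := T.coord_injOn hp
  have hU : IsOpen (T.N ∩ T.π ⁻¹' V) := T.π_smooth.continuousOn.isOpen_inter_preimage T.isOpen hV
  obtain ⟨e, hae, heU, hef, hes⟩ := exists_local_inverse hU
    ((T.contMDiffOn_tubeCoord p).mono (inter_subset_inter_right _ (preimage_mono hVs))) (a := x)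
    ⟨hxN, by rw [mem_preimage, hxπ]; exact hpV⟩ (by
      have := T.tubeCoord_immersive hxN
      rwa [hxπ] at this)
  set G : ℝ × M → Plane := fun q => pt q.1 (T.coord p q.2)
  have hG : ContMDiffOn (𝓘(ℝ, ℝ).prod (𝓡 2)) (𝓡 2) ∞ G
      (univ ×ˢ (chartAt (EuclideanSpace ℝ (Fin 2)) p).source) :=
    contDiff_pt.contMDiff.comp_contMDiffOn (contMDiffOn_fst.prodMk_space
      ((T.contMDiffOn_coord p).comp contMDiffOn_snd fun q hq => hq.2))
  have hop : IsOpen ((univ : Set ℝ) ×ˢ (chartAt (EuclideanSpace ℝ (Fin 2)) p).source) :=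
    isOpen_univ.prod (chartAt Plane p).open_source
  have hq0 : (w, p) ∈ (univ : Set ℝ) ×ˢ (chartAt (EuclideanSpace ℝ (Fin 2)) p).source :=
    ⟨mem_univ _, mem_chart_source _ p⟩
  have hGx : G (w, p) = e x := by
    rw [hef x hae]
    simp only [G, tubeCoord, hxz, hxπ]
  have hG0 : G (w, p) ∈ e.target := hGx ▸ e.map_source hae
  have hGat : ContMDiffAt (𝓘(ℝ, ℝ).prod (𝓡 2)) (𝓡 2) ∞ G (w, p) :=
    hG.contMDiffAt (hop.mem_nhds hq0)
  have hcomp : ContMDiffAt (𝓘(ℝ, ℝ).prod (𝓡 2)) (𝓡 2) ∞ (fun q => e.symm (G q)) (w, p) :=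
    (hes.contMDiffAt (e.open_target.mem_nhds hG0)).comp (w, p) hGat
  refine (hcomp.contMDiffWithinAt (s := Ioo (-T.δ) T.δ ×ˢ Z)).congr_of_eventuallyEq_of_mem ?_
    ⟨hw, hp⟩
  have hev : ∀ᶠ q in 𝓝 (w, p), G q ∈ e.target ∧ q.2 ∈ V :=
    (hGat.continuousAt.eventually_mem (e.open_target.mem_nhds hG0)).and
      (continuousAt_snd.eventually_mem (hV.mem_nhds hpV))
  -- Near (w, p) the map is the local inverse of `tubeCoord` after `G`: both points have the same
  -- height, and their projections to Z share the coordinate, which is injective on Z near `p`.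
  filter_upwards [mem_nhdsWithin_of_mem_nhds hev, self_mem_nhdsWithin] with q hq hqm
  have hy := e.map_target hq.1
  have h1 := e.right_inv hq.1
  rw [hef _ hy] at h1
  obtain ⟨h2, h3⟩ := pt_inj h1
  exact (T.eq_point (heU hy).1 h2
    (hVi ⟨(heU hy).2, T.π_mem (heU hy).1⟩ ⟨hq.2, hqm.2⟩ h3)).symm

end AdaptedTube
end Tube

/-! ### Minimal periods of continuous curves. -/

section Periods

/-- A continuous non-constant periodic curve has a minimal period. -/
lemma exists_minimal_period {X : Type*} [TopologicalSpace X] [T2Space X] {γ : ℝ → X}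
    (hγ : Continuous γ) (hne : ∃ a b, γ a ≠ γ b) {c : ℝ} (hc : 0 < c) (hper : Periodic γ c) :
    ∃ P > 0, ∀ a, Periodic γ a ↔ ∃ n : ℤ, a = n * P := by
  let G : AddSubgroup ℝ :=
    { carrier := {a | Periodic γ a}
      add_mem' := fun {a b} ha hb => ha.add_period hb
      zero_mem' := fun x => by rw [add_zero]
      neg_mem' := fun {a} ha => ha.neg }
  have hGmem : ∀ a, a ∈ G ↔ Periodic γ a := fun a => Iff.rfl
  have hclosed : IsClosed (G : Set ℝ) := by
    have : (G : Set ℝ) = ⋂ x, {a | γ (x + a) = γ x} := by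
      ext a
      simp only [SetLike.mem_coe, hGmem, mem_iInter, mem_ofPred_eq, Periodic]
    rw [this]
    exact isClosed_iInter fun x => isClosed_eq (by fun_prop) continuous_const
  -- The periods form a closed subgroup of the line. A dense one would be everything and force the
  -- curve to be constant.
  rcases AddSubgroup.dense_or_cyclic G with h | ⟨a, ha⟩
  · exfalso
    obtain ⟨a, b, hab⟩ := hne
    have : b - a ∈ G := by
      have h1 := h (b - a)
      rwa [hclosed.closure_eq] at h1
    have h2 := (hGmem _).1 this a
    rw [add_sub_cancel] at h2
    exact hab h2.symm
  · have hmem : ∀ x, Periodic γ x ↔ ∃ n : ℤ, n • a = x := fun x => by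
      rw [← hGmem, ha, AddSubgroup.mem_closure_singleton]
    have ha0 : a ≠ 0 := by
      rintro rfl
      obtain ⟨n, hn⟩ := (hmem c).1 hper
      rw [smul_zero] at hn
      exact hc.ne hn
    refine ⟨|a|, abs_pos.2 ha0, fun x => (hmem x).trans ?_⟩
    rcases abs_choice a with h | h <;> rw [h]
    · exact ⟨fun ⟨n, hn⟩ => ⟨n, by rw [← hn, zsmul_eq_mul]⟩, fun ⟨n, hn⟩ => ⟨n, by rw [hn, zsmul_eq_mul]⟩⟩
    · exact ⟨fun ⟨n, hn⟩ => ⟨-n, by rw [← hn, zsmul_eq_mul]; push_cast; ring⟩,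
        fun ⟨n, hn⟩ => ⟨-n, by rw [hn, zsmul_eq_mul]; push_cast; ring⟩⟩

end Periods

lemma isClosed_connectedComponentIn {X : Type*} [TopologicalSpace X] {F : Set X} (hF : IsClosed F)
    {p : X} (hp : p ∈ F) : IsClosed (connectedComponentIn F p) := by
  refine isClosed_of_closure_subset ?_
  exact isPreconnected_connectedComponentIn.closure.subset_connectedComponentIn
    (subset_closure (mem_connectedComponentIn hp))
    (closure_minimal (connectedComponentIn_subset F p) hF)

/-! ### Components of Z as closed Reeb orbits. -/

section CurvesInTube

variable {M : Type*} [TopologicalSpace M] [T2Space M] [CompactSpace M]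
  [ChartedSpace (EuclideanSpace ℝ (Fin 2)) M]
  [IsManifold (𝓡 2) ∞ M] {m : ℕ} {Z : Set M} {Ω : TwoTensor M}

namespace AdaptedTube

variable (T : AdaptedTube m Z Ω)

/-- An extension of the Reeb field to a global vector field. -/
lemma exists_global_reeb (hZ : IsClosed Z) : ∃ Y : VField M, IsSmoothVFieldOn Y univ ∧
    (∀ x ∈ Z, Y x = T.R x) ∧ ∀ x ∈ T.N, ∃ c : ℝ, Y x = c • T.R x := by
  obtain ⟨f, hf0, hf1, -⟩ := exists_contMDiffMap_zero_one_nhds_of_isClosed (n := ⊤) (𝓡 2)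
    T.isOpen.isClosed_compl hZ (disjoint_left.2 fun x hx hxZ => hx (T.subset hxZ))
  refine ⟨fun x => f x • T.R x, ?_, fun x hx => ?_, fun x _ => ⟨f x, rfl⟩⟩
  · intro x _
    apply ContMDiffAt.contMDiffWithinAt
    by_cases hx : x ∈ T.N
    · exact f.contMDiff.contMDiffAt.smul_section (T.R_smooth.contMDiffAt (T.isOpen.mem_nhds hx))
    · have hzero : ContMDiffAt (𝓡 2) (𝓡 2).tangent ∞
          (fun x : M => (⟨x, (0 : TangentSpace (𝓡 2) x)⟩ : TangentBundle (𝓡 2) M)) x :=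
        (Bundle.contMDiff_zeroSection ℝ (TangentSpace (𝓡 2) : M → Type _)).contMDiffAt
      refine hzero.congr_of_eventuallyEq ?_
      filter_upwards [Filter.Eventually.filter_mono (nhds_le_nhdsSet hx) hf0] with y hy
      rw [hy, zero_smul]
  · have := (Filter.Eventually.filter_mono (nhds_le_nhdsSet hx) hf1).self_of_nhds
    change f x • T.R x = T.R x
    rw [this, one_smul]

lemma isClosed_level_zero (hZ : IsClosed Z) : IsClosed {x ∈ T.N | T.z x = 0} := by
  convert hZ using 1
  ext x
  exact ⟨fun h => T.mem_Z h.1 h.2, fun h => ⟨T.subset h, T.z_eq_zero h⟩⟩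

/-- `γ` is an integral curve of the Reeb field inside `Z`. -/
structure IsReebCurve (γ : ℝ → M) : Prop where
  mem : ∀ t, γ t ∈ Z
  deriv : IsMIntegralCurve (I := 𝓡 2) γ T.R

variable {T}

lemma IsReebCurve.contMDiff {γ : ℝ → M} (h : T.IsReebCurve γ) : ContMDiff 𝓘(ℝ, ℝ) (𝓡 2) ∞ γ :=
  IsMIntegralCurve.contMDiff_of_contMDiffOn T.isOpen T.R_smooth h.deriv
    fun t => T.subset (h.mem t)

/-- Inside Z the curves are also integral curves of a global smooth extension of the Reeb field, to
which uniqueness applies. -/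
lemma IsReebCurve.eq_of_eq (hZ : IsClosed Z) {γ γ' : ℝ → M} (h : T.IsReebCurve γ)
    (h' : T.IsReebCurve γ') {t₀ : ℝ} (h0 : γ t₀ = γ' t₀) : γ = γ' := by
  have : IsManifold (𝓡 2) 1 M := IsManifold.of_le (n := ∞) (by exact_mod_cast le_top)
  obtain ⟨Y, hY, hYR, -⟩ := T.exists_global_reeb hZ
  have hY1 : ContMDiff (𝓡 2) (𝓡 2).tangent 1 (fun x ↦ (⟨x, Y x⟩ : TangentBundle (𝓡 2) M)) :=
    (contMDiffOn_univ.1 hY).of_le (by exact_mod_cast le_top)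
  have key : ∀ {γ : ℝ → M}, T.IsReebCurve γ → IsMIntegralCurve (I := 𝓡 2) γ Y := by
    intro γ h t
    rw [hYR _ (h.mem t)]
    exact h.deriv t
  exact isMIntegralCurve_Ioo_eq_of_contMDiff_boundaryless hY1 (key h) (key h') h0

lemma IsReebCurve.comp_add {γ : ℝ → M} (h : T.IsReebCurve γ) (a : ℝ) :
    T.IsReebCurve (fun t => γ (t + a)) :=
  ⟨fun _ => h.mem _, h.deriv.comp_add a⟩

lemma IsReebCurve.periodic_of_eq (hZ : IsClosed Z) {γ : ℝ → M} (h : T.IsReebCurve γ) {a b : ℝ}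
    (hab : γ a = γ b) : Periodic γ (a - b) := by
  have := (h.comp_add (a - b)).eq_of_eq hZ h (t₀ := b) (by simp [hab])
  exact fun t => congrFun this t

variable (T)

/-- The global extension is complete by compactness. It is tangent to the levels of `z`, so its
orbit through `p` never leaves Z, where it agrees with the Reeb field. -/
lemma exists_isReebCurve (hZ : IsClosed Z) {p : M} (hp : p ∈ Z) :
    ∃ γ : ℝ → M, T.IsReebCurve γ ∧ γ 0 = p := by
  obtain ⟨Y, hY, hYR, hYc⟩ := T.exists_global_reeb hZ
  have hY1 : ContMDiff (𝓡 2) (𝓡 2).tangent 1 (fun x ↦ (⟨x, Y x⟩ : TangentBundle (𝓡 2) M)) :=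
    (contMDiffOn_univ.1 hY).of_le (by exact_mod_cast le_top)
  obtain ⟨γ, h0, hγ⟩ := exists_isMIntegralCurve_of_compact hY1 p
  have hmem : ∀ t, γ t ∈ Z := by
    intro t
    have := mem_level_of_tangent T.isOpen T.z_def.1 (T.isClosed_level_zero hZ)
      (V := fun t => Y (γ t)) hγ (fun t' ht => by
        obtain ⟨c, hc⟩ := hYc _ ht
        change diff T.z (γ t') (Y (γ t')) = 0
        rw [hc, map_smul, T.dz_R _ ht, smul_zero])
      (t₀ := 0) ⟨h0 ▸ T.subset hp, h0 ▸ T.z_eq_zero hp⟩ t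
    exact T.mem_Z this.1 this.2
  refine ⟨γ, ⟨hmem, fun t => ?_⟩, h0⟩
  rw [← hYR _ (hmem t)]
  exact hγ t

variable {T}

/-- Reeb curves are open in `Z`. -/
lemma IsReebCurve.image_mem_nhdsWithin {γ : ℝ → M} (h : T.IsReebCurve γ) (t₀ : ℝ) {U : Set ℝ}
    (hU : U ∈ 𝓝 t₀) : γ '' U ∈ 𝓝[Z] (γ t₀) := by
  obtain ⟨V, hV, hpV, hVs, hVi⟩ := T.coord_injOn (h.mem t₀)
  have hsm : ContDiffAt ℝ ∞ (fun t => T.coord (γ t₀) (γ t)) t₀ := by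
    rw [← contMDiffAt_iff_contDiffAt]
    exact ((T.contMDiffOn_coord (γ t₀)).contMDiffAt ((chartAt Plane (γ t₀)).open_source.mem_nhds
      (mem_chart_source _ _))).comp t₀ h.contMDiff.contMDiffAt
  have hder : HasDerivAt (fun t => T.coord (γ t₀) (γ t))
      (inner ℝ (T.reebVec (γ t₀)) (T.reebVec (γ t₀))) t₀ := by
    have h3 : HasMFDerivAt 𝓘(ℝ, ℝ) 𝓘(ℝ, ℝ) (fun t => T.coord (γ t₀) (γ t)) t₀
        (ContinuousLinearMap.toSpanSingleton ℝ
          (inner ℝ (T.reebVec (γ t₀)) (T.reebVec (γ t₀)) : ℝ)) :=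
      ((T.hasMFDerivAt_coord (γ t₀)).comp t₀ (h.deriv t₀)).congr_mfderiv (by
        ext1
        change inner ℝ (T.reebVec (γ t₀)) ((1 : ℝ) • T.reebVec (γ t₀)) = (1 : ℝ) • _
        rw [one_smul, one_smul])
    exact hasDerivAt_iff_hasFDerivAt.2 h3.hasFDerivAt
  have hne : inner ℝ (T.reebVec (γ t₀)) (T.reebVec (γ t₀)) ≠ 0 := fun h0 =>
    T.R_ne_zero (T.subset (h.mem t₀)) (inner_self_eq_zero.1 h0)
  -- Along the curve the coordinate has derivative |R|² ≠ 0, so it is open there. Injectivity of the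
  -- coordinate on Z turns this into openness in Z.
  have hmap := (hsm.hasStrictDerivAt' hder (by simp)).map_nhds_eq hne
  have hUV : U ∩ γ ⁻¹' V ∈ 𝓝 t₀ := Filter.inter_mem hU
    (h.contMDiff.continuous.continuousAt.preimage_mem_nhds (hV.mem_nhds hpV))
  have him := Filter.image_mem_map (m := fun t => T.coord (γ t₀) (γ t)) hUV
  rw [hmap] at him
  have hcc : ContinuousAt (T.coord (γ t₀)) (γ t₀) :=
    (T.contMDiffOn_coord (γ t₀)).continuousOn.continuousAt
      ((chartAt Plane (γ t₀)).open_source.mem_nhds (mem_chart_source _ _))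
  filter_upwards [self_mem_nhdsWithin, mem_nhdsWithin_of_mem_nhds (hV.mem_nhds hpV),
    mem_nhdsWithin_of_mem_nhds (hcc.preimage_mem_nhds him)] with y hyZ hyV ⟨t, ht, hty⟩
  exact ⟨t, ht.1, hVi ⟨ht.2, h.mem t⟩ ⟨hyV, hyZ⟩ hty⟩

/-- Reeb orbits are connected, relatively open and pairwise disjoint or equal, and they cover Z. An
orbit is thus relatively clopen. -/
lemma IsReebCurve.range_eq (hZ : IsClosed Z) {γ : ℝ → M} (h : T.IsReebCurve γ) {p : M}
    (hp : p ∈ range γ) : range γ = connectedComponentIn Z p := by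
  have hsub : range γ ⊆ Z := by
    rintro _ ⟨t, rfl⟩
    exact h.mem t
  apply subset_antisymm
  · exact (isPreconnected_range h.contMDiff.continuous).subset_connectedComponentIn hp hsub
  · have hnhds : ∀ {γ : ℝ → M}, T.IsReebCurve γ → ∀ y ∈ range γ, ∃ V, IsOpen V ∧ y ∈ V ∧
        V ∩ Z ⊆ range γ := by
      rintro γ h _ ⟨t, rfl⟩
      have := h.image_mem_nhdsWithin t Filter.univ_mem
      rw [image_univ] at this
      obtain ⟨V, hV, hy, hVs⟩ := mem_nhdsWithin.1 this
      exact ⟨V, hV, hy, hVs⟩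
    set A := {y | ∃ V, IsOpen V ∧ y ∈ V ∧ V ∩ Z ⊆ range γ}
    set A' := {y | ∃ V, IsOpen V ∧ y ∈ V ∧ V ∩ Z ⊆ (range γ)ᶜ}
    have hA : IsOpen A := isOpen_iff_mem_nhds.2 fun y ⟨V, hV, hy, hs⟩ =>
      Filter.mem_of_superset (hV.mem_nhds hy) fun y' hy' => ⟨V, hV, hy', hs⟩
    have hA' : IsOpen A' := isOpen_iff_mem_nhds.2 fun y ⟨V, hV, hy, hs⟩ =>
      Filter.mem_of_superset (hV.mem_nhds hy) fun y' hy' => ⟨V, hV, hy', hs⟩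
    have hcov : Z ⊆ A ∪ A' := by
      intro y hy
      by_cases hyγ : y ∈ range γ
      · exact Or.inl (hnhds h y hyγ)
      · obtain ⟨γ', h', h0⟩ := T.exists_isReebCurve hZ hy
        obtain ⟨V, hV, hyV, hs⟩ := hnhds h' y ⟨0, h0⟩
        refine Or.inr ⟨V, hV, hyV, fun x hx => ?_⟩
        rintro ⟨t, rfl⟩
        obtain ⟨s, hs⟩ := hs hx
        have := (h'.comp_add (s - t)).eq_of_eq hZ h (t₀ := t) (by simp [hs])
        apply hyγ
        rw [← h0, ← this]
        exact ⟨t - s, by simp⟩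
    have hpre := isPreconnected_connectedComponentIn (F := Z) (x := p)
    have hcZ := connectedComponentIn_subset Z p
    intro y hy
    by_contra hyn
    have hyA' : y ∈ A' := by
      rcases hcov (hcZ hy) with ⟨V, -, hyV, hs⟩ | h'
      · exact absurd (hs ⟨hyV, hcZ hy⟩) hyn
      · exact h'
    obtain ⟨x, hx, ⟨V, -, hxV, hs⟩, ⟨V', -, hxV', hs'⟩⟩ := hpre A A' hA hA' (hcZ.trans hcov)
      ⟨p, mem_connectedComponentIn (hsub hp), hnhds h p hp⟩ ⟨y, hy, hyA'⟩
    exact hs' ⟨hxV', hcZ hx⟩ (hs ⟨hxV, hcZ hx⟩)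

/-- The orbit is a component of Z, hence compact, which prevents it from being an injective image of
the line. A coincidence of two values is a period, and a minimal period exists because the curve is
not constant. -/
lemma IsReebCurve.exists_period (hZ : IsClosed Z) {γ : ℝ → M} (h : T.IsReebCurve γ) :
    ∃ P > 0, ∀ a b, γ a = γ b ↔ ∃ n : ℤ, a = b + n * P := by
  have hcont := h.contMDiff.continuous
  have hrange : range γ = connectedComponentIn Z (γ 0) := h.range_eq hZ ⟨0, rfl⟩
  have hcomp : IsCompact (range γ) := by
    rw [hrange]
    exact (isClosed_connectedComponentIn hZ (h.mem 0)).isCompact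
  have hsub : range γ ⊆ Z := by
    rintro _ ⟨t, rfl⟩
    exact h.mem t
  have hnotinj : ∃ a b, a ≠ b ∧ γ a = γ b := by
    -- The arcs over (-n, n) are relatively open and exhaust the compact orbit, so one of them is
    -- already everything, and a later point of the curve repeats an earlier one.
    have hO : ∀ n : ℕ, ∃ O : Set M, IsOpen O ∧ O ∩ Z = γ '' Ioo (-(n : ℝ)) n := by
      intro n
      refine ⟨⋃₀ {V | IsOpen V ∧ V ∩ Z ⊆ γ '' Ioo (-(n : ℝ)) n}, isOpen_sUnion fun V hV => hV.1, ?_⟩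
      apply subset_antisymm
      · rintro x ⟨⟨V, hV, hx⟩, hxZ⟩
        exact hV.2 ⟨hx, hxZ⟩
      · rintro _ ⟨t, ht, rfl⟩
        obtain ⟨V, hV, hy, hVs⟩ := mem_nhdsWithin.1
          (h.image_mem_nhdsWithin t (isOpen_Ioo.mem_nhds ht))
        exact ⟨⟨V, ⟨hV, hVs⟩, hy⟩, h.mem t⟩
    choose O hO hOZ using hO
    have hcov : range γ ⊆ ⋃ n, O n := by
      rintro _ ⟨t, rfl⟩
      obtain ⟨n, hn⟩ := exists_nat_gt |t|
      have : γ t ∈ O n ∩ Z := by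
        rw [hOZ]
        exact ⟨t, abs_lt.1 hn, rfl⟩
      exact mem_iUnion.2 ⟨n, this.1⟩
    obtain ⟨s, hs⟩ := hcomp.elim_finite_subcover O hO hcov
    obtain ⟨n, hn⟩ := exists_nat_ge (s.sup id)
    have := hs ⟨n + 1, rfl⟩
    simp only [mem_iUnion] at this
    obtain ⟨k, hk, hmem⟩ := this
    have h2 : γ (n + 1) ∈ O k ∩ Z := ⟨hmem, h.mem _⟩
    rw [hOZ] at h2
    obtain ⟨t, ht, hte⟩ := h2
    refine ⟨n + 1, t, ?_, hte.symm⟩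
    have hkn : k ≤ n := (Finset.le_sup (f := id) hk).trans (by exact_mod_cast hn)
    have : (k : ℝ) ≤ n := by exact_mod_cast hkn
    intro heq
    linarith [ht.2]
  obtain ⟨a, b, hab, hγab⟩ := hnotinj
  have hper := h.periodic_of_eq hZ hγab
  have hc : ∃ c > 0, Periodic γ c := by
    rcases lt_or_gt_of_ne hab with h' | h'
    · exact ⟨b - a, sub_pos.2 h', h.periodic_of_eq hZ hγab.symm⟩
    · exact ⟨a - b, sub_pos.2 h', hper⟩
  obtain ⟨c, hc, hcper⟩ := hc
  have hne : ∃ a b, γ a ≠ γ b := by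
    by_contra! hcon
    have h1 : HasMFDerivAt 𝓘(ℝ, ℝ) (𝓡 2) γ 0
        (0 : TangentSpace 𝓘(ℝ, ℝ) (0 : ℝ) →L[ℝ] TangentSpace (𝓡 2) (γ 0)) :=
      (hasMFDerivAt_const (γ 0) (0 : ℝ)).congr_of_eventuallyEq
        (Filter.Eventually.of_forall fun t => hcon t 0)
    have h2 := hasMFDerivAt_unique h1 (h.deriv 0)
    have h3 := congrArg (fun L : ℝ →L[ℝ] EuclideanSpace ℝ (Fin 2) => L 1) h2
    apply T.R_ne_zero (T.subset (h.mem 0))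
    have h4 : (0 : Plane) = (1 : ℝ) • T.reebVec (γ 0) := h3
    rw [one_smul] at h4
    exact h4.symm
  obtain ⟨P, hP, hPer⟩ := exists_minimal_period hcont hne hc hcper
  refine ⟨P, hP, fun a b => ⟨fun hab => ?_, ?_⟩⟩
  · obtain ⟨n, hn⟩ := (hPer _).1 (h.periodic_of_eq hZ hab)
    exact ⟨n, by linarith⟩
  · rintro ⟨n, rfl⟩
    exact (hPer _).2 ⟨n, rfl⟩ b

variable (T)

/-- Components of `Z` are relatively open. -/
lemma exists_open_component (T : AdaptedTube m Z Ω) (hZ : IsClosed Z) {p : M} (hp : p ∈ Z) :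
    ∃ V, IsOpen V ∧ p ∈ V ∧ V ∩ Z ⊆ connectedComponentIn Z p := by
  obtain ⟨γ, h, h0⟩ := T.exists_isReebCurve hZ hp
  have := h.image_mem_nhdsWithin 0 Filter.univ_mem
  rw [image_univ, h.range_eq hZ ⟨0, h0⟩, h0] at this
  obtain ⟨V, hV, hy, hVs⟩ := mem_nhdsWithin.1 this
  exact ⟨V, hV, hy, hVs⟩

/-- Components are relatively open and Z is compact. -/
lemma finite_components (T : AdaptedTube m Z Ω) (hZ : IsClosed Z) : {C : Set M | IsComponentOf C Z}.Finite := by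
  choose! V hV hpV hVs using fun p (hp : p ∈ Z) => T.exists_open_component hZ hp
  obtain ⟨s, hsZ, hs⟩ := hZ.isCompact.elim_nhds_subcover V fun p hp => (hV p hp).mem_nhds (hpV p hp)
  refine (s.finite_toSet.image (connectedComponentIn Z)).subset ?_
  rintro _ ⟨q, hq, rfl⟩
  obtain ⟨p, hp, hqp⟩ := mem_iUnion₂.1 (hs hq)
  exact ⟨p, hp, (connectedComponentIn_eq (hVs p (hsZ p hp) ⟨hqp, hq⟩))⟩

lemma finite_ends (hZ : IsClosed Z) (V : Set M) : (T.ends V).Finite := by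
  refine ((T.finite_components hZ).prod (Set.finite_univ (α := ℤˣ))).subset ?_
  rintro ⟨C, s⟩ h
  exact ⟨h.1, mem_univ _⟩

end AdaptedTube
end CurvesInTube

/-! ### Diffeomorphisms induced by local diffeomorphisms with equal fibres. -/

section QuotientDiffeo

variable {A B C : Type*} [TopologicalSpace A] [ChartedSpace Plane A] [IsManifold (𝓡 2) ∞ A]
  [TopologicalSpace B] [ChartedSpace Plane B] [IsManifold (𝓡 2) ∞ B]
  [TopologicalSpace C] [ChartedSpace Plane C] [IsManifold (𝓡 2) ∞ C]

lemma isOpen_image_of_immersive {P : A → B} {O : Set A} (hO : IsOpen O)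
    (hP : ContMDiffOn (𝓡 2) (𝓡 2) ∞ P O)
    (hPi : ∀ y ∈ O, ∀ v, mfderiv (𝓡 2) (𝓡 2) P y v = 0 → v = 0) : IsOpen (P '' O) := by
  rw [isOpen_iff_mem_nhds]
  rintro _ ⟨y, hy, rfl⟩
  obtain ⟨e, hye, heO, hee, -⟩ := exists_local_inverse hO hP hy (hPi y hy)
  refine Filter.mem_of_superset (e.open_target.mem_nhds (hee y hye ▸ e.map_source hye)) ?_
  intro x hx
  exact ⟨e.symm x, heO (e.map_target hx), by rw [← hee _ (e.map_target hx), e.right_inv hx]⟩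

lemma contMDiffOn_of_comp_immersive {P : A → B} {E : A → C} {O : Set A} (hO : IsOpen O)
    (hP : ContMDiffOn (𝓡 2) (𝓡 2) ∞ P O)
    (hPi : ∀ y ∈ O, ∀ v, mfderiv (𝓡 2) (𝓡 2) P y v = 0 → v = 0)
    (hE : ContMDiffOn (𝓡 2) (𝓡 2) ∞ E O) {f : B → C} (hf : ∀ y ∈ O, f (P y) = E y) :
    ContMDiffOn (𝓡 2) (𝓡 2) ∞ f (P '' O) := by
  rintro _ ⟨y, hy, rfl⟩
  obtain ⟨e, hye, heO, hee, hes⟩ := exists_local_inverse hO hP hy (hPi y hy)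
  have hmem : P y ∈ e.target := hee y hye ▸ e.map_source hye
  have h1 : ContMDiffOn (𝓡 2) (𝓡 2) ∞ (fun x => E (e.symm x)) e.target :=
    hE.comp hes fun x hx => heO (e.map_target hx)
  refine ((h1.contMDiffAt (e.open_target.mem_nhds hmem)).congr_of_eventuallyEq ?_).contMDiffWithinAt
  filter_upwards [e.open_target.mem_nhds hmem] with x hx
  have h2 := hf _ (heO (e.map_target hx))
  rwa [← hee _ (e.map_target hx), e.right_inv hx] at h2

/-- Two local diffeomorphisms with the same fibres induce a diffeomorphism of their images. -/
lemma exists_diffeo_of_same_fibres {P : A → B} {E : A → C} {O : Set A} (hO : IsOpen O)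
    (hP : ContMDiffOn (𝓡 2) (𝓡 2) ∞ P O)
    (hPi : ∀ y ∈ O, ∀ v, mfderiv (𝓡 2) (𝓡 2) P y v = 0 → v = 0)
    (hE : ContMDiffOn (𝓡 2) (𝓡 2) ∞ E O)
    (hEi : ∀ y ∈ O, ∀ v, mfderiv (𝓡 2) (𝓡 2) E y v = 0 → v = 0)
    (hfib : ∀ y ∈ O, ∀ y' ∈ O, P y = P y' ↔ E y = E y') (hne : O.Nonempty) :
    ∃ φ : OpenPartialHomeomorph B C, φ.source = P '' O ∧ φ.target = E '' O ∧
      (∀ y ∈ O, φ (P y) = E y) ∧ ContMDiffOn (𝓡 2) (𝓡 2) ∞ φ φ.source ∧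
      ContMDiffOn (𝓡 2) (𝓡 2) ∞ φ.symm φ.target := by
  have : Nonempty A := ⟨hne.some⟩
  set f : B → C := fun x => E (invFunOn P O x)
  set g : C → B := fun x => P (invFunOn E O x)
  have hf : ∀ y ∈ O, f (P y) = E y := fun y hy => by
    have h1 : ∃ a ∈ O, P a = P y := ⟨y, hy, rfl⟩
    exact (hfib _ (invFunOn_mem h1) _ hy).1 (invFunOn_eq h1)
  have hg : ∀ y ∈ O, g (E y) = P y := fun y hy => by
    have h1 : ∃ a ∈ O, E a = E y := ⟨y, hy, rfl⟩
    exact (hfib _ (invFunOn_mem h1) _ hy).2 (invFunOn_eq h1)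
  have hfs := contMDiffOn_of_comp_immersive hO hP hPi hE hf
  have hgs := contMDiffOn_of_comp_immersive hO hE hEi hP hg
  refine ⟨{ toFun := f
            invFun := g
            source := P '' O
            target := E '' O
            map_source' := ?_
            map_target' := ?_
            left_inv' := ?_
            right_inv' := ?_
            open_source := isOpen_image_of_immersive hO hP hPi
            open_target := isOpen_image_of_immersive hO hE hEi
            continuousOn_toFun := hfs.continuousOn
            continuousOn_invFun := hgs.continuousOn }, rfl, rfl, hf, hfs, hgs⟩
  · rintro _ ⟨y, hy, rfl⟩
    exact ⟨y, hy, (hf y hy).symm⟩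
  · rintro _ ⟨y, hy, rfl⟩
    exact ⟨y, hy, (hg y hy).symm⟩
  · rintro _ ⟨y, hy, rfl⟩
    rw [hf y hy, hg y hy]
  · rintro _ ⟨y, hy, rfl⟩
    rw [hg y hy, hf y hy]

end QuotientDiffeo

/-- The determinant of two vectors of the plane. -/
def det2 (v w : Plane) : ℝ := v 0 * w 1 - v 1 * w 0

/-! ### One side of a component of Z in height and Reeb time. -/

section Collar

variable {M : Type*} [TopologicalSpace M] [T2Space M] [CompactSpace M]
  [ChartedSpace (EuclideanSpace ℝ (Fin 2)) M]
  [IsManifold (𝓡 2) ∞ M] {m : ℕ} {Z : Set M} {Ω : TwoTensor M}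

/-- A side of a component of `Z`, given by a sign and a parametrisation by the Reeb flow. -/
structure AdaptedTube.Collar (T : AdaptedTube m Z Ω) where
  σ : ℝ
  γ : ℝ → M
  P : ℝ
  σσ : σ * σ = 1
  reeb : T.IsReebCurve γ
  P_pos : 0 < P
  period : ∀ a b, γ a = γ b ↔ ∃ n : ℤ, a = b + n * P

namespace AdaptedTube.Collar

variable {T : AdaptedTube m Z Ω} (c : T.Collar)

/-- The parametrisation of a side of the tube by height and Reeb time. -/
noncomputable def param (y : Plane) : M := T.point (c.σ * y 0) (c.γ (y 1))

/-- The coefficients of the Laurent series along the Reeb curve. -/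
noncomputable def coeff (i : ℕ) (τ : ℝ) : ℝ := T.α i (c.γ τ) (T.R (c.γ τ))

/-- The density of the symplectic form in the coordinates `param`. -/
noncomputable def density (w τ : ℝ) : ℝ :=
  ∑ i ∈ Finset.Icc 1 m, ((c.σ * w) ^ i)⁻¹ * (c.σ * c.coeff i τ)

lemma abs_σ : |c.σ| = 1 := by
  have h := abs_mul_abs_self c.σ
  rw [c.σσ] at h
  nlinarith [abs_nonneg c.σ]

lemma σ_ne : c.σ ≠ 0 := fun h => by simpa [h] using c.σσ

lemma mul_mem {w : ℝ} (hw : |w| < T.δ) : c.σ * w ∈ Ioo (-T.δ) T.δ := by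
  rwa [mem_Ioo, ← abs_lt, abs_mul, c.abs_σ, one_mul]

lemma param_spec {y : Plane} (hy : |y 0| < T.δ) :
    c.param y ∈ T.N ∧ T.z (c.param y) = c.σ * y 0 ∧ T.π (c.param y) = c.γ (y 1) :=
  T.point_spec (c.mul_mem hy) (c.reeb.mem _)

/-- The domain of `param`. -/
def dom (T : AdaptedTube m Z Ω) : Set Plane := {y | |y 0| < T.δ}

lemma isOpen_dom : IsOpen (dom T) :=
  isOpen_lt ((contDiff_coord 0).continuous.abs) continuous_const

lemma contMDiffOn_param : ContMDiffOn (𝓡 2) (𝓡 2) ∞ c.param (dom T) := by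
  have h1 : ContMDiff (𝓡 2) 𝓘(ℝ, ℝ) ∞ (fun y : Plane => c.σ * y 0) :=
    (contDiff_const.mul (contDiff_coord 0)).contMDiff
  have h2 : ContMDiff (𝓡 2) (𝓡 2) ∞ (fun y : Plane => c.γ (y 1)) :=
    c.reeb.contMDiff.comp (contDiff_coord 1).contMDiff
  exact T.contMDiffOn_point.comp (h1.prodMk h2).contMDiffOn
    fun y hy => ⟨c.mul_mem hy, c.reeb.mem _⟩

lemma mdiff_param {y : Plane} (hy : y ∈ dom T) : MDifferentiableAt (𝓡 2) (𝓡 2) c.param y :=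
  (c.contMDiffOn_param.contMDiffAt (isOpen_dom.mem_nhds hy)).mdifferentiableAt (by simp)

/-- The derivative of `param`. -/
noncomputable def dparam (y : Plane) (v : Plane) : TangentSpace (𝓡 2) (c.param y) :=
  mfderiv (𝓡 2) (𝓡 2) c.param y v

lemma diff_z_dparam {y : Plane} (hy : y ∈ dom T) (v : Plane) :
    diff T.z (c.param y) (c.dparam y v) = c.σ * v 0 := by
  have h1 := (T.mdiff_z (c.param_spec hy).1).hasMFDerivAt.comp y (c.mdiff_param hy).hasMFDerivAt
  have h2 : HasMFDerivAt (𝓡 2) 𝓘(ℝ, ℝ) (T.z ∘ c.param) y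
      (c.σ • (EuclideanSpace.proj 0 : Plane →L[ℝ] ℝ)) := by
    have h3 : HasMFDerivAt (𝓡 2) 𝓘(ℝ, ℝ) (fun y : Plane => c.σ * y 0) y
        (c.σ • (EuclideanSpace.proj 0 : Plane →L[ℝ] ℝ)) :=
      ((EuclideanSpace.proj 0 : Plane →L[ℝ] ℝ).hasFDerivAt.const_mul c.σ).hasMFDerivAt
    refine h3.congr_of_eventuallyEq ?_
    filter_upwards [isOpen_dom.mem_nhds hy] with y' hy'
    exact (c.param_spec hy').2.1
  exact congrArg (fun L : Plane →L[ℝ] ℝ => L v) (hasMFDerivAt_unique h1 h2)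

lemma mfderiv_π_dparam {y : Plane} (hy : y ∈ dom T) (v : Plane) :
    mfderiv (𝓡 2) (𝓡 2) T.π (c.param y) (c.dparam y v) = v 1 • T.reebVec (c.γ (y 1)) := by
  have h1 := (T.mdiff_π (c.param_spec hy).1).hasMFDerivAt.comp y (c.mdiff_param hy).hasMFDerivAt
  have h3 : HasMFDerivAt (𝓡 2) 𝓘(ℝ, ℝ) (fun y : Plane => y 1) y
      (EuclideanSpace.proj 1 : Plane →L[ℝ] ℝ) :=
    (EuclideanSpace.proj 1 : Plane →L[ℝ] ℝ).hasFDerivAt.hasMFDerivAt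
  have h2 := ((c.reeb.deriv (y 1)).comp y h3).congr_of_eventuallyEq
    (f₁ := T.π ∘ c.param) (by
      filter_upwards [isOpen_dom.mem_nhds hy] with y' hy'
      exact (c.param_spec hy').2.2)
  exact congrArg (fun L : Plane →L[ℝ] Plane => L v) (hasMFDerivAt_unique h1 h2)

lemma param_immersive {y : Plane} (hy : y ∈ dom T) (v : Plane) (hv : c.dparam y v = 0) : v = 0 := by
  have h0 := c.diff_z_dparam hy v
  have h1 := c.mfderiv_π_dparam hy v
  rw [hv, map_zero] at h0 h1
  have h0' : v 0 = 0 := by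
    rcases mul_eq_zero.1 h0.symm with h | h
    exacts [absurd h c.σ_ne, h]
  have h1' : v 1 = 0 := by
    rcases smul_eq_zero.1 h1.symm with h | h
    exacts [h, absurd h (T.R_ne_zero (T.subset (c.reeb.mem _)))]
  ext i
  fin_cases i
  exacts [h0', h1']

lemma dparam_surjective {y : Plane} (hy : y ∈ dom T) (w : TangentSpace (𝓡 2) (c.param y)) :
    ∃ v, c.dparam y v = w := by
  obtain ⟨L, hL⟩ : ∃ L : Plane →L[ℝ] Plane, L = mfderiv (𝓡 2) (𝓡 2) c.param y := ⟨_, rfl⟩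
  have hi : Injective L.toLinearMap :=
    (injective_iff_map_eq_zero _).2 fun v hv => c.param_immersive hy v (by
      unfold dparam
      rw [← hL]
      exact hv)
  obtain ⟨v, hv⟩ := LinearMap.injective_iff_surjective.1 hi w
  refine ⟨v, ?_⟩
  unfold dparam
  rw [← hL]
  exact hv

lemma notMem_Z {y : Plane} (hy : y ∈ dom T) (h0 : y 0 ≠ 0) : c.param y ∉ Z := by
  intro h
  have := T.z_eq_zero h
  rw [(c.param_spec hy).2.1] at this
  exact (mul_ne_zero c.σ_ne h0) this

/-- The symplectic form in the coordinates `param`. -/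
lemma form_dparam {y : Plane} (hy : y ∈ dom T) (h0 : y 0 ≠ 0) (v w : Plane) :
    Ω (c.param y) (c.dparam y v) (c.dparam y w) = c.density (y 0) (y 1) * det2 v w := by
  have hx := (c.param_spec hy).1
  rw [T.laurent _ ⟨hx, c.notMem_Z hy h0⟩, density, Finset.sum_mul]
  refine Finset.sum_congr rfl fun i _ => ?_
  rw [c.diff_z_dparam hy, c.diff_z_dparam hy, c.mfderiv_π_dparam hy, c.mfderiv_π_dparam hy,
    (c.param_spec hy).2.1]
  have hα : ∀ u : Plane, T.α i (T.π (c.param y)) (u 1 • T.reebVec (c.γ (y 1))) =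
      u 1 * c.coeff i (y 1) := by
    intro u
    rw [(c.param_spec hy).2.2]
    exact (T.α i (c.γ (y 1))).map_smul (u 1) (T.R (c.γ (y 1)))
  rw [hα, hα, det2]
  ring

/-- A zero of the density would put the image of ∂/∂w in the kernel of the form. -/
lemma density_ne_zero (hΩ : IsSymplecticOn Ω Zᶜ) {w : ℝ} (hw : |w| < T.δ) (h0 : w ≠ 0) (τ : ℝ) :
    c.density w τ ≠ 0 := by
  intro hd
  have hy : pt w τ ∈ dom T := hw
  have h1 : c.dparam (pt w τ) (pt 1 0) = 0 := by
    refine hΩ.2 _ (c.notMem_Z hy h0) _ fun u => ?_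
    obtain ⟨v, rfl⟩ := c.dparam_surjective hy u
    rw [c.form_dparam hy h0, pt_zero, pt_one, hd, zero_mul]
  have h2 := congrArg (fun y : Plane => y 0) (c.param_immersive hy _ h1)
  simp at h2

lemma contDiff_coeff (i : ℕ) : ContDiff ℝ ∞ (c.coeff i) := by
  rw [← contMDiff_iff_contDiff]
  have hR : ContMDiff 𝓘(ℝ, ℝ) (𝓡 2).tangent ∞
      (fun τ => (⟨c.γ τ, T.R (c.γ τ)⟩ : TangentBundle (𝓡 2) M)) :=
    T.R_smooth.comp_contMDiff c.reeb.contMDiff fun τ => T.subset (c.reeb.mem τ)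
  have hα := (T.α_smooth i).comp_contMDiff c.reeb.contMDiff fun τ => T.subset (c.reeb.mem τ)
  intro τ
  have := ContMDiffAt.clm_bundle_apply (E₂ := Bundle.Trivial M ℝ) (F₂ := ℝ) (hα τ) (hR τ)
  rw [Bundle.contMDiffAt_totalSpace] at this
  exact this.2

lemma coeff_add_period (i : ℕ) (τ : ℝ) : c.coeff i (τ + c.P) = c.coeff i τ := by
  have : c.γ (τ + c.P) = c.γ τ := (c.period _ _).2 ⟨1, by simp⟩
  unfold coeff
  rw [this]

end AdaptedTube.Collar
end Collar

lemma norm_sq_plane (y : Plane) : ‖y‖ ^ 2 = y 0 ^ 2 + y 1 ^ 2 := by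
  rw [EuclideanSpace.norm_sq_eq, Fin.sum_univ_two]
  simp

lemma plane_decomp (v : Plane) : v = v 0 • pt 1 0 + v 1 • pt 0 1 := by
  ext i
  fin_cases i <;> simp [pt]

lemma contDiff_primitive {f : ℝ → ℝ} (hf : ContDiff ℝ ∞ f) :
    ContDiff ℝ ∞ (fun τ => ∫ s in (0:ℝ)..τ, f s) := by
  have hd : ∀ τ, HasDerivAt (fun τ => ∫ s in (0:ℝ)..τ, f s) (f τ) τ := fun τ =>
    (hf.continuous.integral_hasStrictDerivAt 0 τ).hasDerivAt
  rw [contDiff_infty_iff_deriv]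
  refine ⟨fun τ => (hd τ).differentiableAt, ?_⟩
  rwa [show deriv (fun τ => ∫ s in (0:ℝ)..τ, f s) = f from funext fun τ => (hd τ).deriv]

/-! ### The symplectic angle and the polar coordinates of a cap. -/

section Angle

variable {M : Type*} [TopologicalSpace M] [T2Space M] [CompactSpace M]
  [ChartedSpace (EuclideanSpace ℝ (Fin 2)) M]
  [IsManifold (𝓡 2) ∞ M] {m : ℕ} {Z : Set M} {Ω : TwoTensor M}

namespace AdaptedTube.Collar

variable {T : AdaptedTube m Z Ω} (c : T.Collar)

/-- The primitive of the density in the Reeb time. -/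
noncomputable def prim (w τ : ℝ) : ℝ :=
  ∑ i ∈ Finset.Icc 1 m, ((c.σ * w) ^ i)⁻¹ * (c.σ * ∫ s in (0:ℝ)..τ, c.coeff i s)

/-- The derivative of the action with respect to the height. -/
noncomputable def action (w : ℝ) : ℝ := c.prim w c.P / (2 * Real.pi)

/-- The angle coordinate. -/
noncomputable def angle (w τ : ℝ) : ℝ := c.prim w τ / c.action w

lemma hasDerivAt_prim (w τ : ℝ) : HasDerivAt (c.prim w) (c.density w τ) τ := by
  unfold prim density
  refine HasDerivAt.fun_sum fun i _ => ?_
  exact (((c.contDiff_coeff i).continuous.integral_hasStrictDerivAt 0 τ).hasDerivAt.const_mul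
    c.σ).const_mul _

lemma prim_zero (w : ℝ) : c.prim w 0 = 0 := by simp [prim]

lemma prim_add_period (w τ : ℝ) : c.prim w (τ + c.P) = c.prim w τ + c.prim w c.P := by
  unfold prim
  rw [← Finset.sum_add_distrib]
  refine Finset.sum_congr rfl fun i _ => ?_
  have hper : Periodic (c.coeff i) c.P := c.coeff_add_period i
  have hint : ∀ a b, IntervalIntegrable (c.coeff i) MeasureTheory.volume a b := fun a b =>
    (c.contDiff_coeff i).continuous.intervalIntegrable a b
  have h1 := hper.intervalIntegral_add_eq τ 0
  rw [zero_add] at h1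
  rw [← intervalIntegral.integral_add_adjacent_intervals (hint 0 τ) (hint τ (τ + c.P)), h1]
  ring

/-- Rolle's theorem, since the derivative in τ is the nonvanishing density; its sign does not
matter. -/
lemma injective_prim (hΩ : IsSymplecticOn Ω Zᶜ) {w : ℝ} (hw : |w| < T.δ) (h0 : w ≠ 0) :
    Injective (c.prim w) := by
  have key : ∀ a b : ℝ, a < b → c.prim w a ≠ c.prim w b := by
    intro a b hab h
    obtain ⟨x, -, hx⟩ := exists_hasDerivAt_eq_zero hab
      (fun x _ => (c.hasDerivAt_prim w x).continuousAt.continuousWithinAt) h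
      (fun x _ => c.hasDerivAt_prim w x)
    exact c.density_ne_zero hΩ hw h0 x hx
  intro a b h
  rcases lt_trichotomy a b with hab | hab | hab
  exacts [absurd h (key a b hab), hab, absurd h.symm (key b a hab)]

lemma action_ne_zero (hΩ : IsSymplecticOn Ω Zᶜ) {w : ℝ} (hw : |w| < T.δ) (h0 : w ≠ 0) :
    c.action w ≠ 0 := by
  refine div_ne_zero (fun h => ?_) (by positivity)
  have := c.injective_prim hΩ hw h0 (h.trans (c.prim_zero w).symm)
  exact c.P_pos.ne' this

lemma hasDerivAt_angle (w τ : ℝ) :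
    HasDerivAt (c.angle w) (c.density w τ / c.action w) τ :=
  (c.hasDerivAt_prim w τ).div_const _

lemma injective_angle (hΩ : IsSymplecticOn Ω Zᶜ) {w : ℝ} (hw : |w| < T.δ) (h0 : w ≠ 0) :
    Injective (c.angle w) := fun a b h =>
  c.injective_prim hΩ hw h0 ((div_left_inj' (c.action_ne_zero hΩ hw h0)).1 h)

/-- Division by `action` normalises the increase over one Reeb period to 2π, for either sign of the
density. The angle minus its mean linear growth is then periodic. -/
lemma angle_add_int_mul (hΩ : IsSymplecticOn Ω Zᶜ) {w : ℝ} (hw : |w| < T.δ) (h0 : w ≠ 0)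
    (τ : ℝ) (n : ℤ) : c.angle w (τ + n * c.P) = c.angle w τ + n * (2 * Real.pi) := by
  have hB := c.action_ne_zero hΩ hw h0
  have hP := c.P_pos.ne'
  have h1 : ∀ τ, c.angle w (τ + c.P) = c.angle w τ + 2 * Real.pi := by
    intro τ
    unfold angle
    rw [c.prim_add_period, add_div]
    congr 1
    rw [div_eq_iff hB, action]
    field_simp
  have h2 : Periodic (fun τ => c.angle w τ - τ / c.P * (2 * Real.pi)) c.P := by
    intro τ
    simp only [h1]
    field_simp
    ring
  have h3 := h2.int_mul n τ
  simp only [add_div, mul_div_cancel_right₀ _ hP] at h3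
  linarith

lemma surjective_angle (hΩ : IsSymplecticOn Ω Zᶜ) {w : ℝ} (hw : |w| < T.δ) (h0 : w ≠ 0) :
    Surjective (c.angle w) := by
  intro θ
  have hpi : 0 < 2 * Real.pi := by positivity
  set n := ⌊θ / (2 * Real.pi)⌋
  have hz : c.angle w 0 = 0 := by rw [angle, c.prim_zero, zero_div]
  have h1 := c.angle_add_int_mul hΩ hw h0 0 n
  have h2 := c.angle_add_int_mul hΩ hw h0 0 (n + 1)
  rw [hz, zero_add, zero_add] at h1 h2
  have hmem : θ ∈ Icc (c.angle w (n * c.P)) (c.angle w ((n + 1 : ℤ) * c.P)) := by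
    rw [h1, h2]
    constructor
    · rw [← le_div_iff₀ hpi]
      exact Int.floor_le _
    · rw [← div_le_iff₀ hpi]
      push_cast
      exact (Int.lt_floor_add_one _).le
  have hle : (n : ℝ) * c.P ≤ (n + 1 : ℤ) * c.P := by
    push_cast
    nlinarith [c.P_pos]
  obtain ⟨τ, -, hτ⟩ := intermediate_value_Icc hle
    (fun x _ => (c.hasDerivAt_angle w x).continuousAt.continuousWithinAt) hmem
  exact ⟨τ, hτ⟩

lemma contDiffOn_prim : ContDiffOn ℝ ∞ (fun y : Plane => c.prim (y 0) (y 1)) {y | y 0 ≠ 0} := by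
  unfold prim
  refine ContDiffOn.sum fun i _ => ContDiffOn.mul ?_ ?_
  · refine ContDiffOn.inv ?_ fun y hy => pow_ne_zero _ (mul_ne_zero c.σ_ne hy)
    exact ((contDiff_const.mul (contDiff_coord 0)).pow i).contDiffOn
  · exact (contDiff_const.mul ((contDiff_primitive (c.contDiff_coeff i)).comp
      (contDiff_coord 1))).contDiffOn

lemma contDiffOn_action : ContDiffOn ℝ ∞ c.action {w | w ≠ 0} := by
  have h : ContDiff ℝ ∞ (fun w : ℝ => pt w c.P) := contDiff_pt.comp (contDiff_id.prodMk contDiff_const)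
  exact (c.contDiffOn_prim.comp h.contDiffOn fun w hw => hw).div_const _

/-- The heights allowed for a collar. -/
def strip (T : AdaptedTube m Z Ω) (a : ℝ) : Set Plane := {y | a < y 0 ∧ y 0 < T.δ}

lemma isOpen_strip (a : ℝ) : IsOpen (strip T a) :=
  (isOpen_lt continuous_const (contDiff_coord 0).continuous).inter
    (isOpen_lt (contDiff_coord 0).continuous continuous_const)

lemma strip_subset_dom {a : ℝ} (ha : 0 ≤ a) : strip T a ⊆ dom T := fun y hy =>
  abs_lt.2 ⟨by linarith [hy.1, T.δ_pos], hy.2⟩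

lemma contDiffOn_angle (hΩ : IsSymplecticOn Ω Zᶜ) :
    ContDiffOn ℝ ∞ (fun y : Plane => c.angle (y 0) (y 1)) (strip T 0) := by
  refine ContDiffOn.div (c.contDiffOn_prim.mono fun y hy => hy.1.ne') ?_ fun y hy =>
    c.action_ne_zero hΩ (strip_subset_dom le_rfl hy) hy.1.ne'
  exact c.contDiffOn_action.comp (contDiff_coord 0).contDiffOn fun y hy => hy.1.ne'

/-- The polar map: radius `√((w - a)/κ)` and the angle coordinate. -/
noncomputable def polar (a κ : ℝ) (y : Plane) : Plane :=
  pt (√(κ⁻¹ * (y 0 - a)) * Real.cos (c.angle (y 0) (y 1)))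
    (√(κ⁻¹ * (y 0 - a)) * Real.sin (c.angle (y 0) (y 1)))

variable {a κ : ℝ}

lemma radius_pos (hκ : 0 < κ) {y : Plane} (hy : y ∈ strip T a) : 0 < κ⁻¹ * (y 0 - a) :=
  mul_pos (inv_pos.2 hκ) (sub_pos.2 hy.1)

lemma norm_polar (hκ : 0 < κ) {y : Plane} (hy : y ∈ strip T a) :
    ‖c.polar a κ y‖ ^ 2 = κ⁻¹ * (y 0 - a) := by
  rw [norm_sq_plane, polar, pt_zero, pt_one, mul_pow, mul_pow, ← mul_add,
    Real.cos_sq_add_sin_sq, mul_one, Real.sq_sqrt (radius_pos hκ hy).le]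

lemma strip_mono (ha : 0 < a) : strip T a ⊆ strip T 0 := fun _ hy => ⟨ha.trans hy.1, hy.2⟩

lemma contDiffOn_polar (hΩ : IsSymplecticOn Ω Zᶜ) (ha : 0 < a) (hκ : 0 < κ) :
    ContDiffOn ℝ ∞ (c.polar a κ) (strip T a) := by
  have h1 : ContDiffOn ℝ ∞ (fun y : Plane => √(κ⁻¹ * (y 0 - a))) (strip T a) :=
    ContDiffOn.sqrt (contDiff_const.mul ((contDiff_coord 0).sub contDiff_const)).contDiffOn
      fun y hy => (radius_pos hκ hy).ne'
  have h2 := (c.contDiffOn_angle hΩ).mono (strip_mono ha)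
  exact contDiff_pt.comp_contDiffOn ((h1.mul (Real.contDiff_cos.comp_contDiffOn h2)).prodMk
    (h1.mul (Real.contDiff_sin.comp_contDiffOn h2)))

/-- In polar coordinates dx ∧ dy = r dr ∧ dθ, with r dr = dw/(2κ). The dw-component of dθ dies in
the wedge, so only ∂θ/∂τ = density/action remains. -/
lemma det_fderiv_polar (hΩ : IsSymplecticOn Ω Zᶜ) (ha : 0 < a) (hκ : 0 < κ) {y : Plane}
    (hy : y ∈ strip T a) (v w : Plane) :
    det2 (fderiv ℝ (c.polar a κ) y v) (fderiv ℝ (c.polar a κ) y w) =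
      (2 * κ)⁻¹ * (c.density (y 0) (y 1) / c.action (y 0)) * det2 v w := by
  have hD := ((c.contDiffOn_polar hΩ ha hκ).contDiffAt
    ((isOpen_strip a).mem_nhds hy)).differentiableAt (by simp) |>.hasFDerivAt
  obtain ⟨D, hDeq⟩ : ∃ D, D = fderiv ℝ (c.polar a κ) y := ⟨_, rfl⟩
  rw [← hDeq] at hD ⊢
  have hθ := ((c.contDiffOn_angle hΩ).contDiffAt
    ((isOpen_strip 0).mem_nhds (strip_mono ha hy))).differentiableAt (by simp) |>.hasFDerivAt
  obtain ⟨Θ, hΘeq⟩ : ∃ Θ, Θ = fderiv ℝ (fun y : Plane => c.angle (y 0) (y 1)) y := ⟨_, rfl⟩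
  rw [← hΘeq] at hθ
  have hΘ1 : Θ (pt 0 1) = c.density (y 0) (y 1) / c.action (y 0) := by
    have hline : HasDerivAt (fun τ => pt (y 0) τ) (pt 0 1) (y 1) := by
      have h : HasDerivAt (fun τ : ℝ => y 0 • pt 1 0 + τ • pt 0 1)
          (0 + (1 : ℝ) • pt 0 1) (y 1) :=
        (hasDerivAt_const _ _).add ((hasDerivAt_id _).smul_const _)
      rw [zero_add, one_smul] at h
      refine h.congr_of_eventuallyEq (Filter.Eventually.of_forall fun τ => ?_)
      beta_reduce
      rw [plane_decomp (pt (y 0) τ), pt_zero, pt_one]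
    have hθ' : HasFDerivAt (fun y : Plane => c.angle (y 0) (y 1)) Θ (pt (y 0) (y 1)) := by
      rwa [pt_eta]
    exact (hθ'.comp_hasDerivAt (y 1) hline).unique (c.hasDerivAt_angle (y 0) (y 1))
  have hr : HasFDerivAt (fun y : Plane => √(κ⁻¹ * (y 0 - a)))
      ((1 / (2 * √(κ⁻¹ * (y 0 - a)))) • (κ⁻¹ • (EuclideanSpace.proj 0 : Plane →L[ℝ] ℝ))) y :=
    (((EuclideanSpace.proj 0 : Plane →L[ℝ] ℝ).hasFDerivAt.sub_const a).const_mul κ⁻¹).sqrt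
      (radius_pos hκ hy).ne'
  set r := √(κ⁻¹ * (y 0 - a)) with hrdef
  set θ := c.angle (y 0) (y 1) with hθdef
  have hrpos : 0 < r := Real.sqrt_pos.2 (radius_pos hκ hy)
  have h0 : ∀ v, D v 0 = r * (-Real.sin θ * Θ v) + Real.cos θ * (1 / (2 * r) * (κ⁻¹ * v 0)) := by
    intro v
    have h1 := ((EuclideanSpace.proj 0 : Plane →L[ℝ] ℝ).hasFDerivAt.comp y hD).unique
      (hr.mul hθ.cos)
    exact congrArg (fun L : Plane →L[ℝ] ℝ => L v) h1
  have h1 : ∀ v, D v 1 = r * (Real.cos θ * Θ v) + Real.sin θ * (1 / (2 * r) * (κ⁻¹ * v 0)) := by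
    intro v
    have h1 := ((EuclideanSpace.proj 1 : Plane →L[ℝ] ℝ).hasFDerivAt.comp y hD).unique
      (hr.mul hθ.sin)
    exact congrArg (fun L : Plane →L[ℝ] ℝ => L v) h1
  have hΘv : ∀ v : Plane, Θ v = v 0 * Θ (pt 1 0) + v 1 * Θ (pt 0 1) := by
    intro v
    conv_lhs => rw [plane_decomp v]
    simp
  rw [det2, h0, h1, h0, h1, det2, ← hΘ1]
  have hcs := Real.sin_sq_add_cos_sq θ
  have e1 : (r * (-Real.sin θ * Θ v) + Real.cos θ * (1 / (2 * r) * (κ⁻¹ * v 0))) *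
      (r * (Real.cos θ * Θ w) + Real.sin θ * (1 / (2 * r) * (κ⁻¹ * w 0))) -
      (r * (Real.cos θ * Θ v) + Real.sin θ * (1 / (2 * r) * (κ⁻¹ * v 0))) *
      (r * (-Real.sin θ * Θ w) + Real.cos θ * (1 / (2 * r) * (κ⁻¹ * w 0))) =
      (Real.sin θ ^ 2 + Real.cos θ ^ 2) * (r * (1 / (2 * r))) * κ⁻¹ *
        (v 0 * Θ w - w 0 * Θ v) := by ring
  rw [e1, hcs, hΘv v, hΘv w]
  have e2 : r * (1 / (2 * r)) = 1 / 2 := by field_simp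
  rw [e2]
  ring

lemma polar_immersive (hΩ : IsSymplecticOn Ω Zᶜ) (ha : 0 < a) (hκ : 0 < κ) {y : Plane}
    (hy : y ∈ strip T a) (v : Plane) (hv : fderiv ℝ (c.polar a κ) y v = 0) : v = 0 := by
  have hne : (2 * κ)⁻¹ * (c.density (y 0) (y 1) / c.action (y 0)) ≠ 0 := by
    have h1 := strip_subset_dom le_rfl (strip_mono ha hy)
    have h2 := (strip_mono ha hy).1.ne'
    exact mul_ne_zero (by positivity) (div_ne_zero (c.density_ne_zero hΩ h1 h2 _)
      (c.action_ne_zero hΩ h1 h2))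
  have key : ∀ w, det2 v w = 0 := by
    intro w
    have := c.det_fderiv_polar hΩ ha hκ hy v w
    rw [hv] at this
    have h0 : det2 0 (fderiv ℝ (c.polar a κ) y w) = 0 := by simp [det2]
    rw [h0] at this
    rcases mul_eq_zero.1 this.symm with h | h
    exacts [absurd h hne, h]
  have k0 := key (pt 1 0)
  have k1 := key (pt 0 1)
  simp only [det2, pt_zero, pt_one] at k0 k1
  ext i
  fin_cases i
  · simpa using k1
  · simpa using k0

/-- Both maps identify exactly the points of equal height whose Reeb times differ by a multiple of
the period. On the polar side this is the quasi-periodicity and injectivity of the angle. -/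
lemma polar_fibres (hΩ : IsSymplecticOn Ω Zᶜ) (ha : 0 < a) (hκ : 0 < κ) {y y' : Plane}
    (hy : y ∈ strip T a) (hy' : y' ∈ strip T a) :
    c.param y = c.param y' ↔ c.polar a κ y = c.polar a κ y' := by
  have hd := strip_subset_dom le_rfl (strip_mono ha hy)
  have hd' := strip_subset_dom le_rfl (strip_mono ha hy')
  have hn := (strip_mono ha hy).1.ne'
  have h1 : c.param y = c.param y' ↔ y 0 = y' 0 ∧ ∃ n : ℤ, y 1 = y' 1 + n * c.P := by
    rw [← c.period]
    constructor
    · intro h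
      have hz := (c.param_spec hd).2.1
      have hπ := (c.param_spec hd).2.2
      rw [h, (c.param_spec hd').2.1] at hz
      rw [h, (c.param_spec hd').2.2] at hπ
      exact ⟨(mul_left_cancel₀ c.σ_ne hz).symm, hπ.symm⟩
    · rintro ⟨h, h'⟩
      unfold param
      rw [h, h']
  rw [h1]
  constructor
  · rintro ⟨h, n, hn'⟩
    unfold polar
    rw [hn', ← h, c.angle_add_int_mul hΩ hd hn, Real.cos_add_int_mul_two_pi,
      Real.sin_add_int_mul_two_pi]
  · intro h
    have hr := c.norm_polar hκ hy
    rw [h, c.norm_polar hκ hy'] at hr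
    have h0 : y 0 = y' 0 := by
      have := mul_left_cancel₀ (inv_ne_zero hκ.ne') hr
      linarith
    refine ⟨h0, ?_⟩
    have hrpos : √(κ⁻¹ * (y' 0 - a)) ≠ 0 := (Real.sqrt_pos.2 (radius_pos hκ hy')).ne'
    unfold polar at h
    rw [h0] at h
    obtain ⟨hc, hs⟩ := pt_inj h
    have hang := Real.Angle.cos_sin_inj (mul_left_cancel₀ hrpos hc) (mul_left_cancel₀ hrpos hs)
    obtain ⟨n, hn'⟩ := Real.Angle.angle_eq_iff_two_pi_dvd_sub.1 hang
    refine ⟨n, c.injective_angle hΩ hd' (h0 ▸ hn) ?_⟩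
    rw [c.angle_add_int_mul hΩ hd' (h0 ▸ hn)]
    linarith

lemma image_polar (hΩ : IsSymplecticOn Ω Zᶜ) (ha : 0 < a) (hκ : 0 < κ) :
    c.polar a κ '' strip T a = {y | y ≠ 0 ∧ ‖y‖ ^ 2 < κ⁻¹ * (T.δ - a)} := by
  apply subset_antisymm
  · rintro _ ⟨y, hy, rfl⟩
    have h1 := c.norm_polar hκ hy
    have h2 := radius_pos hκ hy
    refine ⟨fun h => ?_, ?_⟩
    · rw [h, norm_zero] at h1
      norm_num at h1
      rcases h1 with h1 | h1
      · exact hκ.ne' h1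
      · linarith [hy.1]
    · rw [h1]
      have := hy.2
      gcongr
  · rintro y ⟨hy0, hy⟩
    set x : ℂ := ⟨y 0, y 1⟩
    have hxn : ‖x‖ ^ 2 = ‖y‖ ^ 2 := by
      rw [norm_sq_plane, Complex.sq_norm, Complex.normSq_mk]
      ring
    have hyp : 0 < ‖y‖ ^ 2 := by
      have := norm_pos_iff.2 hy0
      positivity
    -- The height is read off from the radius, and the Reeb time is then chosen so that the angle
    -- equals the argument of the point.
    set w := a + κ * ‖x‖ ^ 2
    have hw : κ⁻¹ * (w - a) = ‖x‖ ^ 2 := by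
      simp only [w]
      field_simp
      ring
    have hwa : a < w := by
      simp only [w]
      rw [hxn]
      nlinarith
    have hwδ : w < T.δ := by
      rw [← hxn, ← hw] at hy
      have := (mul_lt_mul_iff_right₀ (inv_pos.2 hκ)).1 hy
      linarith
    have hdom : |w| < T.δ := abs_lt.2 ⟨by linarith [T.δ_pos], hwδ⟩
    obtain ⟨τ, hτ⟩ := c.surjective_angle hΩ hdom (ha.trans hwa).ne' (Complex.arg x)
    refine ⟨pt w τ, ⟨hwa, hwδ⟩, ?_⟩
    unfold polar
    rw [pt_zero, pt_one, hτ, hw, Real.sqrt_sq (norm_nonneg x), Complex.norm_mul_cos_arg,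
      Complex.norm_mul_sin_arg]
    exact pt_eta y

/-- The source of the cap chart: the part of the tube over the given component at signed height
more than `a`. -/
lemma image_param (ha : 0 ≤ a) :
    c.param '' strip T a = {x ∈ T.N | T.π x ∈ range c.γ ∧ a < c.σ * T.z x} := by
  apply subset_antisymm
  · rintro _ ⟨y, hy, rfl⟩
    obtain ⟨h1, h2, h3⟩ := c.param_spec (strip_subset_dom ha hy)
    refine ⟨h1, ⟨y 1, h3.symm⟩, ?_⟩
    rw [h2, ← mul_assoc, c.σσ, one_mul]
    exact hy.1
  · rintro x ⟨hx, ⟨τ, hτ⟩, hax⟩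
    refine ⟨pt (c.σ * T.z x) τ, ⟨hax, ?_⟩, ?_⟩
    · rw [pt_zero]
      have := c.mul_mem (abs_lt.2 (T.z_mem hx))
      exact this.2
    · unfold param
      rw [pt_zero, pt_one, ← mul_assoc, c.σσ, one_mul, hτ, T.point_eq hx]

/-- The cap chart: a symplectic polar coordinate system on a side of the tube. -/
theorem exists_capChart (hΩ : IsSymplecticOn Ω Zᶜ) (ha : 0 < a) (haδ : a < T.δ) (hκ : 0 < κ) :
    ∃ φ : OpenPartialHomeomorph M Plane,
      φ.source = {x ∈ T.N | T.π x ∈ range c.γ ∧ a < c.σ * T.z x} ∧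
      φ.target = {y | y ≠ 0 ∧ ‖y‖ ^ 2 < κ⁻¹ * (T.δ - a)} ∧
      ContMDiffOn (𝓡 2) (𝓡 2) ∞ φ φ.source ∧ ContMDiffOn (𝓡 2) (𝓡 2) ∞ φ.symm φ.target ∧
      (∀ x ∈ φ.source, c.σ * T.z x = a + κ * ‖φ x‖ ^ 2) ∧
      (∀ x ∈ φ.source, ∀ v w, Ω x v w = 2 * κ * c.action (a + κ * ‖φ x‖ ^ 2) *
        det2 (mfderiv (𝓡 2) (𝓡 2) φ x v) (mfderiv (𝓡 2) (𝓡 2) φ x w)) := by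
  have hO := isOpen_strip (T := T) a
  have hsub := (strip_subset_dom (T := T) ha.le)
  have hE := (c.contDiffOn_polar hΩ ha hκ)
  obtain ⟨φ, hs, ht, hφ, h1, h2⟩ := exists_diffeo_of_same_fibres (P := c.param) (E := c.polar a κ) hO
    (c.contMDiffOn_param.mono hsub) (fun y hy v hv => c.param_immersive (hsub hy) v hv)
    hE.contMDiffOn (fun y hy v hv => by
      rw [mfderiv_eq_fderiv] at hv
      exact c.polar_immersive hΩ ha hκ hy v hv)
    (fun y hy y' hy' => c.polar_fibres hΩ ha hκ hy hy')
    ⟨pt ((a + T.δ) / 2) 0, by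
      constructor <;> rw [pt_zero] <;> linarith⟩
  have hheight : ∀ y ∈ strip T a, c.σ * T.z (c.param y) = y 0 := by
    intro y hy
    rw [(c.param_spec (hsub hy)).2.1, ← mul_assoc, c.σσ, one_mul]
  have hrad : ∀ y ∈ strip T a, a + κ * ‖φ (c.param y)‖ ^ 2 = y 0 := by
    intro y hy
    rw [hφ y hy, c.norm_polar hκ hy]
    field_simp
    ring
  refine ⟨φ, by rw [hs, c.image_param ha.le], by rw [ht, c.image_polar hΩ ha hκ], h1, h2, ?_, ?_⟩
  · intro x hx
    rw [hs] at hx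
    obtain ⟨y, hy, rfl⟩ := hx
    rw [hheight y hy, hrad y hy]
  · intro x hx v w
    rw [hs] at hx
    obtain ⟨y, hy, rfl⟩ := hx
    have hyd := hsub hy
    have h0 : y 0 ≠ 0 := (ha.trans hy.1).ne'
    obtain ⟨v, rfl⟩ := c.dparam_surjective hyd v
    obtain ⟨w, rfl⟩ := c.dparam_surjective hyd w
    have hmem : c.param y ∈ φ.source := hs ▸ ⟨y, hy, rfl⟩
    have hφd : MDifferentiableAt (𝓡 2) (𝓡 2) φ (c.param y) :=
      (h1.contMDiffAt (φ.open_source.mem_nhds hmem)).mdifferentiableAt (by simp)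
    have hchain : ∀ u : Plane, mfderiv (𝓡 2) (𝓡 2) φ (c.param y) (c.dparam y u) =
        fderiv ℝ (c.polar a κ) y u := by
      intro u
      have e1 := hφd.hasMFDerivAt.comp y (c.mdiff_param hyd).hasMFDerivAt
      have e2 : HasMFDerivAt (𝓡 2) (𝓡 2) (φ ∘ c.param) y (fderiv ℝ (c.polar a κ) y) := by
        have e3 : HasMFDerivAt (𝓡 2) (𝓡 2) (c.polar a κ) y (fderiv ℝ (c.polar a κ) y) :=
          ((hE.contDiffAt (hO.mem_nhds hy)).differentiableAt (by simp)).hasFDerivAt.hasMFDerivAt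
        refine e3.congr_of_eventuallyEq ?_
        filter_upwards [hO.mem_nhds hy] with y' hy' using hφ y' hy'
      exact congrArg (fun L : Plane →L[ℝ] Plane => L u) (hasMFDerivAt_unique e1 e2)
    -- Both sides are multiples of the determinant in (w, τ). The factor density/action from the
    -- polar map times 2κ · action/(2κ) restores the density.
    rw [hchain, hchain, c.form_dparam hyd h0, c.det_fderiv_polar hΩ ha hκ hy, hrad y hy]
    have hB := c.action_ne_zero hΩ hyd h0
    field_simp

end AdaptedTube.Collar
end Angle

/-! ### Smoothness of bilinear forms, pullbacks and area forms. -/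

section Tensors

variable {A B : Type*} [TopologicalSpace A] [ChartedSpace Plane A] [IsManifold (𝓡 2) ∞ A]
  [TopologicalSpace B] [ChartedSpace Plane B] [IsManifold (𝓡 2) ∞ B]

lemma contMDiffAt_clm_of_apply {F : Type*} [NormedAddCommGroup F] [NormedSpace ℝ F]
    {g : B → Plane →L[ℝ] F} {b : B} (h : ∀ v, ContMDiffAt (𝓡 2) 𝓘(ℝ, F) ∞ (fun x => g x v) b) :
    ContMDiffAt (𝓡 2) 𝓘(ℝ, Plane →L[ℝ] F) ∞ g b := by
  have hg : g = fun x => ContinuousLinearMap.smulRightL ℝ Plane F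
      (EuclideanSpace.proj 0 : Plane →L[ℝ] ℝ) (g x (pt 1 0)) +
      ContinuousLinearMap.smulRightL ℝ Plane F
      (EuclideanSpace.proj 1 : Plane →L[ℝ] ℝ) (g x (pt 0 1)) := by
    funext x
    ext1 v
    conv_lhs => rw [plane_decomp v]
    simp
  rw [hg]
  exact ((ContinuousLinearMap.contMDiff _).contMDiffAt.comp b (h _)).add
    ((ContinuousLinearMap.contMDiff _).contMDiffAt.comp b (h _))

/-- The coordinate vector fields near a point. -/
noncomputable def frame (b : B) (v : Plane) (x : B) : TangentSpace (𝓡 2) x :=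
  (trivializationAt Plane (TangentSpace (𝓡 2)) b).symmL ℝ x v

lemma contMDiffAt_frame (b : B) (v : Plane) :
    ContMDiffAt (𝓡 2) (𝓡 2).tangent ∞ (fun x => (⟨x, frame b v x⟩ : TangentBundle (𝓡 2) B)) b := by
  have h := (trivializationAt Plane (TangentSpace (𝓡 2) : B → Type _) b).contMDiffAt_symmL
    (IB := 𝓡 2) (n := ∞) (FiberBundle.mem_baseSet_trivializationAt' b)
  have h2 : ContMDiffAt (𝓡 2) ((𝓡 2).prod 𝓘(ℝ, Plane)) ∞
      (fun x => (⟨x, v⟩ : Bundle.TotalSpace Plane (Bundle.Trivial B Plane))) b := by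
    rw [Bundle.contMDiffAt_totalSpace]
    exact ⟨contMDiffAt_id, contMDiffAt_const⟩
  exact h.clm_bundle_apply h2

/-- In the trivialisation at `b` the entries of the form are its values on the coordinate frame, so
smoothness can be tested on frame vectors. -/
lemma contMDiffAt_twoTensor {η : TwoTensor B} {b : B}
    (h : ∀ v w : Plane, ContMDiffAt (𝓡 2) 𝓘(ℝ, ℝ) ∞ (fun x => η x (frame b v x) (frame b w x)) b) :
    ContMDiffAt (𝓡 2) ((𝓡 2).prod 𝓘(ℝ, Plane →L[ℝ] Plane →L[ℝ] ℝ)) ∞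
    (fun x => Bundle.TotalSpace.mk' (Plane →L[ℝ] Plane →L[ℝ] ℝ)
      (E := fun x : B => TangentSpace (𝓡 2) x →L[ℝ] TangentSpace (𝓡 2) x →L[ℝ] ℝ) x (η x)) b := by
  rw [contMDiffAt_hom_bundle]
  refine ⟨contMDiffAt_id, ?_⟩
  refine contMDiffAt_clm_of_apply fun v => contMDiffAt_clm_of_apply fun w => ?_
  refine (h v w).congr_of_eventuallyEq ?_
  have hb := (trivializationAt Plane (TangentSpace (𝓡 2) : B → Type _) b).open_baseSet.mem_nhds
    (FiberBundle.mem_baseSet_trivializationAt' b)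
  filter_upwards [hb] with x hx
  rw [inCoordinates_apply_eq₂ hx hx (by exact mem_univ _)]
  simp [frame, Bundle.Trivialization.symmL_apply _ hx]

lemma contMDiffAt_tensor_apply {C : Type*} [TopologicalSpace C] {E' H' : Type*}
    [NormedAddCommGroup E'] [NormedSpace ℝ E'] [TopologicalSpace H'] {J : ModelWithCorners ℝ E' H'}
    [ChartedSpace H' C] {η : TwoTensor A} {f : C → A} {v w : ∀ x, TangentSpace (𝓡 2) (f x)} {c : C}
    (hη : ContMDiffAt (𝓡 2) ((𝓡 2).prod 𝓘(ℝ, Plane →L[ℝ] Plane →L[ℝ] ℝ)) ∞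
      (fun x => Bundle.TotalSpace.mk' (Plane →L[ℝ] Plane →L[ℝ] ℝ)
      (E := fun x : A => TangentSpace (𝓡 2) x →L[ℝ] TangentSpace (𝓡 2) x →L[ℝ] ℝ) x (η x)) (f c))
    (hv : ContMDiffAt J (𝓡 2).tangent ∞ (fun x => (⟨f x, v x⟩ : TangentBundle (𝓡 2) A)) c)
    (hw : ContMDiffAt J (𝓡 2).tangent ∞ (fun x => (⟨f x, w x⟩ : TangentBundle (𝓡 2) A)) c) :
    ContMDiffAt J 𝓘(ℝ, ℝ) ∞ (fun x => η (f x) (v x) (w x)) c := by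
  have hf : ContMDiffAt J (𝓡 2) ∞ f c := (Bundle.contMDiffAt_totalSpace.1 hv).1
  have h1 := hη.comp c hf
  have h2 := ContMDiffAt.clm_bundle_apply (E₂ := fun x : A => TangentSpace (𝓡 2) x →L[ℝ] ℝ)
    (F₂ := Plane →L[ℝ] ℝ) h1 hv
  have h3 := ContMDiffAt.clm_bundle_apply (E₂ := Bundle.Trivial A ℝ) (F₂ := ℝ) h2 hw
  rw [Bundle.contMDiffAt_totalSpace] at h3
  exact h3.2

/-- The pullback of a bilinear form by a linear map of the model space. -/
noncomputable def pullLinear (L : Plane →L[ℝ] Plane) (β : Plane →L[ℝ] Plane →L[ℝ] ℝ) :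
    Plane →L[ℝ] Plane →L[ℝ] ℝ := β.bilinearComp L L

/-- The pullback of a bilinear form. -/
noncomputable def pull (f : B → A) (η : TwoTensor A) : TwoTensor B := fun x =>
  pullLinear (mfderiv (𝓡 2) (𝓡 2) f x) (η (f x))

/-- Smoothness of the tangent map, for fields along a map. A general parameter space `C` is allowed
so that time can be one of the parameters. -/
lemma contMDiffAt_mfderiv_vfield {C : Type*} [TopologicalSpace C] {E' H' : Type*}
    [NormedAddCommGroup E'] [NormedSpace ℝ E'] [TopologicalSpace H'] {J : ModelWithCorners ℝ E' H'}
    [ChartedSpace H' C] {f : B → A} {g : C → B} {v : ∀ x, TangentSpace (𝓡 2) (g x)} {O : Set B}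
    (hO : IsOpen O) (hf : ContMDiffOn (𝓡 2) (𝓡 2) ∞ f O) {c : C} (hc : g c ∈ O)
    (hv : ContMDiffAt J (𝓡 2).tangent ∞ (fun x => (⟨g x, v x⟩ : TangentBundle (𝓡 2) B)) c) :
    ContMDiffAt J (𝓡 2).tangent ∞
      (fun x => (⟨f (g x), mfderiv (𝓡 2) (𝓡 2) f (g x) (v x)⟩ : TangentBundle (𝓡 2) A)) c := by
  have h1 : ContMDiffOn (𝓡 2).tangent (𝓡 2).tangent ∞ (tangentMapWithin (𝓡 2) (𝓡 2) f O)
      (Bundle.TotalSpace.proj ⁻¹' O) :=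
    hf.contMDiffOn_tangentMapWithin (m := ∞) (by simp) hO.uniqueMDiffOn
  have hpre : IsOpen (Bundle.TotalSpace.proj ⁻¹' O : Set (TangentBundle (𝓡 2) B)) :=
    hO.preimage (FiberBundle.continuous_proj Plane (TangentSpace (𝓡 2)))
  have h2 := (h1.contMDiffAt (hpre.mem_nhds (x := (⟨g c, v c⟩ : TangentBundle (𝓡 2) B)) hc)).comp c hv
  have hg : ContinuousAt g c := (Bundle.contMDiffAt_totalSpace.1 hv).1.continuousAt
  refine h2.congr_of_eventuallyEq ?_
  filter_upwards [hg (hO.mem_nhds hc)] with x hx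
  change _ = tangentMapWithin (𝓡 2) (𝓡 2) f O ⟨g x, v x⟩
  rw [tangentMapWithin, mfderivWithin_of_isOpen hO hx]

lemma contMDiffAt_pull {f : B → A} {η : TwoTensor A} {O : Set B} (hO : IsOpen O)
    (hf : ContMDiffOn (𝓡 2) (𝓡 2) ∞ f O) {b : B} (hb : b ∈ O)
    (hη : ContMDiffAt (𝓡 2) ((𝓡 2).prod 𝓘(ℝ, Plane →L[ℝ] Plane →L[ℝ] ℝ)) ∞
      (fun x => Bundle.TotalSpace.mk' (Plane →L[ℝ] Plane →L[ℝ] ℝ)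
      (E := fun x : A => TangentSpace (𝓡 2) x →L[ℝ] TangentSpace (𝓡 2) x →L[ℝ] ℝ) x (η x)) (f b)) :
    ContMDiffAt (𝓡 2) ((𝓡 2).prod 𝓘(ℝ, Plane →L[ℝ] Plane →L[ℝ] ℝ)) ∞
    (fun x => Bundle.TotalSpace.mk' (Plane →L[ℝ] Plane →L[ℝ] ℝ)
      (E := fun x : B => TangentSpace (𝓡 2) x →L[ℝ] TangentSpace (𝓡 2) x →L[ℝ] ℝ) x (pull f η x)) b :=
  contMDiffAt_twoTensor fun v w => contMDiffAt_tensor_apply (η := η) (f := f) hη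
    (contMDiffAt_mfderiv_vfield hO hf hb (contMDiffAt_frame b v))
    (contMDiffAt_mfderiv_vfield hO hf hb (contMDiffAt_frame b w))

/-- The area form of the plane with a given density. -/
noncomputable def areaForm (K : Plane → ℝ) : TwoTensor Plane := fun x =>
  K x • ((EuclideanSpace.proj 0 : Plane →L[ℝ] ℝ).smulRight (EuclideanSpace.proj 1 : Plane →L[ℝ] ℝ) -
    (EuclideanSpace.proj 1 : Plane →L[ℝ] ℝ).smulRight (EuclideanSpace.proj 0 : Plane →L[ℝ] ℝ))

lemma areaForm_apply (K : Plane → ℝ) (x : Plane) (v w : Plane) :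
    areaForm K x v w = K x * det2 v w := rfl

lemma contMDiffAt_areaForm {K : Plane → ℝ} {b : Plane} (hK : ContDiffAt ℝ ∞ K b) :
    ContMDiffAt (𝓡 2) ((𝓡 2).prod 𝓘(ℝ, Plane →L[ℝ] Plane →L[ℝ] ℝ)) ∞
    (fun x => Bundle.TotalSpace.mk' (Plane →L[ℝ] Plane →L[ℝ] ℝ)
      (E := fun x : Plane => TangentSpace (𝓡 2) x →L[ℝ] TangentSpace (𝓡 2) x →L[ℝ] ℝ) x
      (areaForm K x)) b := by
  refine contMDiffAt_twoTensor fun v w => ?_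
  have h : (fun x => areaForm K x (frame b v x) (frame b w x)) = fun x => K x * det2 v w := by
    funext x
    unfold frame
    rw [TangentBundle.symmL_model_space]
    rfl
  rw [h]
  exact (hK.mul contDiffAt_const).contMDiffAt

lemma det2_eq_zero {v : Plane} (h : ∀ w, det2 v w = 0) : v = 0 := by
  have k0 := h (pt 1 0)
  have k1 := h (pt 0 1)
  simp only [det2, pt_zero, pt_one] at k0 k1
  ext i
  fin_cases i
  · simpa using k1
  · simpa using k0

end Tensors

/-! ### Gluing a point into every end: the topology of the capped surface. -/

/-- The open disk of given squared radius. -/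
def disk (r : ℝ) : Set Plane := {y | ‖y‖ ^ 2 < r}

lemma isOpen_disk (r : ℝ) : IsOpen (disk r) := isOpen_lt (by fun_prop) continuous_const

/-- Data for capping off the ends of the open subset `U` of a surface: the ends are parametrised by
punctured disks. -/
structure CapData (M : Type*) [TopologicalSpace M] [ChartedSpace Plane M] (E : Type*) where
  U : Set M
  base : M
  r : ℝ
  φ : E → OpenPartialHomeomorph M Plane
  isOpen : IsOpen U
  base_mem : base ∈ U
  one_lt : 1 < r
  source_subset : ∀ e, (φ e).source ⊆ U
  target_eq : ∀ e, (φ e).target = {y | y ≠ 0} ∩ disk r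
  smooth : ∀ e, ContMDiffOn (𝓡 2) (𝓡 2) ∞ (φ e) (φ e).source
  smooth_symm : ∀ e, ContMDiffOn (𝓡 2) (𝓡 2) ∞ (φ e).symm (φ e).target
  disjoint : Pairwise fun e e' => Disjoint (φ e).source (φ e').source
  closed : ∀ e, IsClosed ({x ∈ (φ e).source | ‖φ e x‖ ^ 2 ≤ 1} ∪ Uᶜ)
  compact : IsCompact (U \ ⋃ e, {x ∈ (φ e).source | ‖φ e x‖ ^ 2 < 1})
  connected : IsConnected U

namespace CapData

variable {M : Type u} [TopologicalSpace M] [T2Space M] [ChartedSpace Plane M]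
  [IsManifold (𝓡 2) ∞ M] {E : Type u} (D : CapData M E)

/-- The capped surface. -/
def Capped : Type u := D.U ⊕ E

/-- The inclusion of the uncapped part. -/
def inc (x : D.U) : D.Capped := Sum.inl x

/-- The centre of a cap. -/
def centre (e : E) : D.Capped := Sum.inr e

open Classical in
/-- The inclusion of the uncapped part, extended to the whole surface. -/
noncomputable def incl (x : M) : D.Capped :=
  if h : x ∈ D.U then D.inc ⟨x, h⟩ else D.inc ⟨D.base, D.base_mem⟩

open Classical in
/-- The parametrisation of a cap. -/
noncomputable def cap (e : E) (y : Plane) : D.Capped :=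
  if y = 0 then D.centre e else D.incl ((D.φ e).symm y)

/-- The inverse of `incl`. -/
def out : D.Capped → M := Sum.elim (fun x => x.1) (fun _ => D.base)

lemma out_incl {x : M} (hx : x ∈ D.U) : D.out (D.incl x) = x := by
  rw [incl, dif_pos hx]
  rfl

lemma incl_out (x : D.U) : D.incl (D.out (D.inc x)) = D.inc x := by
  change D.incl x.1 = _
  rw [incl, dif_pos x.2]

lemma incl_inj {x y : M} (hx : x ∈ D.U) (hy : y ∈ D.U) (h : D.incl x = D.incl y) : x = y := by
  rw [← D.out_incl hx, h, D.out_incl hy]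

lemma incl_ne_centre (x : M) (e : E) : D.incl x ≠ D.centre e := by
  unfold incl
  split_ifs
  all_goals exact Sum.inl_ne_inr

lemma centre_inj {e e' : E} (h : D.centre e = D.centre e') : e = e' := Sum.inr_injective h

lemma exists_rep (s : D.Capped) : (∃ x ∈ D.U, s = D.incl x) ∨ ∃ e, s = D.centre e := by
  rcases s with x | e
  · exact Or.inl ⟨x.1, x.2, by rw [incl, dif_pos x.2]; rfl⟩
  · exact Or.inr ⟨e, rfl⟩

lemma cap_zero (e : E) : D.cap e 0 = D.centre e := if_pos rfl

lemma cap_of_ne (e : E) {y : Plane} (hy : y ≠ 0) : D.cap e y = D.incl ((D.φ e).symm y) := if_neg hy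

lemma mem_target {e : E} {y : Plane} (hy : y ≠ 0) (hr : y ∈ disk D.r) : y ∈ (D.φ e).target := by
  rw [D.target_eq]
  exact ⟨hy, hr⟩

lemma r_pos : 0 < D.r := zero_lt_one.trans D.one_lt

lemma zero_mem_disk : (0 : Plane) ∈ disk D.r := by
  change ‖(0 : Plane)‖ ^ 2 < D.r
  simpa using D.r_pos

lemma cap_map {e : E} {x : M} (hx : x ∈ (D.φ e).source) : D.cap e (D.φ e x) = D.incl x := by
  have h := (D.φ e).map_source hx
  have h0 : D.φ e x ≠ 0 := by
    rw [D.target_eq] at h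
    exact h.1
  rw [D.cap_of_ne e h0, (D.φ e).left_inv hx]

lemma symm_mem {e : E} {y : Plane} (hy : y ≠ 0) (hr : y ∈ disk D.r) : (D.φ e).symm y ∈ D.U :=
  D.source_subset e ((D.φ e).map_target (D.mem_target hy hr))

lemma cap_injOn (e : E) : InjOn (D.cap e) (disk D.r) := by
  intro y hy y' hy' h
  by_cases h0 : y = 0
  · by_cases h0' : y' = 0
    · rw [h0, h0']
    · rw [h0, D.cap_zero, D.cap_of_ne e h0'] at h
      exact absurd h.symm (D.incl_ne_centre _ _)
  · by_cases h0' : y' = 0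
    · rw [h0', D.cap_zero, D.cap_of_ne e h0] at h
      exact absurd h (D.incl_ne_centre _ _)
    · rw [D.cap_of_ne e h0', D.cap_of_ne e h0] at h
      exact (D.φ e).symm.injOn (D.mem_target h0 hy) (D.mem_target h0' hy')
        (D.incl_inj (D.symm_mem h0 hy) (D.symm_mem h0' hy') h)

lemma eq_of_cap_eq {e e' : E} {y y' : Plane} (hy : y ∈ disk D.r) (hy' : y' ∈ disk D.r)
    (h : D.cap e y = D.cap e' y') : e = e' := by
  by_contra hne
  by_cases h0 : y = 0
  · by_cases h0' : y' = 0
    · rw [h0, h0', D.cap_zero, D.cap_zero] at h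
      exact hne (D.centre_inj h)
    · rw [h0, D.cap_zero, D.cap_of_ne e' h0'] at h
      exact D.incl_ne_centre _ _ h.symm
  · by_cases h0' : y' = 0
    · rw [h0', D.cap_zero, D.cap_of_ne e h0] at h
      exact D.incl_ne_centre _ _ h
    · rw [D.cap_of_ne e' h0', D.cap_of_ne e h0] at h
      have h1 := D.incl_inj (D.symm_mem h0 hy) (D.symm_mem h0' hy') h
      have h2 := (D.φ e).map_target (D.mem_target h0 hy)
      rw [h1] at h2
      exact disjoint_left.1 (D.disjoint hne) h2 ((D.φ e').map_target (D.mem_target h0' hy'))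

lemma eq_of_cap_eq_incl {e : E} {y : Plane} {x : M} (hy : y ∈ disk D.r) (hx : x ∈ D.U)
    (h : D.cap e y = D.incl x) : x ∈ (D.φ e).source ∧ D.φ e x = y := by
  by_cases h0 : y = 0
  · rw [h0, D.cap_zero] at h
    exact absurd h.symm (D.incl_ne_centre _ _)
  · rw [D.cap_of_ne e h0] at h
    have h1 := D.incl_inj (D.symm_mem h0 hy) hx h
    have h2 := D.mem_target (e := e) h0 hy
    rw [← h1]
    exact ⟨(D.φ e).map_target h2, (D.φ e).right_inv h2⟩

/-- The finest topology making the inclusion of `U` and all the cap parametrisations continuous.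
Both kinds of maps turn out to be open embeddings. -/
instance : TopologicalSpace D.Capped where
  IsOpen W := IsOpen (D.U ∩ D.incl ⁻¹' W) ∧ ∀ e, IsOpen (disk D.r ∩ D.cap e ⁻¹' W)
  isOpen_univ := by
    simp only [preimage_univ, inter_univ]
    exact ⟨D.isOpen, fun _ => isOpen_disk _⟩
  isOpen_inter V W hV hW := by
    rw [preimage_inter, inter_inter_distrib_left]
    refine ⟨hV.1.inter hW.1, fun e => ?_⟩
    rw [preimage_inter, inter_inter_distrib_left]
    exact (hV.2 e).inter (hW.2 e)
  isOpen_sUnion S hS := by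
    simp only [preimage_sUnion, inter_iUnion₂]
    exact ⟨isOpen_biUnion fun W hW => (hS W hW).1, fun e => isOpen_biUnion fun W hW => (hS W hW).2 e⟩

lemma isOpen_iff {W : Set D.Capped} :
    IsOpen W ↔ IsOpen (D.U ∩ D.incl ⁻¹' W) ∧ ∀ e, IsOpen (disk D.r ∩ D.cap e ⁻¹' W) := Iff.rfl

lemma isOpen_image_incl {O : Set M} (hO : IsOpen O) (hOU : O ⊆ D.U) : IsOpen (D.incl '' O) := by
  rw [isOpen_iff]
  constructor
  · convert hO using 1
    ext x
    constructor
    · rintro ⟨hx, y, hy, hxy⟩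
      rwa [← D.incl_inj (hOU hy) hx hxy]
    · exact fun hx => ⟨hOU hx, x, hx, rfl⟩
  · intro e
    convert (D.φ e).symm.isOpen_inter_preimage hO using 1
    ext y
    constructor
    · rintro ⟨hy, x, hx, hxy⟩
      obtain ⟨h1, rfl⟩ := D.eq_of_cap_eq_incl hy (hOU hx) hxy.symm
      refine ⟨(D.φ e).map_source h1, ?_⟩
      rw [mem_preimage, (D.φ e).left_inv h1]
      exact hx
    · rintro ⟨hy, hx⟩
      change y ∈ (D.φ e).target at hy
      rw [D.target_eq] at hy
      exact ⟨hy.2, _, hx, (D.cap_of_ne e hy.1).symm⟩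

lemma isOpen_image_cap (e : E) {O : Set Plane} (hO : IsOpen O) (hOU : O ⊆ disk D.r) :
    IsOpen (D.cap e '' O) := by
  rw [isOpen_iff]
  constructor
  · convert (D.φ e).isOpen_inter_preimage hO using 1
    ext x
    constructor
    · rintro ⟨hx, y, hy, hxy⟩
      obtain ⟨h1, rfl⟩ := D.eq_of_cap_eq_incl (hOU hy) hx hxy
      exact ⟨h1, hy⟩
    · rintro ⟨hx, hy⟩
      exact ⟨D.source_subset e hx, _, hy, D.cap_map hx⟩
  · intro e'
    by_cases he : e' = e
    · subst he
      convert hO using 1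
      ext y
      constructor
      · rintro ⟨hy, y', hy', h⟩
        rwa [← D.cap_injOn e' (hOU hy') hy h]
      · exact fun hy => ⟨hOU hy, y, hy, rfl⟩
    · convert isOpen_empty using 1
      rw [eq_empty_iff_forall_notMem]
      rintro y ⟨hy, y', hy', h⟩
      exact he (D.eq_of_cap_eq (hOU hy') hy h).symm

/-- The inclusion of the uncapped part, as an open partial homeomorphism. -/
noncomputable def Φ : OpenPartialHomeomorph M D.Capped where
  toFun := D.incl
  invFun := D.out
  source := D.U
  target := D.incl '' D.U
  map_source' x hx := ⟨x, hx, rfl⟩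
  map_target' := by
    rintro _ ⟨x, hx, rfl⟩
    rwa [D.out_incl hx]
  left_inv' x hx := D.out_incl hx
  right_inv' := by
    rintro _ ⟨x, hx, rfl⟩
    rw [D.out_incl hx]
  open_source := D.isOpen
  open_target := D.isOpen_image_incl D.isOpen subset_rfl
  continuousOn_toFun := (continuousOn_open_iff D.isOpen).2 fun _ hW => hW.1
  continuousOn_invFun := by
    refine (continuousOn_open_iff (D.isOpen_image_incl D.isOpen subset_rfl)).2 fun W hW => ?_
    convert D.isOpen_image_incl (D.isOpen.inter hW) inter_subset_left using 1
    ext s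
    constructor
    · rintro ⟨⟨x, hx, rfl⟩, hW⟩
      rw [mem_preimage, D.out_incl hx] at hW
      exact ⟨x, ⟨hx, hW⟩, rfl⟩
    · rintro ⟨x, ⟨hx, hW⟩, rfl⟩
      refine ⟨⟨x, hx, rfl⟩, ?_⟩
      rwa [mem_preimage, D.out_incl hx]

/-- The parametrisation of a cap, as an open partial homeomorphism. -/
noncomputable def J (e : E) : OpenPartialHomeomorph Plane D.Capped where
  toFun := D.cap e
  invFun := invFunOn (D.cap e) (disk D.r)
  source := disk D.r
  target := D.cap e '' disk D.r
  map_source' x hx := ⟨x, hx, rfl⟩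
  map_target' _ hs := invFunOn_mem hs
  left_inv' x hx := (D.cap_injOn e).leftInvOn_invFunOn hx
  right_inv' _ hs := invFunOn_eq hs
  open_source := isOpen_disk _
  open_target := D.isOpen_image_cap e (isOpen_disk _) subset_rfl
  continuousOn_toFun := (continuousOn_open_iff (isOpen_disk _)).2 fun _ hW => hW.2 e
  continuousOn_invFun := by
    refine (continuousOn_open_iff (D.isOpen_image_cap e (isOpen_disk _) subset_rfl)).2 fun W hW => ?_
    convert D.isOpen_image_cap e ((isOpen_disk D.r).inter hW) inter_subset_left using 1
    ext s
    constructor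
    · rintro ⟨⟨y, hy, rfl⟩, hW⟩
      rw [mem_preimage, (D.cap_injOn e).leftInvOn_invFunOn hy] at hW
      exact ⟨y, ⟨hy, hW⟩, rfl⟩
    · rintro ⟨y, ⟨hy, hW⟩, rfl⟩
      refine ⟨⟨y, hy, rfl⟩, ?_⟩
      rwa [mem_preimage, (D.cap_injOn e).leftInvOn_invFunOn hy]

lemma Φ_source : D.Φ.source = D.U := rfl

lemma J_zero (e : E) : D.J e 0 = D.centre e := D.cap_zero e

lemma J_φ {e : E} {x : M} (hx : x ∈ (D.φ e).source) : D.J e (D.φ e x) = D.Φ x := D.cap_map hx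

lemma J_eq_Φ {e : E} {y : Plane} (hy : y ≠ 0) : D.J e y = D.Φ ((D.φ e).symm y) := D.cap_of_ne e hy

lemma Φ_target_or (s : D.Capped) : s ∈ D.Φ.target ∨ ∃ e, s = D.centre e := by
  rcases D.exists_rep s with ⟨x, hx, rfl⟩ | h
  exacts [Or.inl ⟨x, hx, rfl⟩, Or.inr h]

lemma centre_notMem (e : E) : D.centre e ∉ D.Φ.target := by
  rintro ⟨x, -, hx⟩
  exact D.incl_ne_centre _ _ hx

lemma centre_mem (e : E) : D.centre e ∈ (D.J e).target := ⟨0, D.zero_mem_disk, D.cap_zero e⟩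

lemma J_mem_Φ_target {e : E} {y : Plane} (hr : y ∈ disk D.r) :
    D.J e y ∈ D.Φ.target ↔ y ≠ 0 := by
  constructor
  · rintro h rfl
    rw [D.J_zero] at h
    exact D.centre_notMem e h
  · intro h
    rw [D.J_eq_Φ h]
    exact D.Φ.map_source (D.symm_mem h hr)

lemma Φ_mem_J_target {e : E} {x : M} (hx : x ∈ D.U) :
    D.Φ x ∈ (D.J e).target ↔ x ∈ (D.φ e).source := by
  constructor
  · rintro ⟨y, hy, h⟩
    exact (D.eq_of_cap_eq_incl hy hx h).1
  · intro h
    rw [← D.J_φ h]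
    refine (D.J e).map_source ?_
    have := (D.φ e).map_source h
    rw [D.target_eq] at this
    exact this.2

lemma J_symm_Φ {e : E} {x : M} (hx : x ∈ (D.φ e).source) : (D.J e).symm (D.Φ x) = D.φ e x := by
  rw [← D.J_φ hx]
  refine (D.J e).left_inv ?_
  have := (D.φ e).map_source hx
  rw [D.target_eq] at this
  exact this.2

lemma Φ_symm_J {e : E} {y : Plane} (hr : y ∈ disk D.r) (hy : y ≠ 0) :
    D.Φ.symm (D.J e y) = (D.φ e).symm y := by
  rw [D.J_eq_Φ hy, D.Φ.left_inv (D.symm_mem hy hr)]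

/-- The open cap of squared radius `1`. -/
def openCap (e : E) : Set D.Capped := D.cap e '' disk 1

/-- The closed cap of squared radius `1`. -/
def closedCap (e : E) : Set D.Capped := D.cap e '' {y | ‖y‖ ^ 2 ≤ 1}

lemma closed_subset_disk : {y : Plane | ‖y‖ ^ 2 ≤ 1} ⊆ disk D.r := fun y hy =>
  lt_of_le_of_lt (show ‖y‖ ^ 2 ≤ 1 from hy) D.one_lt

lemma disk_subset_disk : disk 1 ⊆ disk D.r := fun _ hy => lt_trans hy D.one_lt

lemma isOpen_openCap (e : E) : IsOpen (D.openCap e) :=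
  D.isOpen_image_cap e (isOpen_disk 1) D.disk_subset_disk

lemma incl_mem_closedCap {e : E} {x : M} (hx : x ∈ D.U) :
    D.incl x ∈ D.closedCap e ↔ x ∈ (D.φ e).source ∧ ‖D.φ e x‖ ^ 2 ≤ 1 := by
  constructor
  · rintro ⟨y, hy, h⟩
    obtain ⟨h1, rfl⟩ := D.eq_of_cap_eq_incl (D.closed_subset_disk hy) hx h
    exact ⟨h1, hy⟩
  · rintro ⟨h1, h2⟩
    exact ⟨_, h2, D.cap_map h1⟩

lemma incl_mem_openCap {e : E} {x : M} (hx : x ∈ D.U) :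
    D.incl x ∈ D.openCap e ↔ x ∈ (D.φ e).source ∧ ‖D.φ e x‖ ^ 2 < 1 := by
  constructor
  · rintro ⟨y, hy, h⟩
    obtain ⟨h1, rfl⟩ := D.eq_of_cap_eq_incl (D.disk_subset_disk hy) hx h
    exact ⟨h1, hy⟩
  · rintro ⟨h1, h2⟩
    exact ⟨_, h2, D.cap_map h1⟩

lemma isClosed_closedCap (e : E) : IsClosed (D.closedCap e) := by
  rw [← isOpen_compl_iff, isOpen_iff]
  constructor
  · convert (D.closed e).isOpen_compl using 1
    ext x
    by_cases hx : x ∈ D.U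
    · simp only [mem_inter_iff, hx, true_and, mem_preimage, mem_compl_iff,
        D.incl_mem_closedCap hx, mem_union, not_true_eq_false, or_false]
      rfl
    · simp [hx]
  · intro e'
    by_cases he : e' = e
    · subst he
      have h1 : IsOpen (disk D.r ∩ {y | 1 < ‖y‖ ^ 2}) :=
        (isOpen_disk _).inter (isOpen_lt continuous_const (by fun_prop))
      convert h1 using 1
      ext y
      constructor
      · rintro ⟨hy, h⟩
        refine ⟨hy, ?_⟩
        by_contra h'
        exact h ⟨y, show ‖y‖ ^ 2 ≤ 1 from not_lt.1 h', rfl⟩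
      · rintro ⟨hy, h⟩
        refine ⟨hy, ?_⟩
        rintro ⟨y', hy', h'⟩
        rw [D.cap_injOn e' (D.closed_subset_disk hy') hy h'] at hy'
        exact not_lt.2 (show ‖y‖ ^ 2 ≤ 1 from hy') h
    · convert isOpen_disk D.r using 1
      ext y
      refine ⟨fun h => h.1, fun h => ⟨h, ?_⟩⟩
      rintro ⟨y', hy', h'⟩
      exact he (D.eq_of_cap_eq (D.closed_subset_disk hy') h h').symm

/-- Within the closed cap the points are separated in the plane. Outside it, the open cap and the
complement of the closed cap do the job; this is where closedness of the cap, that is the field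
`closed`, enters. -/
lemma separated_centre {e : E} {s : D.Capped} (hs : s ≠ D.centre e) :
    ∃ V W : Set D.Capped, IsOpen V ∧ IsOpen W ∧ s ∈ V ∧ D.centre e ∈ W ∧ Disjoint V W := by
  by_cases h : s ∈ D.closedCap e
  · obtain ⟨y, hy, rfl⟩ := h
    have hy0 : y ≠ 0 := by
      rintro rfl
      exact hs (D.cap_zero e)
    obtain ⟨V, W, hV, hW, hyV, h0W, hVW⟩ := t2_separation hy0
    refine ⟨D.cap e '' (V ∩ disk D.r), D.cap e '' (W ∩ disk D.r),
      D.isOpen_image_cap e (hV.inter (isOpen_disk _)) inter_subset_right,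
      D.isOpen_image_cap e (hW.inter (isOpen_disk _)) inter_subset_right,
      ⟨y, ⟨hyV, D.closed_subset_disk hy⟩, rfl⟩, ⟨0, ⟨h0W, D.zero_mem_disk⟩, D.cap_zero e⟩, ?_⟩
    rw [disjoint_left]
    rintro _ ⟨a, ha, rfl⟩ ⟨b, hb, hab⟩
    rw [D.cap_injOn e hb.2 ha.2 hab] at hb
    exact disjoint_left.1 hVW ha.1 hb.1
  · refine ⟨(D.closedCap e)ᶜ, D.openCap e, (D.isClosed_closedCap e).isOpen_compl,
      D.isOpen_openCap e, h, ⟨0, by simp [disk], D.cap_zero e⟩, ?_⟩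
    rw [disjoint_left]
    rintro _ h1 ⟨y, hy, rfl⟩
    exact h1 ⟨y, show ‖y‖ ^ 2 ≤ 1 from le_of_lt hy, rfl⟩

instance : T2Space D.Capped where
  t2 s t hst := by
    rcases D.exists_rep t with ⟨x', hx', rfl⟩ | ⟨e, rfl⟩
    · rcases D.exists_rep s with ⟨x, hx, rfl⟩ | ⟨e, rfl⟩
      · have hne : x ≠ x' := fun h => hst (h ▸ rfl)
        obtain ⟨V, W, hV, hW, hyV, h0W, hVW⟩ := t2_separation hne
        refine ⟨D.incl '' (V ∩ D.U), D.incl '' (W ∩ D.U),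
          D.isOpen_image_incl (hV.inter D.isOpen) inter_subset_right,
          D.isOpen_image_incl (hW.inter D.isOpen) inter_subset_right,
          ⟨x, ⟨hyV, hx⟩, rfl⟩, ⟨x', ⟨h0W, hx'⟩, rfl⟩, ?_⟩
        rw [disjoint_left]
        rintro _ ⟨a, ha, rfl⟩ ⟨b, hb, hab⟩
        rw [D.incl_inj hb.2 ha.2 hab] at hb
        exact disjoint_left.1 hVW ha.1 hb.1
      · obtain ⟨V, W, hV, hW, h1, h2, h3⟩ := D.separated_centre hst.symm
        exact ⟨W, V, hW, hV, h2, h1, h3.symm⟩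
    · exact D.separated_centre hst

lemma isCompact_closed_unit : IsCompact {y : Plane | ‖y‖ ^ 2 ≤ 1} := by
  have h : {y : Plane | ‖y‖ ^ 2 ≤ 1} = Metric.closedBall 0 1 := by
    ext y
    rw [mem_closedBall_zero_iff]
    exact sq_le_one_iff₀ (norm_nonneg y)
  rw [h]
  exact isCompact_closedBall (0 : Plane) 1

/-- The surface is the compact core together with finitely many closed disks. -/
instance [Finite E] : CompactSpace D.Capped where
  isCompact_univ := by
    have h1 := D.compact.image_of_continuousOn (D.Φ.continuousOn.mono sdiff_subset)
    have h2 : IsCompact (⋃ e, D.J e '' {y : Plane | ‖y‖ ^ 2 ≤ 1}) := isCompact_iUnion fun e =>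
      isCompact_closed_unit.image_of_continuousOn ((D.J e).continuousOn.mono D.closed_subset_disk)
    convert h1.union h2 using 1
    symm
    rw [eq_univ_iff_forall]
    intro s
    rcases D.exists_rep s with ⟨x, hx, rfl⟩ | ⟨e, rfl⟩
    · by_cases h : x ∈ ⋃ e, {x ∈ (D.φ e).source | ‖D.φ e x‖ ^ 2 < 1}
      · obtain ⟨e, he, h'⟩ := mem_iUnion.1 h
        exact Or.inr (mem_iUnion.2 ⟨e, _, h'.le, D.cap_map he⟩)
      · exact Or.inl ⟨x, ⟨hx, h⟩, rfl⟩
    · exact Or.inr (mem_iUnion.2 ⟨e, 0, by simp, D.cap_zero e⟩)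

lemma centre_mem_closure (e : E) : D.centre e ∈ closure (D.incl '' D.U) := by
  rw [mem_closure_iff_nhds]
  intro t ht
  have h1 : ContinuousAt (D.J e) 0 := (D.J e).continuousAt D.zero_mem_disk
  have h2 : D.J e ⁻¹' t ∈ 𝓝 0 := h1 (by rwa [D.J_zero])
  have h3 := (nhdsNE_neBot_of_surface (0 : Plane)).nonempty_of_mem
    (inter_mem_nhdsWithin {0}ᶜ (Filter.inter_mem h2 ((isOpen_disk D.r).mem_nhds D.zero_mem_disk)))
  obtain ⟨y, hy0, hyt, hyr⟩ := h3
  exact ⟨D.J e y, hyt, (D.J_mem_Φ_target hyr).2 hy0⟩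

/-- The connected uncapped part is dense, every centre being a limit of punctured disks. -/
instance : ConnectedSpace D.Capped := by
  have h1 : IsConnected (D.incl '' D.U) := D.connected.image _ D.Φ.continuousOn
  have h2 := h1.closure
  have h3 : closure (D.incl '' D.U) = univ := by
    rw [eq_univ_iff_forall]
    intro s
    rcases D.exists_rep s with ⟨x, hx, rfl⟩ | ⟨e, rfl⟩
    exacts [subset_closure ⟨x, hx, rfl⟩, D.centre_mem_closure e]
  rw [h3] at h2
  exact connectedSpace_iff_univ.2 h2

end CapData
-- The smooth structure of the capped surface, its disks and its genus.
namespace CapData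

variable {M : Type u} [TopologicalSpace M] [T2Space M] [ChartedSpace Plane M]
  [IsManifold (𝓡 2) ∞ M] {E : Type u} (D : CapData M E)

/-- The chart of the capped surface induced by a chart of the uncapped part. -/
noncomputable def chartOf (x : M) : OpenPartialHomeomorph D.Capped Plane :=
  D.Φ.symm ≫ₕ chartAt Plane x

noncomputable instance : ChartedSpace Plane D.Capped where
  atlas := range D.chartOf ∪ range fun e => (D.J e).symm
  chartAt := Sum.elim (fun x => D.chartOf x.1) (fun e => (D.J e).symm)
  mem_chart_source s := by
    rcases s with x | e
    · change D.inc x ∈ (D.chartOf x.1).source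
      have h : D.inc x ∈ D.Φ.target := by
        rw [← D.incl_out]
        exact D.Φ.map_source x.2
      rw [chartOf, OpenPartialHomeomorph.trans_source]
      exact ⟨h, mem_chart_source Plane x.1⟩
    · exact D.centre_mem e
  chart_mem_atlas s := by
    rcases s with x | e
    exacts [Or.inl ⟨x.1, rfl⟩, Or.inr ⟨e, rfl⟩]

lemma chartOf_mem_atlas (x : M) : D.chartOf x ∈ atlas Plane D.Capped := Or.inl ⟨x, rfl⟩

lemma J_symm_mem_atlas (e : E) : (D.J e).symm ∈ atlas Plane D.Capped := Or.inr ⟨e, rfl⟩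

/-- Transitions between an old chart and a cap involve `φ` or its inverse, and the centre never lies
in the overlap. Distinct caps do not meet. -/
lemma contDiffOn_transition {ψ ψ' : OpenPartialHomeomorph D.Capped Plane}
    (hψ : ψ ∈ atlas Plane D.Capped) (hψ' : ψ' ∈ atlas Plane D.Capped) :
    ContMDiffOn (𝓡 2) (𝓡 2) ∞ (fun y => ψ' (ψ.symm y)) (ψ.symm ≫ₕ ψ').source := by
  have hch : ∀ x : M, ContMDiffOn (𝓡 2) (𝓡 2) ∞ (chartAt Plane x) (chartAt Plane x).source :=
    fun x => contMDiffOn_chart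
  have hchs : ∀ x : M, ContMDiffOn (𝓡 2) (𝓡 2) ∞ (chartAt Plane x).symm (chartAt Plane x).target :=
    fun x => contMDiffOn_chart_symm
  rcases hψ with ⟨x, rfl⟩ | ⟨e, rfl⟩ <;> rcases hψ' with ⟨x', rfl⟩ | ⟨e', rfl⟩
  · have key : ∀ y ∈ ((D.chartOf x).symm ≫ₕ D.chartOf x').source, y ∈ (chartAt Plane x).target ∧
        D.Φ.symm ((D.chartOf x).symm y) = (chartAt Plane x).symm y ∧
        (chartAt Plane x).symm y ∈ (chartAt Plane x').source := by
      rintro y ⟨⟨hy1, hy2⟩, hy3, hy4⟩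
      have h : D.Φ.symm ((D.chartOf x).symm y) = (chartAt Plane x).symm y := D.Φ.left_inv hy2
      refine ⟨hy1, h, ?_⟩
      rw [← h]
      exact hy4
    refine ((hch x').comp ((hchs x).mono fun y hy => (key y hy).1) fun y hy => (key y hy).2.2).congr
      fun y hy => ?_
    change chartAt Plane x' (D.Φ.symm ((D.chartOf x).symm y)) = _
    rw [(key y hy).2.1]
    rfl
  · have key : ∀ y ∈ ((D.chartOf x).symm ≫ₕ (D.J e').symm).source, y ∈ (chartAt Plane x).target ∧
        (chartAt Plane x).symm y ∈ (D.φ e').source := by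
      rintro y ⟨⟨hy1, hy2⟩, hy3⟩
      exact ⟨hy1, (D.Φ_mem_J_target hy2).1 hy3⟩
    refine ((D.smooth e').comp ((hchs x).mono fun y hy => (key y hy).1)
      fun y hy => (key y hy).2).congr fun y hy => ?_
    exact D.J_symm_Φ (key y hy).2
  · have key : ∀ y ∈ ((D.J e).symm.symm ≫ₕ D.chartOf x').source, y ∈ (D.φ e).target ∧
        D.Φ.symm (D.J e y) = (D.φ e).symm y ∧ (D.φ e).symm y ∈ (chartAt Plane x').source := by
      rintro y ⟨hy1, hy2, hy3⟩
      have h0 : y ≠ 0 := (D.J_mem_Φ_target hy1).1 hy2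
      have h : D.Φ.symm (D.J e y) = (D.φ e).symm y := D.Φ_symm_J hy1 h0
      refine ⟨D.mem_target h0 hy1, h, ?_⟩
      rw [← h]
      exact hy3
    refine ((hch x').comp ((D.smooth_symm e).mono fun y hy => (key y hy).1)
      fun y hy => (key y hy).2.2).congr fun y hy => ?_
    change chartAt Plane x' (D.Φ.symm (D.J e y)) = _
    rw [(key y hy).2.1]
    rfl
  · refine contMDiffOn_id.congr fun y hy => ?_
    obtain ⟨hy1, hy2⟩ := hy
    obtain ⟨y', hy', h⟩ : D.J e y ∈ D.cap e' '' disk D.r := hy2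
    have he : e' = e := D.eq_of_cap_eq hy' hy1 h
    subst he
    exact (D.J e').left_inv hy1

instance : IsManifold (𝓡 2) ∞ D.Capped := by
  refine isManifold_of_contDiffOn _ _ _ fun ψ ψ' hψ hψ' => ?_
  have h := (D.contDiffOn_transition hψ hψ').contDiffOn
  simpa [Function.comp_def] using h

lemma contMDiffOn_Φ : ContMDiffOn (𝓡 2) (𝓡 2) ∞ D.Φ D.U := by
  intro x hx
  apply ContMDiffAt.contMDiffWithinAt
  have h1 := contMDiffOn_symm_of_mem_maximalAtlas (I := 𝓡 2) (n := ∞)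
    (IsManifold.subset_maximalAtlas (D.chartOf_mem_atlas x))
  have hxs : D.Φ x ∈ (D.chartOf x).source := by
    rw [chartOf, OpenPartialHomeomorph.trans_source]
    refine ⟨D.Φ.map_source hx, ?_⟩
    change D.Φ.symm (D.Φ x) ∈ (chartAt Plane x).source
    rw [D.Φ.left_inv hx]
    exact mem_chart_source Plane x
  have hval : ∀ x' : M, x' ∈ D.U → D.chartOf x (D.Φ x') = chartAt Plane x x' := fun x' hx' => by
    change chartAt Plane x (D.Φ.symm (D.Φ x')) = _
    rw [D.Φ.left_inv hx']
  have ht : chartAt Plane x x ∈ (D.chartOf x).target := by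
    rw [← hval x hx]
    exact (D.chartOf x).map_source hxs
  have h2 := (h1.contMDiffAt ((D.chartOf x).open_target.mem_nhds ht)).comp x
    (contMDiffOn_chart.contMDiffAt ((chartAt Plane x).open_source.mem_nhds (mem_chart_source Plane x)))
  refine h2.congr_of_eventuallyEq ?_
  have hcont : ContinuousAt D.Φ x := D.Φ.continuousAt hx
  filter_upwards [D.isOpen.mem_nhds hx, hcont ((D.chartOf x).open_source.mem_nhds hxs)] with x' hx' h'
  change _ = (D.chartOf x).symm (chartAt Plane x x')
  rw [← hval x' hx', (D.chartOf x).left_inv h']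

lemma contMDiffOn_Φ_symm : ContMDiffOn (𝓡 2) (𝓡 2) ∞ D.Φ.symm D.Φ.target := by
  intro s hs
  apply ContMDiffAt.contMDiffWithinAt
  set x := D.Φ.symm s
  have h1 := contMDiffOn_of_mem_maximalAtlas (I := 𝓡 2) (n := ∞)
    (IsManifold.subset_maximalAtlas (D.chartOf_mem_atlas x))
  have hxs : s ∈ (D.chartOf x).source := by
    rw [chartOf, OpenPartialHomeomorph.trans_source]
    exact ⟨hs, mem_chart_source Plane x⟩
  have h2 := ((contMDiffOn_chart_symm (I := 𝓡 2) (n := ∞) (x := x)).contMDiffAt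
    ((chartAt Plane x).open_target.mem_nhds
    ((chartAt Plane x).map_source (mem_chart_source Plane x)))).comp s
    (h1.contMDiffAt ((D.chartOf x).open_source.mem_nhds hxs))
  refine h2.congr_of_eventuallyEq ?_
  filter_upwards [(D.chartOf x).open_source.mem_nhds hxs] with t ht
  exact ((chartAt Plane x).left_inv ht.2).symm

lemma contMDiffOn_J (e : E) : ContMDiffOn (𝓡 2) (𝓡 2) ∞ (D.J e) (disk D.r) :=
  contMDiffOn_symm_of_mem_maximalAtlas (I := 𝓡 2) (n := ∞)
    (IsManifold.subset_maximalAtlas (D.J_symm_mem_atlas e))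

lemma contMDiffOn_J_symm (e : E) : ContMDiffOn (𝓡 2) (𝓡 2) ∞ (D.J e).symm (D.J e).target :=
  contMDiffOn_of_mem_maximalAtlas (I := 𝓡 2) (n := ∞)
    (IsManifold.subset_maximalAtlas (D.J_symm_mem_atlas e))

lemma disk_one : disk 1 = Metric.ball 0 1 := by
  ext y
  rw [mem_ball_zero_iff]
  exact sq_lt_one_iff₀ (norm_nonneg y)

lemma closed_disk_one : {y : Plane | ‖y‖ ^ 2 ≤ 1} = Metric.closedBall 0 1 := by
  ext y
  rw [mem_closedBall_zero_iff]
  exact sq_le_one_iff₀ (norm_nonneg y)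

lemma isSmoothDisk_openCap (e : E) : IsSmoothDisk (D.openCap e) := by
  refine ⟨_, IsManifold.subset_maximalAtlas (D.J_symm_mem_atlas e), ?_, ?_⟩
  · rw [← closed_disk_one]
    exact D.closed_subset_disk
  · rw [openCap, disk_one]
    rfl

lemma closure_openCap (e : E) : closure (D.openCap e) = D.closedCap e := by
  apply subset_antisymm
  · exact closure_minimal (image_mono fun y hy => show ‖y‖ ^ 2 ≤ 1 from le_of_lt hy)
      (D.isClosed_closedCap e)
  · have h := ContinuousOn.image_closure (f := D.J e) (s := disk 1) (by
      rw [disk_one, closure_ball _ one_ne_zero, ← closed_disk_one]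
      exact (D.J e).continuousOn.mono D.closed_subset_disk)
    rw [disk_one, closure_ball _ one_ne_zero, ← closed_disk_one, ← disk_one] at h
    exact h

lemma frontier_openCap (e : E) : frontier (D.openCap e) = D.cap e '' {y | ‖y‖ ^ 2 = 1} := by
  rw [frontier, D.closure_openCap, (D.isOpen_openCap e).interior_eq, closedCap, openCap,
    ← ((D.cap_injOn e).mono D.closed_subset_disk).image_sdiff_subset
      (t := disk 1) fun y hy => show ‖y‖ ^ 2 ≤ 1 from le_of_lt hy]
  congr 1
  ext y
  change ‖y‖ ^ 2 ≤ 1 ∧ ¬ ‖y‖ ^ 2 < 1 ↔ ‖y‖ ^ 2 = 1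
  rw [not_lt, le_antisymm_iff]

lemma disjoint_closedCap : Pairwise fun e e' => Disjoint (D.closedCap e) (D.closedCap e') := by
  intro e e' hne
  rw [disjoint_left]
  rintro _ ⟨y, hy, rfl⟩ ⟨y', hy', h⟩
  exact hne (D.eq_of_cap_eq (D.closed_subset_disk hy') (D.closed_subset_disk hy) h).symm

lemma image_Φ_eq_compl_iUnion_openCap :
    D.Φ '' (D.U \ ⋃ e, {x ∈ (D.φ e).source | ‖D.φ e x‖ ^ 2 < 1}) = (⋃ e, D.openCap e)ᶜ := by
  ext s
  rcases D.exists_rep s with ⟨x, hx, rfl⟩ | ⟨e, rfl⟩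
  · have h1 : D.incl x ∈ (⋃ e, D.openCap e)ᶜ ↔ x ∉ ⋃ e, {x ∈ (D.φ e).source | ‖D.φ e x‖ ^ 2 < 1} := by
      rw [mem_compl_iff, mem_iUnion, mem_iUnion]
      simp only [D.incl_mem_openCap hx]
      rfl
    rw [h1]
    constructor
    · rintro ⟨x', ⟨hx', h'⟩, h⟩
      rwa [← D.incl_inj hx' hx h]
    · exact fun h => ⟨x, ⟨hx, h⟩, rfl⟩
  · constructor
    · rintro ⟨x, -, h⟩
      exact absurd h (D.incl_ne_centre _ _)
    · intro h
      exact absurd (mem_iUnion.2 ⟨e, show D.centre e ∈ D.cap e '' disk 1 from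
        ⟨0, by simp [disk], D.cap_zero e⟩⟩) h

/-- The uncapped part is the complement of the finitely many centres. -/
lemma genus_capped [Finite E] : genus D.Capped = genus D.U := by
  have h1 : (range D.centre)ᶜ = D.Φ.target := by
    ext s
    constructor
    · intro h
      rcases D.Φ_target_or s with h' | ⟨e, rfl⟩
      exacts [h', absurd ⟨e, rfl⟩ h]
    · rintro h ⟨e, rfl⟩
      exact D.centre_notMem e h
  rw [← genus_compl_finite (finite_range D.centre), h1]
  exact genus_congr D.Φ.toHomeomorphSourceTarget.symm

end CapData

/-! ### Derivatives as maps of the model plane; partial diffeomorphisms. -/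

section ModelDerivative

variable {A B C : Type*} [TopologicalSpace A] [ChartedSpace Plane A] [IsManifold (𝓡 2) ∞ A]
  [TopologicalSpace B] [ChartedSpace Plane B] [IsManifold (𝓡 2) ∞ B]
  [TopologicalSpace C] [ChartedSpace Plane C] [IsManifold (𝓡 2) ∞ C]

/-- The derivative of a map of surfaces, as a linear map of the model space. -/
noncomputable def tder (f : A → B) (x : A) : Plane →L[ℝ] Plane := mfderiv (𝓡 2) (𝓡 2) f x

/-- The differential of a function, as a linear form on the model space. -/
noncomputable def tdiff (f : A → ℝ) (x : A) : Plane →L[ℝ] ℝ := mfderiv (𝓡 2) 𝓘(ℝ, ℝ) f x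

lemma tder_comp {g : B → C} {f : A → B} {x : A} (hg : MDifferentiableAt (𝓡 2) (𝓡 2) g (f x))
    (hf : MDifferentiableAt (𝓡 2) (𝓡 2) f x) (v : Plane) :
    tder (fun x => g (f x)) x v = tder g (f x) (tder f x v) :=
  congrArg (fun L : Plane →L[ℝ] Plane => L v) (mfderiv_comp x hg hf)

lemma tdiff_comp {g : B → ℝ} {f : A → B} {x : A} (hg : MDifferentiableAt (𝓡 2) 𝓘(ℝ, ℝ) g (f x))
    (hf : MDifferentiableAt (𝓡 2) (𝓡 2) f x) (v : Plane) :
    tdiff (fun x => g (f x)) x v = tdiff g (f x) (tder f x v) :=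
  congrArg (fun L : Plane →L[ℝ] ℝ => L v) (mfderiv_comp x hg hf)

lemma tder_congr {f f' : A → B} {x : A} (h : f =ᶠ[𝓝 x] f') : tder f x = tder f' x :=
  Filter.EventuallyEq.mfderiv_eq h

lemma tdiff_congr {f f' : A → ℝ} {x : A} (h : f =ᶠ[𝓝 x] f') : tdiff f x = tdiff f' x :=
  Filter.EventuallyEq.mfderiv_eq h

lemma tder_of_eventually_id {f : A → A} {x : A} (h : ∀ᶠ y in 𝓝 x, f y = y) (v : Plane) :
    tder f x v = v := by
  rw [tder_congr (f' := id) h]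
  exact congrArg (fun L : Plane →L[ℝ] Plane => L v) (mfderiv_id (I := 𝓡 2) (x := x))

lemma pull_eq {f : B → A} {η : TwoTensor A} (x : B) (v w : Plane) :
    pull f η x v w = η (f x) (tder f x v) (tder f x w) := rfl

lemma mdifferentiableAt_of_smooth {f : A → B} {O : Set A} (hO : IsOpen O)
    (hf : ContMDiffOn (𝓡 2) (𝓡 2) ∞ f O) {x : A} (hx : x ∈ O) :
    MDifferentiableAt (𝓡 2) (𝓡 2) f x :=
  (hf.contMDiffAt (hO.mem_nhds hx)).mdifferentiableAt (by simp)

/-- A diffeomorphism between open subsets. -/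
structure IsDiffeoPartial (ψ : OpenPartialHomeomorph A B) : Prop where
  smooth : ContMDiffOn (𝓡 2) (𝓡 2) ∞ ψ ψ.source
  smooth_symm : ContMDiffOn (𝓡 2) (𝓡 2) ∞ ψ.symm ψ.target

namespace IsDiffeoPartial

variable {ψ : OpenPartialHomeomorph A B}

lemma mdiff (h : IsDiffeoPartial ψ) {x : A} (hx : x ∈ ψ.source) : MDifferentiableAt (𝓡 2) (𝓡 2) ψ x :=
  mdifferentiableAt_of_smooth ψ.open_source h.smooth hx

lemma mdiff_symm (h : IsDiffeoPartial ψ) {y : B} (hy : y ∈ ψ.target) : MDifferentiableAt (𝓡 2) (𝓡 2) ψ.symm y :=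
  mdifferentiableAt_of_smooth ψ.open_target h.smooth_symm hy

lemma tder_symm_tder (h : IsDiffeoPartial ψ) {x : A} (hx : x ∈ ψ.source) (v : Plane) :
    tder ψ.symm (ψ x) (tder ψ x v) = v := by
  rw [← tder_comp (h.mdiff_symm (ψ.map_source hx)) (h.mdiff hx)]
  refine tder_of_eventually_id ?_ v
  filter_upwards [ψ.open_source.mem_nhds hx] with y hy using ψ.left_inv hy

lemma tder_tder_symm (h : IsDiffeoPartial ψ) {y : B} (hy : y ∈ ψ.target) (v : Plane) :
    tder ψ (ψ.symm y) (tder ψ.symm y v) = v := by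
  rw [← tder_comp (h.mdiff (ψ.map_target hy)) (h.mdiff_symm hy)]
  refine tder_of_eventually_id ?_ v
  filter_upwards [ψ.open_target.mem_nhds hy] with z hz using ψ.right_inv hz

end IsDiffeoPartial

lemma tangent_mk_eq {s s' : B} (h : s = s') {v v' : Plane} (hv : v = v') :
    (⟨s, v⟩ : TangentBundle (𝓡 2) B) = ⟨s', v'⟩ := by
  subst h hv
  rfl

end ModelDerivative

/-! ### Extending the form, the Hamiltonian and its vector field over the caps. -/

namespace CapData

variable {M : Type u} [TopologicalSpace M] [T2Space M] [ChartedSpace Plane M]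
  [IsManifold (𝓡 2) ∞ M] {E : Type u}

/-- A Hamiltonian system on the uncapped part of a surface which extends over the caps. -/
structure Ham (D : CapData M E) where
  Ω : TwoTensor M
  H : ℝ → M → ℝ
  X : ℝ → VField M
  K : E → Plane → ℝ
  g : E → ℝ → Plane → ℝ
  sympl : IsSymplecticOn Ω D.U
  K_smooth : ∀ e, ContDiffOn ℝ ∞ (K e) (disk D.r)
  K_ne : ∀ e, ∀ y ∈ disk D.r, K e y ≠ 0
  form : ∀ e, ∀ x ∈ (D.φ e).source, ∀ v w : Plane,
    Ω x v w = K e (D.φ e x) * det2 (tder (D.φ e) x v) (tder (D.φ e) x w)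
  H_smooth : IsSmoothTimeFunOn H D.U
  H_per : ∀ t, H (t + 1) = H t
  g_smooth : ∀ e, ContDiffOn ℝ ∞ (fun q : ℝ × Plane => g e q.1 q.2) (univ ×ˢ disk D.r)
  g_per : ∀ e t, g e (t + 1) = g e t
  g_crit : ∀ e t, fderiv ℝ (g e t) 0 = 0
  g_rot : ∀ e t, ∀ y ∈ disk D.r, fderiv ℝ (g e t) y (pt (-y 1) (y 0)) = 0
  H_eq : ∀ e, ∀ x ∈ (D.φ e).source, ∀ t, H t x = g e t (D.φ e x)
  X_smooth : ContMDiffOn (𝓘(ℝ, ℝ).prod (𝓡 2)) (𝓡 2).tangent ∞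
    (fun p : ℝ × M => (⟨p.2, X p.1 p.2⟩ : TangentBundle (𝓡 2) M)) (univ ×ˢ D.U)
  X_eq : ∀ t, ∀ x ∈ D.U, ∀ w : Plane, Ω x (X t x) w = - tdiff (H t) x w

variable (D : CapData M E)

lemma diffeo_φ (e : E) : IsDiffeoPartial (D.φ e) := ⟨D.smooth e, D.smooth_symm e⟩

lemma diffeo_Φ : IsDiffeoPartial D.Φ := ⟨D.contMDiffOn_Φ, D.contMDiffOn_Φ_symm⟩

lemma diffeo_J (e : E) : IsDiffeoPartial (D.J e) := ⟨D.contMDiffOn_J e, D.contMDiffOn_J_symm e⟩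

lemma tder_J {e : E} {y : Plane} (hy : y ≠ 0) (hr : y ∈ disk D.r) (v : Plane) :
    tder (D.J e) y v = tder D.Φ ((D.φ e).symm y) (tder (D.φ e).symm y v) := by
  have h := D.mem_target (e := e) hy hr
  rw [← tder_comp ((D.diffeo_Φ).mdiff (D.symm_mem hy hr)) ((D.diffeo_φ e).mdiff_symm h)]
  rw [tder_congr]
  filter_upwards [(D.φ e).open_target.mem_nhds h] with y' hy'
  rw [D.target_eq] at hy'
  exact D.J_eq_Φ hy'.1

lemma tder_J_symm {e : E} {x : M} (hx : x ∈ (D.φ e).source) (v : Plane) :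
    tder (D.J e).symm (D.Φ x) v = tder (D.φ e) x (tder D.Φ.symm (D.Φ x) v) := by
  have hxU := D.source_subset e hx
  have hΦ : D.Φ x ∈ D.Φ.target := D.Φ.map_source hxU
  have e0 : D.Φ.symm (D.Φ x) = x := D.Φ.left_inv hxU
  have h1 := tder_comp (g := D.φ e) (f := D.Φ.symm) (x := D.Φ x)
    (by rw [e0]; exact (D.diffeo_φ e).mdiff hx) (D.diffeo_Φ.mdiff_symm hΦ) v
  rw [e0] at h1
  rw [← h1, tder_congr]
  have hO : IsOpen (D.Φ '' (D.φ e).source) :=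
    D.isOpen_image_incl (D.φ e).open_source (D.source_subset e)
  filter_upwards [hO.mem_nhds ⟨x, hx, rfl⟩]
  rintro _ ⟨x', hx', rfl⟩
  rw [D.J_symm_Φ hx', D.Φ.left_inv (D.source_subset e hx')]

lemma J_target_cases {e : E} {s : D.Capped} (hs : s ∈ (D.J e).target) :
    s = D.centre e ∨ ∃ x ∈ (D.φ e).source, s = D.Φ x := by
  obtain ⟨y, hy, rfl⟩ : s ∈ D.cap e '' disk D.r := hs
  by_cases h : y = 0
  · exact Or.inl (by rw [h, D.cap_zero])
  · exact Or.inr ⟨_, (D.φ e).map_target (D.mem_target h hy), D.J_eq_Φ h⟩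

namespace Ham

variable {D} (F : D.Ham)

open Classical in
/-- The symplectic form of the capped surface. -/
noncomputable def tensor : TwoTensor D.Capped := fun s =>
  if h : ∃ e, s = D.centre e then pull (D.J h.choose).symm (areaForm (F.K h.choose)) s
  else pull D.Φ.symm F.Ω s

open Classical in
/-- The Hamiltonian of the capped surface. -/
noncomputable def ham (t : ℝ) (s : D.Capped) : ℝ :=
  if h : ∃ e, s = D.centre e then F.g h.choose t 0 else F.H t (D.Φ.symm s)

open Classical in
/-- The Hamiltonian vector field of the capped surface. -/
noncomputable def field (t : ℝ) : VField D.Capped := fun s =>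
  if ∃ e, s = D.centre e then (0 : Plane) else tder D.Φ (D.Φ.symm s) (F.X t (D.Φ.symm s))

/-- The Hamiltonian vector field on a cap. -/
noncomputable def capField (e : E) (t : ℝ) (y : Plane) : Plane :=
  (F.K e y)⁻¹ • pt (-fderiv ℝ (F.g e t) y (pt 0 1)) (fderiv ℝ (F.g e t) y (pt 1 0))

lemma not_centre {s : D.Capped} (hs : s ∈ D.Φ.target) : ¬ ∃ e, s = D.centre e := by
  rintro ⟨e, rfl⟩
  exact D.centre_notMem e hs

lemma tensor_of_mem {s : D.Capped} (hs : s ∈ D.Φ.target) : F.tensor s = pull D.Φ.symm F.Ω s :=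
  dif_neg (not_centre hs)

lemma ham_of_mem {s : D.Capped} (hs : s ∈ D.Φ.target) (t : ℝ) : F.ham t s = F.H t (D.Φ.symm s) :=
  dif_neg (not_centre hs)

lemma field_of_mem {s : D.Capped} (hs : s ∈ D.Φ.target) (t : ℝ) :
    F.field t s = tder D.Φ (D.Φ.symm s) (F.X t (D.Φ.symm s)) :=
  if_neg (not_centre hs)

lemma field_centre (e : E) (t : ℝ) : F.field t (D.centre e) = (0 : Plane) := if_pos ⟨e, rfl⟩

lemma tensor_centre (e : E) :
    F.tensor (D.centre e) = pull (D.J e).symm (areaForm (F.K e)) (D.centre e) := by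
  have h : ∃ e', D.centre e = D.centre e' := ⟨e, rfl⟩
  have h2 : h.choose = e := (D.centre_inj h.choose_spec).symm
  rw [tensor, dif_pos h, h2]

lemma ham_centre (e : E) (t : ℝ) : F.ham t (D.centre e) = F.g e t 0 := by
  have h : ∃ e', D.centre e = D.centre e' := ⟨e, rfl⟩
  have h2 : h.choose = e := (D.centre_inj h.choose_spec).symm
  rw [ham, dif_pos h, h2]

lemma J_symm_centre (e : E) : (D.J e).symm (D.centre e) = 0 := by
  rw [← D.J_zero]
  exact (D.J e).left_inv D.zero_mem_disk

/-- The definition prescribes the value only at the centre. Off the centre the formula agrees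
because `φ` carries `Ω` to the area form; hence one smooth expression is valid on the whole cap. -/
lemma tensor_of_mem_J {e : E} {s : D.Capped} (hs : s ∈ (D.J e).target) (v w : Plane) :
    F.tensor s v w = pull (D.J e).symm (areaForm (F.K e)) s v w := by
  rcases D.J_target_cases hs with rfl | ⟨x, hx, rfl⟩
  · rw [F.tensor_centre]
  · have hxU := D.source_subset e hx
    rw [F.tensor_of_mem (D.Φ.map_source hxU), pull_eq, pull_eq, areaForm_apply, D.J_symm_Φ hx,
      D.tder_J_symm hx, D.tder_J_symm hx, ← F.form e x hx, D.Φ.left_inv hxU]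

lemma ham_of_mem_J {e : E} {s : D.Capped} (hs : s ∈ (D.J e).target) (t : ℝ) :
    F.ham t s = F.g e t ((D.J e).symm s) := by
  rcases D.J_target_cases hs with rfl | ⟨x, hx, rfl⟩
  · rw [F.ham_centre, J_symm_centre]
  · have hxU := D.source_subset e hx
    rw [F.ham_of_mem (D.Φ.map_source hxU), D.J_symm_Φ hx, D.Φ.left_inv hxU, F.H_eq e x hx]

/-- Identifies `capField` as the Hamiltonian field of `g` for the area form of density `K`. -/
lemma det2_capField {e : E} {y : Plane} (hy : y ∈ disk D.r) (t : ℝ) (w : Plane) :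
    F.K e y * det2 (F.capField e t y) w = - fderiv ℝ (F.g e t) y w := by
  have hK := F.K_ne e y hy
  conv_rhs => rw [plane_decomp w, map_add, map_smul, map_smul, smul_eq_mul, smul_eq_mul]
  rw [det2, capField, PiLp.smul_apply, PiLp.smul_apply, pt_zero, pt_one, smul_eq_mul, smul_eq_mul]
  field_simp
  ring

lemma g_differentiable {e : E} {y : Plane} (hy : y ∈ disk D.r) (t : ℝ) :
    DifferentiableAt ℝ (F.g e t) y := by
  have h := ((F.g_smooth e).contDiffAt ((isOpen_univ.prod (isOpen_disk D.r)).mem_nhds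
    (show ((t, y) : ℝ × Plane) ∈ univ ×ˢ disk D.r from ⟨mem_univ _, hy⟩))).differentiableAt (by simp)
  exact h.comp y ((differentiableAt_const t).prodMk differentiableAt_id)

lemma H_mdifferentiable {x : M} (hx : x ∈ D.U) (t : ℝ) :
    MDifferentiableAt (𝓡 2) 𝓘(ℝ, ℝ) (F.H t) x := by
  have h := (F.H_smooth.contMDiffAt ((isOpen_univ.prod D.isOpen).mem_nhds
    (show ((t, x) : ℝ × M) ∈ univ ×ˢ D.U from ⟨mem_univ _, hx⟩)))
  have h2 : ContMDiffAt (𝓡 2) (𝓘(ℝ, ℝ).prod (𝓡 2)) ∞ (fun x : M => (t, x)) x :=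
    contMDiffAt_const.prodMk contMDiffAt_id
  exact (h.comp x h2).mdifferentiableAt (by simp)

lemma tdiff_H {e : E} {x : M} (hx : x ∈ (D.φ e).source) (t : ℝ) (w : Plane) :
    tdiff (F.H t) x w = fderiv ℝ (F.g e t) (D.φ e x) (tder (D.φ e) x w) := by
  have hr : D.φ e x ∈ disk D.r := by
    have := (D.φ e).map_source hx
    rw [D.target_eq] at this
    exact this.2
  have h1 : MDifferentiableAt (𝓡 2) 𝓘(ℝ, ℝ) (F.g e t) (D.φ e x) :=
    (F.g_differentiable hr t).mdifferentiableAt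
  have h2 := tdiff_comp h1 ((D.diffeo_φ e).mdiff hx) w
  have h3 : tdiff (F.g e t) (D.φ e x) = fderiv ℝ (F.g e t) (D.φ e x) := mfderiv_eq_fderiv
  rw [← h3, ← h2, tdiff_congr]
  filter_upwards [(D.φ e).open_source.mem_nhds hx] with x' hx' using F.H_eq e x' hx' t

/-- Both vectors satisfy the Hamilton equation for the same function and the same nondegenerate
form. -/
lemma tder_φ_X {e : E} {x : M} (hx : x ∈ (D.φ e).source) (t : ℝ) :
    tder (D.φ e) x (F.X t x) = F.capField e t (D.φ e x) := by
  have hr : D.φ e x ∈ disk D.r := by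
    have := (D.φ e).map_source hx
    rw [D.target_eq] at this
    exact this.2
  refine sub_eq_zero.1 (det2_eq_zero fun w => ?_)
  have h1 := F.X_eq t x (D.source_subset e hx) (tder (D.φ e).symm (D.φ e x) w)
  have h4 := (D.diffeo_φ e).tder_tder_symm ((D.φ e).map_source hx) w
  rw [(D.φ e).left_inv hx] at h4
  have h2 := F.form e x hx (F.X t x) (tder (D.φ e).symm (D.φ e x) w)
  rw [h1, F.tdiff_H hx, h4, ← F.det2_capField hr] at h2
  have h3 := mul_left_cancel₀ (F.K_ne e _ hr) h2
  have h5 : ∀ a b c : Plane, det2 (a - b) c = det2 a c - det2 b c := by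
    intro a b c
    simp only [det2, PiLp.sub_apply]
    ring
  rw [h5, h3, sub_self]

lemma capField_zero (e : E) (t : ℝ) : F.capField e t 0 = 0 := by
  rw [capField, F.g_crit]
  ext i
  fin_cases i <;> simp [pt]

/-- The value zero at the centre matches `capField` there, since the centre is critical for `g`.
This gives smoothness of the extended field across the centre. -/
lemma field_of_mem_J {e : E} {s : D.Capped} (hs : s ∈ (D.J e).target) (t : ℝ) :
    F.field t s = tder (D.J e) ((D.J e).symm s) (F.capField e t ((D.J e).symm s)) := by
  rcases D.J_target_cases hs with rfl | ⟨x, hx, rfl⟩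
  · rw [F.field_centre, J_symm_centre, F.capField_zero, map_zero]
  · have hxU := D.source_subset e hx
    have ht := (D.φ e).map_source hx
    have ht' := ht
    rw [D.target_eq] at ht'
    rw [F.field_of_mem (D.Φ.map_source hxU), D.J_symm_Φ hx, D.Φ.left_inv hxU,
      D.tder_J ht'.1 ht'.2, ← F.tder_φ_X hx, (D.φ e).left_inv hx]
    exact congrArg (tder D.Φ x) ((D.diffeo_φ e).tder_symm_tder hx (F.X t x)).symm

end Ham
end CapData

lemma contMDiffAt_vector_of_contMDiffAt {C : Type*} [TopologicalSpace C] {E' H' : Type*}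
    [NormedAddCommGroup E'] [NormedSpace ℝ E'] [TopologicalSpace H'] {J : ModelWithCorners ℝ E' H'}
    [ChartedSpace H' C] {f v : C → Plane} {c : C} (hf : ContMDiffAt J (𝓡 2) ∞ f c)
    (hv : ContMDiffAt J (𝓡 2) ∞ v c) :
    ContMDiffAt J (𝓡 2).tangent ∞ (fun x => (⟨f x, v x⟩ : TangentBundle (𝓡 2) Plane)) c := by
  rw [Bundle.contMDiffAt_totalSpace]
  refine ⟨hf, hv.congr_of_eventuallyEq (Filter.Eventually.of_forall fun x => ?_)⟩
  have h := TangentBundle.continuousLinearMapAt_model_space (𝕜 := ℝ) (F := Plane) (f c) (f x)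
  have h2 := Bundle.Trivialization.coe_linearMapAt_of_mem (R := ℝ)
    (trivializationAt Plane (TangentSpace 𝓘(ℝ, Plane)) (f c)) (b := f x) (by
      rw [TangentBundle.trivializationAt_baseSet, chartAt_self_eq]
      exact mem_univ _)
  exact (congrFun h2 (v x)).symm.trans (congrArg (fun L : Plane →L[ℝ] Plane => L (v x)) h)

/-! ### The capped system is smooth, symplectic, Hamiltonian and periodic. -/

namespace CapData

variable {M : Type u} [TopologicalSpace M] [T2Space M] [ChartedSpace Plane M]
  [IsManifold (𝓡 2) ∞ M] {E : Type u} {D : CapData M E}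

namespace Ham

variable (F : D.Ham)

/-- Locally the tensor is a pullback of a symplectic form by a diffeomorphism: of `Ω` by the inverse
of `Φ` off the centres, of an area form by the inverse of `J` near them. -/
lemma isSymplecticOn_tensor : IsSymplecticOn F.tensor univ := by
  refine ⟨⟨fun s _ (v : Plane) => ?_, fun s _ => ?_⟩, fun s _ (v : Plane)
    (hv : ∀ w : Plane, F.tensor s v w = 0) => ?_⟩
  · rcases D.Φ_target_or s with hs | ⟨e, rfl⟩
    · rw [F.tensor_of_mem hs]
      exact F.sympl.1.1 _ (D.Φ.map_target hs) _
    · rw [F.tensor_centre, pull_eq, areaForm_apply, det2, mul_comm, sub_eq_zero.2, zero_mul]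
      ring
  · apply ContMDiffAt.contMDiffWithinAt
    rcases D.Φ_target_or s with hs | ⟨e, rfl⟩
    · have hU := D.Φ.map_target hs
      refine (contMDiffAt_pull D.Φ.open_target D.contMDiffOn_Φ_symm hs
        (F.sympl.1.2.contMDiffAt (D.isOpen.mem_nhds hU))).congr_of_eventuallyEq ?_
      filter_upwards [D.Φ.open_target.mem_nhds hs] with s' hs'
      rw [F.tensor_of_mem hs']
    · have hs := D.centre_mem e
      have hr : (D.J e).symm (D.centre e) ∈ disk D.r := (D.J e).map_target hs
      refine (contMDiffAt_pull (D.J e).open_target (D.contMDiffOn_J_symm e) hs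
        (contMDiffAt_areaForm ((F.K_smooth e).contDiffAt
          ((isOpen_disk D.r).mem_nhds hr)))).congr_of_eventuallyEq ?_
      filter_upwards [(D.J e).open_target.mem_nhds hs] with s' hs'
      congr 1
      ext v w
      exact F.tensor_of_mem_J hs' v w
  · rcases D.Φ_target_or s with hs | ⟨e, rfl⟩
    · have h1 : tder D.Φ.symm s v = 0 := F.sympl.2 _ (D.Φ.map_target hs) _ fun (w : Plane) => by
        have h2 := hv (tder D.Φ (D.Φ.symm s) w)
        rw [F.tensor_of_mem hs] at h2
        have h3 := D.diffeo_Φ.tder_symm_tder (D.Φ.map_target hs) w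
        rw [D.Φ.right_inv hs] at h3
        rw [pull_eq, h3] at h2
        exact h2
      have h4 := D.diffeo_Φ.tder_tder_symm hs v
      rw [h1, map_zero] at h4
      exact h4.symm
    · have hs := D.centre_mem e
      have hr : (D.J e).symm (D.centre e) ∈ disk D.r := (D.J e).map_target hs
      have h1 : tder (D.J e).symm (D.centre e) v = 0 := det2_eq_zero fun (w : Plane) => by
        have h2 := hv (tder (D.J e) ((D.J e).symm (D.centre e)) w)
        rw [F.tensor_centre] at h2
        have h3 := (D.diffeo_J e).tder_symm_tder hr w
        rw [(D.J e).right_inv hs] at h3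
        rw [pull_eq, h3, areaForm_apply] at h2
        exact (mul_eq_zero.1 h2).resolve_left (F.K_ne e _ hr)
      have h4 := (D.diffeo_J e).tder_tder_symm hs v
      rw [h1, map_zero] at h4
      exact h4.symm

lemma isSmoothTimeFunOn_ham : IsSmoothTimeFunOn F.ham univ := by
  rintro ⟨t, s⟩ -
  apply ContMDiffAt.contMDiffWithinAt
  rcases D.Φ_target_or s with hs | ⟨e, rfl⟩
  · have hU := D.Φ.map_target hs
    have h1 := F.H_smooth.contMDiffAt ((isOpen_univ.prod D.isOpen).mem_nhds
      (show ((t, D.Φ.symm s) : ℝ × M) ∈ univ ×ˢ D.U from ⟨mem_univ _, hU⟩))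
    have h2 : ContMDiffAt (𝓘(ℝ, ℝ).prod (𝓡 2)) (𝓡 2) ∞ (fun p : ℝ × D.Capped => D.Φ.symm p.2) (t, s) :=
      ContMDiffAt.comp (t, s)
        (D.contMDiffOn_Φ_symm.contMDiffAt (D.Φ.open_target.mem_nhds hs)) contMDiffAt_snd
    have h3 := ContMDiffAt.comp (t, s) (f := fun p : ℝ × D.Capped => (p.1, D.Φ.symm p.2)) h1
      (contMDiffAt_fst.prodMk h2)
    refine h3.congr_of_eventuallyEq ?_
    filter_upwards [(isOpen_univ.prod D.Φ.open_target).mem_nhds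
      (show ((t, s) : ℝ × D.Capped) ∈ univ ×ˢ D.Φ.target from ⟨mem_univ _, hs⟩)] with p hp
    exact F.ham_of_mem hp.2 p.1
  · have hs := D.centre_mem e
    have hr : (D.J e).symm (D.centre e) ∈ disk D.r := (D.J e).map_target hs
    have h1 := ((F.g_smooth e).contDiffAt ((isOpen_univ.prod (isOpen_disk D.r)).mem_nhds
      (show ((t, (D.J e).symm (D.centre e)) : ℝ × Plane) ∈ univ ×ˢ disk D.r from
        ⟨mem_univ _, hr⟩))).contMDiffAt
    have h2 : ContMDiffAt (𝓘(ℝ, ℝ).prod (𝓡 2)) (𝓡 2) ∞ (fun p : ℝ × D.Capped => (D.J e).symm p.2)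
        (t, D.centre e) :=
      ContMDiffAt.comp (t, D.centre e)
        ((D.contMDiffOn_J_symm e).contMDiffAt ((D.J e).open_target.mem_nhds hs)) contMDiffAt_snd
    have h3 := ContMDiffAt.comp (t, D.centre e)
      (f := fun p : ℝ × D.Capped => (p.1, (D.J e).symm p.2)) h1
      (contMDiffAt_fst.prodMk_space h2)
    refine h3.congr_of_eventuallyEq ?_
    filter_upwards [(isOpen_univ.prod (D.J e).open_target).mem_nhds
      (show ((t, D.centre e) : ℝ × D.Capped) ∈ univ ×ˢ (D.J e).target from ⟨mem_univ _, hs⟩)] with p hp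
    exact F.ham_of_mem_J hp.2 p.1

lemma contDiffOn_capField (e : E) :
    ContDiffOn ℝ ∞ (fun q : ℝ × Plane => F.capField e q.1 q.2) (univ ×ˢ disk D.r) := by
  have hO : IsOpen ((univ : Set ℝ) ×ˢ disk D.r) := isOpen_univ.prod (isOpen_disk D.r)
  have h1 : ContDiffOn ℝ ∞ (fderiv ℝ (fun q : ℝ × Plane => F.g e q.1 q.2)) (univ ×ˢ disk D.r) :=
    (F.g_smooth e).fderiv_of_isOpen hO (by simp)
  have h2 : ∀ v : Plane, ContDiffOn ℝ ∞ (fun q : ℝ × Plane => fderiv ℝ (F.g e q.1) q.2 v)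
      (univ ×ˢ disk D.r) := by
    intro v
    refine (h1.clm_apply (contDiffOn_const (c := ((0 : ℝ), v)))).congr ?_
    rintro ⟨t, y⟩ hq
    have h3 := (((F.g_smooth e).contDiffAt (hO.mem_nhds hq)).differentiableAt
      (by simp)).hasFDerivAt
    have h4 : HasFDerivAt (fun y : Plane => (t, y)) (ContinuousLinearMap.inr ℝ ℝ Plane) y :=
      hasFDerivAt_prodMk_right t y
    have h5 := (h3.comp y h4).fderiv
    exact congrArg (fun L : Plane →L[ℝ] ℝ => L v) h5
  have h6 : ContDiffOn ℝ ∞ (fun q : ℝ × Plane => (F.K e q.2)⁻¹) (univ ×ˢ disk D.r) :=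
    ContDiffOn.inv ((F.K_smooth e).comp contDiffOn_snd fun q hq => hq.2)
      fun q hq => F.K_ne e _ hq.2
  exact h6.smul (contDiff_pt.comp_contDiffOn ((h2 _).neg.prodMk (h2 _)))

lemma isSmoothTimeVField_field : IsSmoothTimeVField F.field := by
  rintro ⟨t, s⟩
  rcases D.Φ_target_or s with hs | ⟨e, rfl⟩
  · have hU := D.Φ.map_target hs
    have h1 := F.X_smooth.contMDiffAt ((isOpen_univ.prod D.isOpen).mem_nhds
      (show ((t, D.Φ.symm s) : ℝ × M) ∈ univ ×ˢ D.U from ⟨mem_univ _, hU⟩))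
    have h2 : ContMDiffAt (𝓘(ℝ, ℝ).prod (𝓡 2)) (𝓡 2) ∞ (fun p : ℝ × D.Capped => D.Φ.symm p.2) (t, s) :=
      ContMDiffAt.comp (t, s)
        (D.contMDiffOn_Φ_symm.contMDiffAt (D.Φ.open_target.mem_nhds hs)) contMDiffAt_snd
    have h3 := ContMDiffAt.comp (t, s) (f := fun p : ℝ × D.Capped => (p.1, D.Φ.symm p.2)) h1
      (contMDiffAt_fst.prodMk h2)
    have h4 := contMDiffAt_mfderiv_vfield (g := fun p : ℝ × D.Capped => D.Φ.symm p.2)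
      (v := fun p => F.X p.1 (D.Φ.symm p.2)) D.isOpen D.contMDiffOn_Φ (c := (t, s)) hU h3
    refine h4.congr_of_eventuallyEq ?_
    filter_upwards [(isOpen_univ.prod D.Φ.open_target).mem_nhds
      (show ((t, s) : ℝ × D.Capped) ∈ univ ×ˢ D.Φ.target from ⟨mem_univ _, hs⟩)] with p hp
    exact tangent_mk_eq (D.Φ.right_inv hp.2).symm (F.field_of_mem hp.2 p.1)
  · have hs := D.centre_mem e
    have hr : (D.J e).symm (D.centre e) ∈ disk D.r := (D.J e).map_target hs
    have h1 := ((F.contDiffOn_capField e).contDiffAt ((isOpen_univ.prod (isOpen_disk D.r)).mem_nhds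
      (show ((t, (D.J e).symm (D.centre e)) : ℝ × Plane) ∈ univ ×ˢ disk D.r from
        ⟨mem_univ _, hr⟩))).contMDiffAt
    have h2 : ContMDiffAt (𝓘(ℝ, ℝ).prod (𝓡 2)) (𝓡 2) ∞ (fun p : ℝ × D.Capped => (D.J e).symm p.2)
        (t, D.centre e) :=
      ContMDiffAt.comp (t, D.centre e)
        ((D.contMDiffOn_J_symm e).contMDiffAt ((D.J e).open_target.mem_nhds hs)) contMDiffAt_snd
    have h3 := ContMDiffAt.comp (t, D.centre e)
      (f := fun p : ℝ × D.Capped => (p.1, (D.J e).symm p.2)) h1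
      (contMDiffAt_fst.prodMk_space h2)
    have h4 := contMDiffAt_mfderiv_vfield (g := fun p : ℝ × D.Capped => (D.J e).symm p.2)
      (v := fun p => F.capField e p.1 ((D.J e).symm p.2)) (isOpen_disk D.r) (D.contMDiffOn_J e)
      (c := (t, D.centre e)) hr (contMDiffAt_vector_of_contMDiffAt h2 h3)
    refine h4.congr_of_eventuallyEq ?_
    filter_upwards [(isOpen_univ.prod (D.J e).open_target).mem_nhds
      (show ((t, D.centre e) : ℝ × D.Capped) ∈ univ ×ˢ (D.J e).target from ⟨mem_univ _, hs⟩)] with p hp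
    exact tangent_mk_eq ((D.J e).right_inv hp.2).symm (F.field_of_mem_J hp.2 p.1)

lemma isHamiltonianField : IsHamiltonianField F.tensor ∅ F.ham F.field := by
  refine ⟨F.isSmoothTimeVField_field, fun t s _ (w : Plane) => ?_⟩
  change F.tensor s (F.field t s) w = - tdiff (F.ham t) s w
  rcases D.Φ_target_or s with hs | ⟨e, rfl⟩
  · have hU := D.Φ.map_target hs
    have h1 : tder D.Φ.symm s (F.field t s) = F.X t (D.Φ.symm s) := by
      rw [F.field_of_mem hs]
      have h3 := D.diffeo_Φ.tder_symm_tder (D.Φ.map_target hs) (F.X t (D.Φ.symm s))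
      rw [D.Φ.right_inv hs] at h3
      exact h3
    have h2 : tdiff (F.ham t) s w = tdiff (F.H t) (D.Φ.symm s) (tder D.Φ.symm s w) := by
      rw [← tdiff_comp (F.H_mdifferentiable hU t) (D.diffeo_Φ.mdiff_symm hs), tdiff_congr]
      filter_upwards [D.Φ.open_target.mem_nhds hs] with s' hs' using F.ham_of_mem hs' t
    rw [h2, ← F.X_eq t _ hU, ← h1, F.tensor_of_mem hs]
    rfl
  · have hs := D.centre_mem e
    have h2 : tdiff (F.ham t) (D.centre e) w = 0 := by
      have h1 : MDifferentiableAt (𝓡 2) 𝓘(ℝ, ℝ) (F.g e t) ((D.J e).symm (D.centre e)) :=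
        (F.g_differentiable ((D.J e).map_target hs) t).mdifferentiableAt
      have h3 : tdiff (F.g e t) ((D.J e).symm (D.centre e)) =
        fderiv ℝ (F.g e t) ((D.J e).symm (D.centre e)) := mfderiv_eq_fderiv
      rw [tdiff_congr (f' := fun s => F.g e t ((D.J e).symm s)),
        tdiff_comp h1 ((D.diffeo_J e).mdiff_symm hs), h3, J_symm_centre, F.g_crit]
      · rfl
      · filter_upwards [(D.J e).open_target.mem_nhds hs] with s' hs' using F.ham_of_mem_J hs' t
    have h4 : F.tensor (D.centre e) (F.field t (D.centre e)) w = 0 := by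
      rw [F.field_centre]
      exact congrArg (fun L : Plane →L[ℝ] ℝ => L w) (map_zero (F.tensor (D.centre e)))
    rw [h4, h2, neg_zero]

lemma ham_add_one (t : ℝ) : F.ham (t + 1) = F.ham t := by
  funext s
  rcases D.Φ_target_or s with hs | ⟨e, rfl⟩
  · rw [F.ham_of_mem hs, F.ham_of_mem hs, F.H_per]
  · rw [F.ham_centre, F.ham_centre, F.g_per]

/-- Periodicity of the field follows from that of `H`, the form being nondegenerate. -/
lemma X_add_one {x : M} (hx : x ∈ D.U) (t : ℝ) : F.X (t + 1) x = F.X t x := by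
  refine sub_eq_zero.1 (F.sympl.2 x hx _ fun w => ?_)
  have h1 := F.X_eq t x hx w
  have h2 := F.X_eq (t + 1) x hx w
  rw [F.H_per] at h2
  rw [map_sub]
  change F.Ω x (F.X (t + 1) x) w - F.Ω x (F.X t x) w = 0
  rw [h1, h2, sub_self]

lemma field_add_one (t : ℝ) : F.field (t + 1) = F.field t := by
  funext s
  rcases D.Φ_target_or s with hs | ⟨e, rfl⟩
  · rw [F.field_of_mem hs, F.field_of_mem hs, F.X_add_one (D.Φ.map_target hs)]
  · rw [F.field_centre, F.field_centre]

lemma tensor_Φ {x : M} (hx : x ∈ D.U) (v w : Plane) :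
    F.tensor (D.Φ x) (tder D.Φ x v) (tder D.Φ x w) = F.Ω x v w := by
  rw [F.tensor_of_mem (D.Φ.map_source hx), pull_eq, D.diffeo_Φ.tder_symm_tder hx,
    D.diffeo_Φ.tder_symm_tder hx, D.Φ.left_inv hx]

lemma field_Φ {x : M} (hx : x ∈ D.U) (t : ℝ) : F.field t (D.Φ x) = tder D.Φ x (F.X t x) := by
  rw [F.field_of_mem (D.Φ.map_source hx), D.Φ.left_inv hx]

end Ham
end CapData
-- Dynamics in the caps: invariant circles and fixed points.
namespace CapData

variable {M : Type u} [TopologicalSpace M] [T2Space M] [ChartedSpace Plane M]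
  [IsManifold (𝓡 2) ∞ M] {E : Type u} {D : CapData M E}

/-- The squared radius in a cap. -/
noncomputable def radius (D : CapData M E) (e : E) (s : D.Capped) : ℝ := ‖(D.J e).symm s‖ ^ 2

lemma contDiff_sq_norm : ContDiff ℝ ∞ (fun y : Plane => ‖y‖ ^ 2) := contDiff_norm_sq ℝ

lemma contMDiffOn_radius (e : E) : ContMDiffOn (𝓡 2) 𝓘(ℝ, ℝ) ∞ (D.radius e) (D.J e).target :=
  contDiff_sq_norm.contMDiff.comp_contMDiffOn (D.contMDiffOn_J_symm e)

/-- The bound on the level makes the circle compact inside the cap, hence closed in the whole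
surface and not only in the open disk. -/
lemma isClosed_level {e : E} {c : ℝ} (hc : c ≤ 1) :
    IsClosed {s ∈ (D.J e).target | D.radius e s = c} := by
  have h1 : IsCompact ({y : Plane | ‖y‖ ^ 2 ≤ 1} ∩ {y | ‖y‖ ^ 2 = c}) :=
    isCompact_closed_unit.inter_right (isClosed_eq (by fun_prop) continuous_const)
  have h2 : {s ∈ (D.J e).target | D.radius e s = c} =
      D.J e '' ({y : Plane | ‖y‖ ^ 2 ≤ 1} ∩ {y | ‖y‖ ^ 2 = c}) := by
    ext s
    constructor
    · rintro ⟨hs, h⟩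
      have h' : ‖(D.J e).symm s‖ ^ 2 = c := h
      exact ⟨(D.J e).symm s, ⟨show ‖(D.J e).symm s‖ ^ 2 ≤ 1 from h'.trans_le hc, h'⟩,
        (D.J e).right_inv hs⟩
    · rintro ⟨y, ⟨hy1, hy2⟩, rfl⟩
      have hy := D.closed_subset_disk hy1
      refine ⟨(D.J e).map_source hy, ?_⟩
      unfold radius
      rw [(D.J e).left_inv hy]
      exact hy2
  rw [h2]
  exact (h1.image_of_continuousOn ((D.J e).continuousOn.mono
    (inter_subset_left.trans D.closed_subset_disk))).isClosed

namespace Ham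

variable (F : D.Ham)

/-- Up to the factor -2/K, the derivative of r² along the Hamiltonian field of `g` is the derivative
of `g` along the rotation field, which vanishes by `g_rot`. -/
lemma tdiff_radius_field {e : E} {s : D.Capped} (hs : s ∈ (D.J e).target) (t : ℝ) :
    tdiff (D.radius e) s (F.field t s) = 0 := by
  have hr : (D.J e).symm s ∈ disk D.r := (D.J e).map_target hs
  have hd : DifferentiableAt ℝ (fun y : Plane => ‖y‖ ^ 2) ((D.J e).symm s) :=
    contDiff_sq_norm.differentiable (by simp) _
  have h1 := tdiff_comp hd.mdifferentiableAt ((D.diffeo_J e).mdiff_symm hs) (F.field t s)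
  have h2 : tder (D.J e).symm s (F.field t s) = F.capField e t ((D.J e).symm s) := by
    rw [F.field_of_mem_J hs]
    have h3 := (D.diffeo_J e).tder_symm_tder hr (F.capField e t ((D.J e).symm s))
    rwa [(D.J e).right_inv hs] at h3
  have h4 : tdiff (fun y : Plane => ‖y‖ ^ 2) ((D.J e).symm s) =
      fderiv ℝ (fun y : Plane => ‖y‖ ^ 2) ((D.J e).symm s) := mfderiv_eq_fderiv
  rw [h2, h4] at h1
  refine h1.trans ?_
  set y := (D.J e).symm s
  have h5 : HasFDerivAt (fun y : Plane => ‖y‖ ^ 2) (2 • innerSL ℝ y) y :=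
    (hasStrictFDerivAt_norm_sq y).hasFDerivAt
  have h6 := F.g_rot e t y hr
  have h7 : pt (-y 1) (y 0) = (-y 1) • pt 1 0 + y 0 • pt 0 1 := by
    conv_lhs => rw [plane_decomp (pt (-y 1) (y 0)), pt_zero, pt_one]
  rw [h7, map_add, map_smul, map_smul, smul_eq_mul, smul_eq_mul] at h6
  rw [h5.fderiv]
  have h8 : ∀ v w : Plane, inner ℝ v w = v 0 * w 0 + v 1 * w 1 := by
    intro v w
    rw [PiLp.inner_apply, Fin.sum_univ_two]
    simp [mul_comm]
  change 2 • inner ℝ y (F.capField e t y) = 0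
  rw [h8, capField, PiLp.smul_apply, PiLp.smul_apply, pt_zero, pt_one, smul_eq_mul, smul_eq_mul]
  have h9 : y 0 * ((F.K e y)⁻¹ * -(fderiv ℝ (F.g e t) y) (pt 0 1)) +
      y 1 * ((F.K e y)⁻¹ * (fderiv ℝ (F.g e t) y) (pt 1 0)) = 0 := by
    linear_combination -(F.K e y)⁻¹ * h6
  rw [h9, smul_zero]

lemma orbit_radius {γ : ℝ → D.Capped} (hγ : IsOrbit F.field γ) {e : E} {t₀ c : ℝ} (hc : c ≤ 1)
    (h0 : γ t₀ ∈ (D.J e).target ∧ D.radius e (γ t₀) = c) (t : ℝ) :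
    γ t ∈ (D.J e).target ∧ D.radius e (γ t) = c :=
  mem_level_of_tangent (D.J e).open_target (contMDiffOn_radius e) (isClosed_level hc) hγ
    (fun t ht => F.tdiff_radius_field ht t) h0 t

lemma mem_openCap_iff {e : E} {s : D.Capped} :
    s ∈ D.openCap e ↔ s ∈ (D.J e).target ∧ D.radius e s < 1 := by
  constructor
  · rintro ⟨y, hy, rfl⟩
    have hy' := D.disk_subset_disk hy
    refine ⟨(D.J e).map_source hy', ?_⟩
    have h : (D.J e).symm (D.cap e y) = y := (D.J e).left_inv hy'
    unfold radius
    rw [h]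
    exact hy
  · rintro ⟨h1, h2⟩
    exact ⟨_, h2, (D.J e).right_inv h1⟩

lemma orbit_mem_openCap {γ : ℝ → D.Capped} (hγ : IsOrbit F.field γ) {e : E} {t₀ : ℝ}
    (h0 : γ t₀ ∈ D.openCap e) (t : ℝ) :
    γ t ∈ D.openCap e ∧ D.radius e (γ t) = D.radius e (γ t₀) := by
  rw [mem_openCap_iff] at h0
  obtain ⟨h1, h2⟩ := F.orbit_radius hγ h0.2.le ⟨h0.1, rfl⟩ t
  exact ⟨mem_openCap_iff.2 ⟨h1, h2 ▸ h0.2⟩, h2⟩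

lemma radius_eq_zero {e : E} {s : D.Capped} (hs : s ∈ (D.J e).target) :
    D.radius e s = 0 ↔ s = D.centre e := by
  constructor
  · intro h
    have h1 : (D.J e).symm s = 0 := by
      unfold radius at h
      simpa using h
    rw [← (D.J e).right_inv hs, h1, D.J_zero]
  · rintro rfl
    unfold radius
    rw [J_symm_centre, norm_zero]
    norm_num

lemma centre_mem_openCap (e : E) : D.centre e ∈ D.openCap e := ⟨0, by simp [disk], D.cap_zero e⟩

/-- The conserved radius is zero only at the centre. -/
lemma orbit_centre {γ : ℝ → D.Capped} (hγ : IsOrbit F.field γ) {e : E} {t₀ : ℝ}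
    (h0 : γ t₀ = D.centre e) (t : ℝ) : γ t = D.centre e := by
  have h := F.orbit_mem_openCap hγ (h0 ▸ centre_mem_openCap e) t
  rw [h0, (radius_eq_zero (D.centre_mem e)).2 rfl] at h
  exact (radius_eq_zero (mem_openCap_iff.1 h.1).1).1 h.2

/-- Orbits off the centres of the caps come from the uncapped part. -/
lemma isOrbit_Φ_symm {γ : ℝ → D.Capped} (hγ : IsOrbit F.field γ) (hmem : ∀ t, γ t ∈ D.Φ.target) :
    IsOrbit F.X (fun t => D.Φ.symm (γ t)) := by
  intro t
  have h1 := (D.diffeo_Φ.mdiff_symm (hmem t)).hasMFDerivAt.comp t (hγ t)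
  refine h1.congr_mfderiv ?_
  ext1
  have h2 : tder D.Φ.symm (γ t) (F.field t (γ t)) = F.X t (D.Φ.symm (γ t)) := by
    rw [F.field_of_mem (hmem t)]
    have h3 := D.diffeo_Φ.tder_symm_tder (D.Φ.map_target (hmem t)) (F.X t (D.Φ.symm (γ t)))
    rw [D.Φ.right_inv (hmem t)] at h3
    exact h3
  change tder D.Φ.symm (γ t) ((1 : ℝ) • F.field t (γ t)) = (1 : ℝ) • F.X t (D.Φ.symm (γ t))
  rw [one_smul, one_smul]
  exact h2

/-- Conservation of the radius makes the caps and the core invariant, so orbits in the core are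
orbits of the original field. In a cap the centre is stationary. Any other fixed point of the
time-one map lies on a 1-periodic orbit of the original system inside the cap, against `hper`. -/
theorem exists_flow [Finite E]
    (hper : ¬ ∃ γ : ℝ → M, IsOrbit F.X γ ∧ (∀ t, γ (t + 1) = γ t) ∧
      ∃ e, ∀ t, γ t ∈ {x ∈ (D.φ e).source | ‖D.φ e x‖ ^ 2 < 1}) :
    ∃ ψ : ℝ → D.Capped → D.Capped, IsFlow F.field ψ ∧
      (∀ x ∈ D.U \ ⋃ e, {x ∈ (D.φ e).source | ‖D.φ e x‖ ^ 2 < 1}, ∃ γ : ℝ → M, IsOrbit F.X γ ∧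
        γ 0 = x ∧ ∀ t, γ t ∈ D.U \ ⋃ e, {x ∈ (D.φ e).source | ‖D.φ e x‖ ^ 2 < 1} ∧
          D.Φ (γ t) = ψ t (D.Φ x)) ∧
      ∀ e, ∃ q ∈ D.openCap e, (∀ t, ψ t q = q) ∧ ∀ y ∈ D.openCap e, ψ 1 y = y → y = q := by
  choose ψ h0 hψ using exists_isOrbit F.isSmoothTimeVField_field F.field_add_one
  have hcompl := D.image_Φ_eq_compl_iUnion_openCap
  refine ⟨fun t x => ψ x t, ⟨h0, hψ⟩, fun x hx => ?_, fun e => ?_⟩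
  · have hstay : ∀ t, ψ (D.Φ x) t ∈ (⋃ e, D.openCap e)ᶜ := by
      intro t ht
      obtain ⟨e, he⟩ := mem_iUnion.1 ht
      have h1 := (F.orbit_mem_openCap (hψ _) he 0).1
      rw [h0] at h1
      have h2 : D.Φ x ∈ (⋃ e, D.openCap e)ᶜ := hcompl ▸ ⟨x, hx, rfl⟩
      exact h2 (mem_iUnion.2 ⟨e, h1⟩)
    have hmem : ∀ t, ∃ x' ∈ D.U \ ⋃ e, {x ∈ (D.φ e).source | ‖D.φ e x‖ ^ 2 < 1},
        D.Φ x' = ψ (D.Φ x) t := by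
      intro t
      have h := hstay t
      rw [← hcompl] at h
      exact h
    have htarget : ∀ t, ψ (D.Φ x) t ∈ D.Φ.target := by
      intro t
      obtain ⟨x', hx', h⟩ := hmem t
      rw [← h]
      exact D.Φ.map_source hx'.1
    refine ⟨fun t => D.Φ.symm (ψ (D.Φ x) t), F.isOrbit_Φ_symm (hψ _) htarget, ?_, fun t => ⟨?_, ?_⟩⟩
    · change D.Φ.symm (ψ (D.Φ x) 0) = x
      rw [h0, D.Φ.left_inv hx.1]
    · obtain ⟨x', hx', h⟩ := hmem t
      change D.Φ.symm (ψ (D.Φ x) t) ∈ _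
      rwa [← h, D.Φ.left_inv hx'.1]
    · exact D.Φ.right_inv (htarget t)
  · refine ⟨D.centre e, centre_mem_openCap e, fun t => F.orbit_centre (hψ _) (h0 _) t, ?_⟩
    intro y hy hfix
    by_contra hne
    have hcap : ∀ t, ψ y t ∈ D.openCap e := fun t =>
      (F.orbit_mem_openCap (hψ y) (t₀ := 0) (by rwa [h0]) t).1
    have hnec : ∀ t, ψ y t ≠ D.centre e := by
      intro t ht
      exact hne ((h0 y).symm.trans (F.orbit_centre (hψ y) ht 0))
    have htarget : ∀ t, ψ y t ∈ D.Φ.target := by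
      intro t
      rcases D.Φ_target_or (ψ y t) with h | ⟨e', h⟩
      · exact h
      · exfalso
        have h1 := F.orbit_centre (hψ y) h
        obtain ⟨y', hy', h2⟩ := hcap t
        rw [h, ← D.cap_zero] at h2
        have h3 := D.eq_of_cap_eq (D.disk_subset_disk hy') D.zero_mem_disk h2
        exact hnec t (h3 ▸ h)
    refine hper ⟨fun t => D.Φ.symm (ψ y t), F.isOrbit_Φ_symm (hψ y) htarget, fun t => ?_, e, fun t => ?_⟩
    -- By periodicity of the field the shifted orbit is again an orbit. It agrees with the original
    -- at time 0, so uniqueness makes the orbit 1-periodic.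
    · have h1 : (fun t => ψ y (t + 1)) = ψ y :=
        IsOrbit.eq_of_eq F.isSmoothTimeVField_field (t₀ := 0)
          ((hψ y).comp_add F.field_add_one) (hψ y) (by
            rw [zero_add, h0]
            exact hfix)
      exact congrArg D.Φ.symm (congrFun h1 t)
    · have h1 := D.Φ.right_inv (htarget t)
      have h2 := hcap t
      rw [← h1] at h2
      exact (D.incl_mem_openCap (D.Φ.map_target (htarget t))).1 h2

end Ham
end CapData

/-! ### Sides, slabs and components of the complement of Z. -/

section TubeTopology

variable {M : Type*} [TopologicalSpace M] [T2Space M] [CompactSpace M]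
  [ChartedSpace (EuclideanSpace ℝ (Fin 2)) M]
  [IsManifold (𝓡 2) ∞ M] {m : ℕ} {Z : Set M} {Ω : TwoTensor M}

lemma IsComponentOf.isOpen {V W : Set M} (hV : IsComponentOf V W) (hW : IsOpen W) : IsOpen V := by
  have : LocallyConnectedSpace M := ChartedSpace.locallyConnectedSpace Plane M
  obtain ⟨p, -, rfl⟩ := hV
  exact hW.connectedComponentIn

lemma IsComponentOf.isConnected {X : Type*} [TopologicalSpace X] {V W : Set X}
    (hV : ∃ p ∈ W, V = connectedComponentIn W p) : IsConnected V := by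
  obtain ⟨p, hp, rfl⟩ := hV
  exact isConnected_connectedComponentIn_iff.2 hp

lemma IsComponentOf.subset_set {V W : Set M} (hV : IsComponentOf V W) : V ⊆ W := by
  obtain ⟨p, -, rfl⟩ := hV
  exact connectedComponentIn_subset W p

lemma IsComponentOf.eq_of_mem {V W : Set M} (hV : IsComponentOf V W) {x : M} (hx : x ∈ V) :
    V = connectedComponentIn W x := by
  obtain ⟨p, -, rfl⟩ := hV
  exact connectedComponentIn_eq hx

lemma IsComponentOf.subset_of_isPreconnected {V W : Set M} (hV : IsComponentOf V W) {A : Set M}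
    (hA : IsPreconnected A) (hAW : A ⊆ W) {x : M} (hxA : x ∈ A) (hx : x ∈ V) : A ⊆ V := by
  rw [hV.eq_of_mem hx]
  exact hA.subset_connectedComponentIn hxA hAW

/-- The part of a component of an open set outside a neighbourhood of the boundary is closed. -/
lemma IsComponentOf.isClosed_diff {V W : Set M} (hV : IsComponentOf V W) (hW : IsOpen W) {N : Set M}
    (hN : IsOpen N) (hWN : Wᶜ ⊆ N) : IsClosed (V \ N) := by
  refine isClosed_of_closure_subset fun x hx => ?_
  have hxN : x ∉ N := (closure_minimal (fun y hy => hy.2) hN.isClosed_compl) hx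
  have hxW : x ∈ W := by
    by_contra h
    exact hxN (hWN h)
  refine ⟨?_, hxN⟩
  have hc : IsComponentOf (connectedComponentIn W x) W := ⟨x, hxW, rfl⟩
  obtain ⟨y, hy1, hy2⟩ := mem_closure_iff.1 hx _ (hc.isOpen hW) (mem_connectedComponentIn hxW)
  rw [hV.eq_of_mem hy2.1, ← hc.eq_of_mem hy1]
  exact mem_connectedComponentIn hxW

namespace AdaptedTube

variable (T : AdaptedTube m Z Ω)

/-- The slab is the image of a compact product under the continuous inverse trivialisation. This is
what makes slabs closed in `M` although the tube is only open. -/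
lemma isCompact_slab {I : Set ℝ} (hI : IsCompact I) (hIδ : I ⊆ Ioo (-T.δ) T.δ) {C : Set M}
    (hC : IsCompact C) (hCZ : C ⊆ Z) : IsCompact {x ∈ T.N | T.z x ∈ I ∧ T.π x ∈ C} := by
  have h : {x ∈ T.N | T.z x ∈ I ∧ T.π x ∈ C} = (fun q : ℝ × M => T.point q.1 q.2) '' (I ×ˢ C) := by
    ext x
    constructor
    · rintro ⟨hx, h1, h2⟩
      exact ⟨(T.z x, T.π x), ⟨h1, h2⟩, T.point_eq hx⟩
    · rintro ⟨⟨w, p⟩, ⟨hw, hp⟩, rfl⟩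
      obtain ⟨h1, h2, h3⟩ := T.point_spec (hIδ hw) (hCZ hp)
      exact ⟨h1, h2 ▸ hw, h3 ▸ hp⟩
  rw [h]
  exact (hI.prod hC).image_of_continuousOn
    (T.contMDiffOn_point.continuousOn.mono (prod_mono hIδ hCZ))

lemma isClosed_slab (hZ : IsClosed Z) {a : ℝ} (ha : a < T.δ) :
    IsClosed {x ∈ T.N | |T.z x| ≤ a} := by
  have h := T.isCompact_slab (I := Icc (-a) a) isCompact_Icc
    (fun w hw => ⟨by linarith [hw.1], by linarith [hw.2]⟩) hZ.isCompact subset_rfl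
  convert h.isClosed using 1
  ext x
  constructor
  · rintro ⟨hx, h⟩
    exact ⟨hx, abs_le.1 h, T.π_mem hx⟩
  · rintro ⟨hx, h, -⟩
    exact ⟨hx, abs_le.2 h⟩

lemma isOpen_nhd (a : ℝ) : IsOpen (T.nhd a) :=
  T.z_def.1.continuousOn.isOpen_inter_preimage T.isOpen (t := {w | |w| < a})
    (isOpen_lt continuous_abs continuous_const)

lemma subset_nhd {a : ℝ} (ha : 0 < a) : Z ⊆ T.nhd a := fun x hx =>
  ⟨T.subset hx, by rwa [T.z_eq_zero hx, abs_zero]⟩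

/-- Small tubes are contained in any given neighbourhood of `Z`. -/
lemma exists_nhd_subset (hZ : IsClosed Z) {W : Set M} (hW : IsOpen W) (hZW : Z ⊆ W) :
    ∃ ε, 0 < ε ∧ ε ≤ T.δ ∧ T.nhd ε ⊆ W := by
  have hδ := T.δ_pos
  have h1 : IsCompact ({x ∈ T.N | |T.z x| ≤ T.δ / 2} \ W) :=
    ((T.isClosed_slab hZ (a := T.δ / 2) (by linarith)).sdiff hW).isCompact
  rcases ({x ∈ T.N | |T.z x| ≤ T.δ / 2} \ W).eq_empty_or_nonempty with he | hne
  · refine ⟨T.δ / 2, by linarith, by linarith, fun x hx => ?_⟩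
    by_contra h
    exact (eq_empty_iff_forall_notMem.1 he x) ⟨⟨hx.1, hx.2.le⟩, h⟩
  -- The minimum of |z| over the compact part of the slab missed by `W` is positive and serves as
  -- the width of the smaller tube.
  · obtain ⟨x₀, hx₀, hmin⟩ := h1.exists_isMinOn hne
      (T.z_def.1.continuousOn.abs.mono fun x hx => hx.1.1)
    have hpos : 0 < |T.z x₀| := abs_pos.2 fun h => hx₀.2 (hZW (T.mem_Z hx₀.1.1 h))
    refine ⟨|T.z x₀|, hpos, by linarith [hx₀.1.2], fun x hx => ?_⟩
    by_contra h
    have h2 := hmin (a := x) ⟨⟨hx.1, by linarith [hx.2, hx₀.1.2]⟩, h⟩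
    exact absurd hx.2 (not_lt.2 h2)

lemma exists_collar (hZ : IsClosed Z) {C : Set M} (hC : IsComponentOf C Z) (s : ℤˣ) :
    ∃ c : T.Collar, c.σ = ((s : ℤ) : ℝ) ∧ range c.γ = C := by
  obtain ⟨p, hp, rfl⟩ := hC
  obtain ⟨γ, hγ, h0⟩ := T.exists_isReebCurve hZ hp
  obtain ⟨P, hP, hper⟩ := hγ.exists_period hZ
  refine ⟨⟨((s : ℤ) : ℝ), γ, P, ?_, hγ, hP, hper⟩, rfl, hγ.range_eq hZ ⟨0, h0⟩⟩
  rcases Int.units_eq_one_or s with rfl | rfl <;> norm_num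

/-- A side of a component of `Z`. -/
def side (e : Set M × ℤˣ) (a : ℝ) : Set M := {x ∈ T.N | T.π x ∈ e.1 ∧ a < ((e.2 : ℤ) : ℝ) * T.z x}

/-- A side is the image of a convex strip under `param`. -/
lemma isPreconnected_side (hZ : IsClosed Z) {e : Set M × ℤˣ} (he : IsComponentOf e.1 Z) :
    IsPreconnected (T.side e 0) := by
  obtain ⟨c, h1, h2⟩ := T.exists_collar hZ he e.2
  have h3 := c.image_param (a := 0) le_rfl
  rw [h1, h2] at h3
  have hconv : Convex ℝ (Collar.strip T 0) := by
    intro x hx y hy a b ha hb hab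
    have e1 : (a • x + b • y) 0 = a * x 0 + b * y 0 := rfl
    obtain ⟨hx1, hx2⟩ := hx
    obtain ⟨hy1, hy2⟩ := hy
    change 0 < (a • x + b • y) 0 ∧ (a • x + b • y) 0 < T.δ
    rw [e1]
    rcases ha.eq_or_lt with rfl | ha'
    · rw [zero_add] at hab
      subst hab
      simpa using ⟨hy1, hy2⟩
    · constructor
      · have := mul_nonneg hb hy1.le
        have := mul_pos ha' hx1
        linarith
      · have h4 := mul_lt_mul_of_pos_left hx2 ha'
        have h5 := mul_le_mul_of_nonneg_left hy2.le hb
        have : a * T.δ + b * T.δ = T.δ := by rw [← add_mul, hab, one_mul]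
        linarith
  have h4 := hconv.isPreconnected.image c.param
    (c.contMDiffOn_param.continuousOn.mono (Collar.strip_subset_dom le_rfl))
  rwa [h3] at h4

lemma side_subset {e : Set M × ℤˣ} : T.side e 0 ⊆ Zᶜ := by
  rintro x ⟨hx, -, h⟩ hxZ
  rw [T.z_eq_zero hxZ, mul_zero] at h
  exact lt_irrefl _ h

/-- Every point of the tube off `Z` lies on a side of a component. -/
lemma exists_side {x : M} (hx : x ∈ T.N) (hxZ : x ∉ Z) :
    ∃ e : Set M × ℤˣ, IsComponentOf e.1 Z ∧ x ∈ T.side e 0 ∧ ((e.2 : ℤ) : ℝ) * T.z x = |T.z x| := by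
  have hz : T.z x ≠ 0 := fun h => hxZ (T.mem_Z hx h)
  have hp := T.π_mem hx
  rcases lt_or_gt_of_ne hz with h | h
  · refine ⟨(connectedComponentIn Z (T.π x), -1), ⟨_, hp, rfl⟩,
      ⟨hx, mem_connectedComponentIn hp, ?_⟩, ?_⟩
    · simpa using h
    · simp [abs_of_neg h]
  · refine ⟨(connectedComponentIn Z (T.π x), 1), ⟨_, hp, rfl⟩,
      ⟨hx, mem_connectedComponentIn hp, ?_⟩, ?_⟩
    · simpa using h
    · simp [abs_of_pos h]

lemma side_subset_component (hZ : IsClosed Z) {V : Set M} (hV : IsComponentOf V Zᶜ)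
    {e : Set M × ℤˣ} (he : IsComponentOf e.1 Z) {x : M} (hxe : x ∈ T.side e 0) (hx : x ∈ V) :
    T.side e 0 ⊆ V :=
  hV.subset_of_isPreconnected (T.isPreconnected_side hZ he) T.side_subset hxe hx

lemma abs_of_mem_side {e : Set M × ℤˣ} {a : ℝ} (ha : 0 ≤ a) {x : M} (hx : x ∈ T.side e a) :
    |T.z x| = ((e.2 : ℤ) : ℝ) * T.z x := by
  have h := ha.trans_lt hx.2.2
  rcases Int.units_eq_one_or e.2 with h1 | h1 <;> rw [h1] at h ⊢
  · simp only [Units.val_one, Int.cast_one, one_mul] at h ⊢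
    exact abs_of_pos h
  · simp only [Units.val_neg, Units.val_one, Int.cast_neg, Int.cast_one, neg_mul, one_mul] at h ⊢
    exact abs_of_neg (by linarith)

lemma side_disjoint {e e' : Set M × ℤˣ} (he : IsComponentOf e.1 Z) (he' : IsComponentOf e'.1 Z)
    (hne : e ≠ e') : Disjoint (T.side e 0) (T.side e' 0) := by
  rw [disjoint_left]
  rintro x ⟨hx, h1, h2⟩ ⟨-, h3, h4⟩
  apply hne
  have hc : e.1 = e'.1 := (he.eq_of_mem h1).trans (he'.eq_of_mem h3).symm
  have hs : e.2 = e'.2 := by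
    rcases Int.units_eq_one_or e.2 with h5 | h5 <;> rcases Int.units_eq_one_or e'.2 with h6 | h6 <;>
      rw [h5, h6] <;> rw [h5] at h2 <;> rw [h6] at h4 <;>
      simp only [Units.val_neg, Units.val_one, Int.cast_neg, Int.cast_one, neg_mul, one_mul] at h2 h4 <;>
      exfalso <;> linarith
  exact Prod.ext hc hs

end AdaptedTube
end TubeTopology

/-! ### A piecewise linear stretching of heights. -/

section Stretch

/-- A homeomorphism of the punctured line onto the complement of `[-a, a]`, which is the identity
far away. -/
noncomputable def stretch (a k w : ℝ) : ℝ := if 0 < w then max w (a + k * w) else min w (k * w - a)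

/-- The inverse of `stretch`. -/
noncomputable def shrink (a k w : ℝ) : ℝ := if 0 < w then min w ((w - a) / k) else max w ((w + a) / k)

lemma stretch_neg {a k w : ℝ} (hw : w ≠ 0) : stretch a k (-w) = -stretch a k w := by
  unfold stretch
  rcases lt_or_gt_of_ne hw with h | h
  · rw [if_pos (by linarith), if_neg (by linarith), ← max_neg_neg]
    congr 1
    ring
  · rw [if_neg (by linarith), if_pos h, ← min_neg_neg]
    congr 1
    ring

lemma shrink_neg {a k w : ℝ} (hw : w ≠ 0) : shrink a k (-w) = -shrink a k w := by
  unfold shrink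
  rcases lt_or_gt_of_ne hw with h | h
  · rw [if_pos (by linarith), if_neg (by linarith), ← min_neg_neg]
    congr 1
    ring
  · rw [if_neg (by linarith), if_pos h, ← max_neg_neg]
    congr 1
    ring

variable {a δ : ℝ}

/-- The slope of `stretch` near zero. -/
noncomputable def stretchSlope (a δ : ℝ) : ℝ := 1 - 2 * a / δ

lemma slope_pos (ha : 0 < a) (hδ : 2 * a < δ) : 0 < stretchSlope a δ := by
  unfold stretchSlope
  rw [sub_pos, div_lt_one (by linarith)]
  exact hδ

lemma slope_mul (a δ w : ℝ) : stretchSlope a δ * w = w - a * (2 * w / δ) := by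
  unfold stretchSlope
  ring

/-- The slope is chosen so that the line w ↦ a + k w meets the diagonal at δ/2. From there on
`stretch` is the identity. -/
lemma slope_half (ha : 0 < a) (hδ : 2 * a < δ) : stretchSlope a δ * (δ / 2) = δ / 2 - a := by
  have hδ0 : δ ≠ 0 := by linarith
  rw [slope_mul, mul_div_cancel₀ _ two_ne_zero, div_self hδ0, mul_one]

lemma stretch_of_le (ha : 0 < a) (hδ : 2 * a < δ) {w : ℝ} (hw : δ / 2 ≤ w) :
    stretch a (stretchSlope a δ) w = w := by
  have hδ0 : 0 < δ := by linarith
  rw [stretch, if_pos (by linarith), max_eq_left]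
  rw [slope_mul]
  have : 1 ≤ 2 * w / δ := by
    rw [le_div_iff₀ hδ0]
    linarith
  nlinarith

lemma shrink_of_le (ha : 0 < a) (hδ : 2 * a < δ) {w : ℝ} (hw : δ / 2 ≤ w) :
    shrink a (stretchSlope a δ) w = w := by
  have hδ0 : 0 < δ := by linarith
  rw [shrink, if_pos (by linarith), min_eq_left]
  rw [le_div_iff₀ (slope_pos ha hδ), mul_comm, slope_mul]
  have : 1 ≤ 2 * w / δ := by
    rw [le_div_iff₀ hδ0]
    linarith
  nlinarith

lemma stretch_of_ge (ha : 0 < a) (hδ : 2 * a < δ) {w : ℝ} (h0 : 0 < w) (hw : w ≤ δ / 2) :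
    stretch a (stretchSlope a δ) w = a + stretchSlope a δ * w := by
  have hδ0 : 0 < δ := by linarith
  rw [stretch, if_pos h0, max_eq_right]
  rw [slope_mul]
  have : 2 * w / δ ≤ 1 := by
    rw [div_le_one hδ0]
    linarith
  nlinarith

lemma shrink_of_ge (ha : 0 < a) (hδ : 2 * a < δ) {w : ℝ} (h0 : 0 < w) (hw : w ≤ δ / 2) :
    shrink a (stretchSlope a δ) w = (w - a) / stretchSlope a δ := by
  have hδ0 : 0 < δ := by linarith
  rw [shrink, if_pos h0, min_eq_right]
  rw [div_le_iff₀ (slope_pos ha hδ), mul_comm, slope_mul]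
  have : 2 * w / δ ≤ 1 := by
    rw [div_le_one hδ0]
    linarith
  nlinarith

lemma stretch_mem (ha : 0 < a) (hδ : 2 * a < δ) {w : ℝ} (h0 : 0 < w) (hw : w < δ) :
    stretch a (stretchSlope a δ) w ∈ Ioo a δ := by
  have hk := slope_pos ha hδ
  rcases le_total w (δ / 2) with h | h
  · rw [stretch_of_ge ha hδ h0 h]
    refine ⟨by nlinarith, ?_⟩
    have h2 := slope_half ha hδ
    have h3 := mul_le_mul_of_nonneg_left h hk.le
    linarith
  · rw [stretch_of_le ha hδ h]
    exact ⟨by linarith, hw⟩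

lemma shrink_mem (ha : 0 < a) (hδ : 2 * a < δ) {w : ℝ} (h0 : a < w) (hw : w < δ) :
    shrink a (stretchSlope a δ) w ∈ Ioo 0 δ := by
  have hk := slope_pos ha hδ
  rw [shrink, if_pos (by linarith)]
  exact ⟨lt_min (by linarith) (div_pos (by linarith) hk), (min_le_left _ _).trans_lt hw⟩

lemma shrink_stretch (ha : 0 < a) (hδ : 2 * a < δ) {w : ℝ} (h0 : 0 < w) :
    shrink a (stretchSlope a δ) (stretch a (stretchSlope a δ) w) = w := by
  have hk := slope_pos ha hδ
  rcases le_total w (δ / 2) with h | h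
  · have h2 := slope_half ha hδ
    have h3 := mul_le_mul_of_nonneg_left h hk.le
    rw [stretch_of_ge ha hδ h0 h, shrink_of_ge ha hδ (by positivity) (by linarith),
      add_sub_cancel_left, mul_div_cancel_left₀ _ hk.ne']
  · rw [stretch_of_le ha hδ h, shrink_of_le ha hδ h]

lemma stretch_shrink (ha : 0 < a) (hδ : 2 * a < δ) {w : ℝ} (h0 : a < w) :
    stretch a (stretchSlope a δ) (shrink a (stretchSlope a δ) w) = w := by
  have hk := slope_pos ha hδ
  rcases le_total w (δ / 2) with h | h
  · have h2 := slope_half ha hδ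
    rw [shrink_of_ge ha hδ (by linarith) h, stretch_of_ge ha hδ (div_pos (by linarith) hk),
      mul_div_cancel₀ _ hk.ne']
    · ring
    · rw [div_le_iff₀ hk, mul_comm, h2]
      linarith
  · rw [shrink_of_le ha hδ h, stretch_of_le ha hδ h]

lemma continuousAt_ite_pos {f g : ℝ → ℝ} (hf : Continuous f) (hg : Continuous g) {w : ℝ} (hw : w ≠ 0) :
    ContinuousAt (fun w => if 0 < w then f w else g w) w := by
  rcases lt_or_gt_of_ne hw with h | h
  · refine hg.continuousAt.congr ?_
    filter_upwards [eventually_lt_nhds h] with x hx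
    rw [if_neg (by linarith)]
  · refine hf.continuousAt.congr ?_
    filter_upwards [eventually_gt_nhds h] with x hx
    rw [if_pos hx]

lemma continuousAt_stretch (a k : ℝ) {w : ℝ} (hw : w ≠ 0) : ContinuousAt (stretch a k) w :=
  continuousAt_ite_pos (by fun_prop) (by fun_prop) hw

lemma continuousAt_shrink (a k : ℝ) {w : ℝ} (hw : w ≠ 0) : ContinuousAt (shrink a k) w :=
  continuousAt_ite_pos (by fun_prop) (by fun_prop) hw

end Stretch

/-! ### Pushing a component of the complement off a slab. -/

section TubeTopology

variable {M : Type*} [TopologicalSpace M] [T2Space M] [CompactSpace M]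
  [ChartedSpace (EuclideanSpace ℝ (Fin 2)) M]
  [IsManifold (𝓡 2) ∞ M] {m : ℕ} {Z : Set M} {Ω : TwoTensor M}

namespace AdaptedTube

variable (T : AdaptedTube m Z Ω)

open Classical in
/-- Reparametrise the height in the tube. -/
noncomputable def reheight (s : ℝ → ℝ) (x : M) : M := if x ∈ T.N then T.point (s (T.z x)) (T.π x) else x

lemma reheight_of_notMem {s : ℝ → ℝ} {x : M} (hx : x ∉ T.N) : T.reheight s x = x := if_neg hx

lemma reheight_spec {s : ℝ → ℝ} {x : M} (hx : x ∈ T.N) (hs : s (T.z x) ∈ Ioo (-T.δ) T.δ) :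
    T.reheight s x ∈ T.N ∧ T.z (T.reheight s x) = s (T.z x) ∧ T.π (T.reheight s x) = T.π x := by
  rw [reheight, if_pos hx]
  exact T.point_spec hs (T.π_mem hx)

lemma reheight_eq_self {s : ℝ → ℝ} {x : M} (hx : x ∈ T.N) (hs : s (T.z x) = T.z x) :
    T.reheight s x = x := by
  rw [reheight, if_pos hx, hs, T.point_eq hx]

lemma reheight_reheight {s r : ℝ → ℝ} {x : M}
    (h : x ∈ T.N → s (T.z x) ∈ Ioo (-T.δ) T.δ ∧ r (s (T.z x)) = T.z x) :
    T.reheight r (T.reheight s x) = x := by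
  by_cases hx : x ∈ T.N
  · obtain ⟨h1, h2⟩ := h hx
    obtain ⟨h3, h4, h5⟩ := T.reheight_spec hx h1
    rw [reheight, if_pos h3, h4, h5, h2, T.point_eq hx]
  · rw [T.reheight_of_notMem hx, T.reheight_of_notMem hx]

/-- Reparametrising the height is continuous where the new height is. -/
lemma continuousAt_reheight (hZ : IsClosed Z) {s : ℝ → ℝ} {x : M}
    (hfar : ∀ w, T.δ / 2 ≤ |w| → s w = w)
    (hs : x ∈ T.N → s (T.z x) ∈ Ioo (-T.δ) T.δ ∧ ContinuousAt s (T.z x)) :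
    ContinuousAt (T.reheight s) x := by
  have hδ := T.δ_pos
  by_cases hx : x ∈ T.N
  · obtain ⟨h1, h2⟩ := hs hx
    have hN := T.isOpen.mem_nhds hx
    have hz : ContinuousAt T.z x := T.z_def.1.continuousOn.continuousAt hN
    have hsz : ContinuousAt (fun x => s (T.z x)) x := ContinuousAt.comp (g := s) h2 hz
    have hπ : ContinuousAt T.π x := T.π_smooth.continuousOn.continuousAt hN
    have hp := T.contMDiffOn_point.continuousOn (s (T.z x), T.π x) ⟨h1, T.π_mem hx⟩
    have h3 : Filter.Tendsto (fun x => (s (T.z x), T.π x)) (𝓝 x)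
        (𝓝[Ioo (-T.δ) T.δ ×ˢ Z] (s (T.z x), T.π x)) := by
      refine tendsto_nhdsWithin_iff.2 ⟨hsz.prodMk hπ, ?_⟩
      filter_upwards [hN, hsz (Ioo_mem_nhds h1.1 h1.2)] with y hy hy'
      exact ⟨hy', T.π_mem hy⟩
    have h4 : ContinuousAt (fun x => T.point (s (T.z x)) (T.π x)) x := hp.tendsto.comp h3
    refine h4.congr ?_
    filter_upwards [hN] with y hy
    rw [reheight, if_pos hy]
  · have hmem : x ∈ {x ∈ T.N | |T.z x| ≤ T.δ / 2}ᶜ := fun h => hx h.1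
    refine continuousAt_id.congr ?_
    filter_upwards [(T.isClosed_slab hZ (a := T.δ / 2) (by linarith)).isOpen_compl.mem_nhds hmem]
      with y hy
    by_cases hyN : y ∈ T.N
    · refine (T.reheight_eq_self hyN (hfar _ ?_)).symm
      by_contra h
      exact hy ⟨hyN, (not_le.1 h).le⟩
    · exact (T.reheight_of_notMem hyN).symm

/-- Heights of the same sign give points of the same component of the complement of `Z`. -/
lemma reheight_mem (hZ : IsClosed Z) {V : Set M} (hV : IsComponentOf V Zᶜ) {s : ℝ → ℝ} {x : M}
    (hx : x ∈ V) (hs : x ∈ T.N → s (T.z x) ∈ Ioo (-T.δ) T.δ ∧ 0 < T.z x * s (T.z x)) :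
    T.reheight s x ∈ V := by
  by_cases hxN : x ∈ T.N
  · obtain ⟨h1, h2⟩ := hs hxN
    obtain ⟨h3, h4, h5⟩ := T.reheight_spec hxN h1
    obtain ⟨e, he, hxe, -⟩ := T.exists_side hxN (hV.subset_set hx)
    refine T.side_subset_component hZ hV he hxe hx ⟨h3, h5 ▸ hxe.2.1, ?_⟩
    rw [h4]
    have h6 := hxe.2.2
    by_contra h7
    have h8 : ((e.2 : ℤ) : ℝ) * ((e.2 : ℤ) : ℝ) = 1 := by
      rcases Int.units_eq_one_or e.2 with h | h <;> rw [h] <;> norm_num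
    nlinarith [mul_nonpos_of_nonneg_of_nonpos h6.le (not_lt.1 h7)]
  · rwa [T.reheight_of_notMem hxN]

/-- Reduces statements about signed heights to positive ones, `stretch` and `shrink` being odd away
from zero. -/
lemma abs_induction {p : ℝ → Prop} {a : ℝ} (ha : 0 ≤ a) (hp : ∀ w, a < w → w < T.δ → p w)
    (hneg : ∀ w, w ≠ 0 → p w → p (-w)) {w : ℝ} (hw : a < |w|) (hwδ : w ∈ Ioo (-T.δ) T.δ) : p w := by
  rcases le_total 0 w with h | h
  · rw [abs_of_nonneg h] at hw
    exact hp w hw hwδ.2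
  · rw [abs_of_nonpos h] at hw
    have := hneg (-w) (by linarith) (hp (-w) hw (by linarith [hwδ.1]))
    rwa [neg_neg] at this

/-- A component of the complement of `Z` is homeomorphic to its part outside a slab. -/
lemma exists_homeo_shrunk (hZ : IsClosed Z) {V : Set M} (hV : IsComponentOf V Zᶜ) {a : ℝ}
    (ha : 0 < a) (haδ : 2 * a < T.δ) :
    Nonempty (V ≃ₜ (V \ {x ∈ T.N | |T.z x| ≤ a} : Set M)) := by
  set k := stretchSlope a T.δ
  have hVo := hV.isOpen hZ.isOpen_compl
  have hfar : ∀ (f : ℝ → ℝ), (∀ w, T.δ / 2 ≤ w → f w = w) → (∀ w, w ≠ 0 → f (-w) = - f w) →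
      ∀ w, T.δ / 2 ≤ |w| → f w = w := by
    intro f h1 h2 w hw
    rcases le_total 0 w with h | h
    · rw [abs_of_nonneg h] at hw
      exact h1 w hw
    · rw [abs_of_nonpos h] at hw
      have h3 := h2 w (by linarith [T.δ_pos])
      rw [h1 _ hw] at h3
      linarith
  have hs : ∀ w, 0 < |w| → w ∈ Ioo (-T.δ) T.δ → stretch a k w ∈ Ioo (-T.δ) T.δ ∧
      0 < w * stretch a k w ∧ a < |stretch a k w| ∧ shrink a k (stretch a k w) = w := by
    intro w hw hwδ
    refine T.abs_induction (p := fun w => stretch a k w ∈ Ioo (-T.δ) T.δ ∧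
      0 < w * stretch a k w ∧ a < |stretch a k w| ∧ shrink a k (stretch a k w) = w) le_rfl ?_ ?_
      hw hwδ
    · intro w h0 h1
      obtain ⟨h2, h3⟩ := stretch_mem ha haδ h0 h1
      exact ⟨⟨by linarith [T.δ_pos], h3⟩, mul_pos h0 (ha.trans h2), h2.trans_le (le_abs_self _),
        shrink_stretch ha haδ h0⟩
    · rintro w hw ⟨h1, h2, h3, h4⟩
      rw [stretch_neg hw, abs_neg, shrink_neg, h4]
      · exact ⟨⟨by linarith [h1.2], by linarith [h1.1]⟩, by linarith, h3, rfl⟩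
      · intro h
        rw [h, mul_zero] at h2
        exact lt_irrefl _ h2
  have hr : ∀ w, a < |w| → w ∈ Ioo (-T.δ) T.δ → shrink a k w ∈ Ioo (-T.δ) T.δ ∧
      0 < w * shrink a k w ∧ stretch a k (shrink a k w) = w := by
    intro w hw hwδ
    refine T.abs_induction (p := fun w => shrink a k w ∈ Ioo (-T.δ) T.δ ∧
      0 < w * shrink a k w ∧ stretch a k (shrink a k w) = w) ha.le ?_ ?_ hw hwδ
    · intro w h0 h1
      obtain ⟨h2, h3⟩ := shrink_mem ha haδ h0 h1
      exact ⟨⟨by linarith [T.δ_pos], h3⟩, mul_pos (ha.trans h0) h2, stretch_shrink ha haδ h0⟩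
    · rintro w hw ⟨h1, h2, h4⟩
      rw [shrink_neg hw, stretch_neg, h4]
      · exact ⟨⟨by linarith [h1.2], by linarith [h1.1]⟩, by linarith, rfl⟩
      · intro h
        rw [h, mul_zero] at h2
        exact lt_irrefl _ h2
  have hzpos : ∀ x ∈ V, x ∈ T.N → 0 < |T.z x| := fun x hx hxN =>
    abs_pos.2 fun h => hV.subset_set hx (T.mem_Z hxN h)
  have hU : ∀ x ∈ V \ {x ∈ T.N | |T.z x| ≤ a}, x ∈ T.N → a < |T.z x| := fun x hx hxN => by
    by_contra h
    exact hx.2 ⟨hxN, not_lt.1 h⟩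
  -- The two reparametrisations of the height, extended by the identity outside the tube, are
  -- inverse to each other. They preserve the sign of `z`, hence the component `V`.
  let ψ : OpenPartialHomeomorph M M :=
    { toFun := T.reheight (stretch a k)
      invFun := T.reheight (shrink a k)
      source := V
      target := V \ {x ∈ T.N | |T.z x| ≤ a}
      map_source' := fun x hx => by
        refine ⟨T.reheight_mem hZ hV hx fun hxN => ?_, ?_⟩
        · obtain ⟨h1, h2, -⟩ := hs _ (hzpos x hx hxN) (T.z_mem hxN)
          exact ⟨h1, h2⟩
        · rintro ⟨h1, h2⟩
          by_cases hxN : x ∈ T.N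
          · obtain ⟨h3, h4, h5, -⟩ := hs _ (hzpos x hx hxN) (T.z_mem hxN)
            rw [(T.reheight_spec hxN h3).2.1] at h2
            linarith
          · rw [T.reheight_of_notMem hxN] at h1
            exact hxN h1
      map_target' := fun x hx => T.reheight_mem hZ hV hx.1 fun hxN => by
        obtain ⟨h1, h2, -⟩ := hr _ (hU x hx hxN) (T.z_mem hxN)
        exact ⟨h1, h2⟩
      left_inv' := fun x hx => T.reheight_reheight fun hxN => by
        obtain ⟨h1, -, -, h2⟩ := hs _ (hzpos x hx hxN) (T.z_mem hxN)
        exact ⟨h1, h2⟩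
      right_inv' := fun x hx => T.reheight_reheight fun hxN => by
        obtain ⟨h1, -, h2⟩ := hr _ (hU x hx hxN) (T.z_mem hxN)
        exact ⟨h1, h2⟩
      open_source := hVo
      open_target := hVo.sdiff (T.isClosed_slab hZ (by linarith))
      continuousOn_toFun := fun x hx => (T.continuousAt_reheight hZ
        (hfar _ (fun w hw => stretch_of_le ha haδ hw) fun w hw => stretch_neg hw)
        fun hxN => ⟨(hs _ (hzpos x hx hxN) (T.z_mem hxN)).1,
          continuousAt_stretch a k (abs_pos.1 (hzpos x hx hxN))⟩).continuousWithinAt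
      continuousOn_invFun := fun x hx => (T.continuousAt_reheight hZ
        (hfar _ (fun w hw => shrink_of_le ha haδ hw) fun w hw => shrink_neg hw)
        fun hxN => ⟨(hr _ (hU x hx hxN) (T.z_mem hxN)).1,
          continuousAt_shrink a k (abs_pos.1 (hzpos x hx.1 hxN))⟩).continuousWithinAt }
  exact ⟨ψ.toHomeomorphSourceTarget⟩

end AdaptedTube
end TubeTopology

/-! ### A Reeb-invariant Hamiltonian as a radial function on a cap. -/

section CollarHamiltonian

variable {M : Type*} [TopologicalSpace M] [T2Space M] [CompactSpace M]
  [ChartedSpace (EuclideanSpace ℝ (Fin 2)) M]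
  [IsManifold (𝓡 2) ∞ M] {m : ℕ} {Z : Set M} {Ω : TwoTensor M}

namespace AdaptedTube.Collar

variable {T : AdaptedTube m Z Ω} (c : T.Collar)

/-- The values of a Reeb-invariant function as a function of the height. -/
noncomputable def profile (H : ℝ → M → ℝ) (t w : ℝ) : ℝ := H t (c.param (pt w 0))

lemma mdifferentiableAt_timeFun {H : ℝ → M → ℝ} {U : Set M} (hU : IsOpen U)
    (hH : IsSmoothTimeFunOn H U) {x : M} (hx : x ∈ U) (t : ℝ) :
    MDifferentiableAt (𝓡 2) 𝓘(ℝ, ℝ) (H t) x := by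
  have h := (hH.contMDiffAt ((isOpen_univ.prod hU).mem_nhds
    (show ((t, x) : ℝ × M) ∈ univ ×ˢ U from ⟨mem_univ _, hx⟩)))
  have h2 : ContMDiffAt (𝓡 2) (𝓘(ℝ, ℝ).prod (𝓡 2)) ∞ (fun x : M => (t, x)) x :=
    contMDiffAt_const.prodMk contMDiffAt_id
  exact (h.comp x h2).mdifferentiableAt (by simp)

/-- The curves of constant height in the collar have velocity proportional to the Reeb field, so `H`
is constant along them and depends on the height alone. -/
lemma eq_profile (hZ : IsClosed Z) {H : ℝ → M → ℝ} (hH : IsSmoothTimeFunOn H Zᶜ)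
    (hR : ∀ t, ∀ x ∈ T.N \ Z, diff (H t) x (T.R x) = 0) {y : Plane} (hy : y ∈ strip T 0) (t : ℝ) :
    H t (c.param y) = c.profile H t (y 0) := by
  have hdom : ∀ τ, pt (y 0) τ ∈ dom T := fun τ => strip_subset_dom le_rfl hy
  have hder : ∀ τ, HasDerivAt (fun τ => H t (c.param (pt (y 0) τ))) 0 τ := by
    intro τ
    have hyd := hdom τ
    have h0 : pt (y 0) τ 0 ≠ 0 := hy.1.ne'
    have hxN := (c.param_spec hyd).1
    have hxZ := c.notMem_Z hyd h0
    have h1 := (mdifferentiableAt_timeFun hZ.isOpen_compl hH hxZ t).hasMFDerivAt.comp _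
      (c.mdiff_param hyd).hasMFDerivAt
    have hline : HasFDerivAt (fun τ : ℝ => pt (y 0) τ)
        (ContinuousLinearMap.toSpanSingleton ℝ (pt 0 1)) τ := by
      have h : HasDerivAt (fun τ : ℝ => y 0 • pt 1 0 + τ • pt 0 1)
          (0 + (1 : ℝ) • pt 0 1) τ :=
        (hasDerivAt_const _ _).add ((hasDerivAt_id _).smul_const _)
      rw [zero_add, one_smul] at h
      refine (h.congr_of_eventuallyEq (Filter.Eventually.of_forall fun τ => ?_)).hasFDerivAt
      beta_reduce
      rw [plane_decomp (pt (y 0) τ), pt_zero, pt_one]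
    have h2 := h1.comp τ hline.hasMFDerivAt
    have hz1 : diff T.z (c.param (pt (y 0) τ)) ≠ 0 := by
      intro h
      have h3 := c.diff_z_dparam hyd (pt 1 0)
      rw [h, pt_zero, mul_one] at h3
      exact c.σ_ne h3.symm
    have hz0 := c.diff_z_dparam hyd (pt 0 1)
    rw [pt_zero, mul_zero] at hz0
    obtain ⟨k, hk⟩ := T.exists_smul_R hxN hz1 hz0
    have h3 : diff (H t) (c.param (pt (y 0) τ)) (c.dparam (pt (y 0) τ) (pt 0 1)) = 0 := by
      rw [hk, map_smul, hR t _ ⟨hxN, hxZ⟩, smul_zero]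
    have h4 : HasMFDerivAt 𝓘(ℝ, ℝ) 𝓘(ℝ, ℝ) (fun τ => H t (c.param (pt (y 0) τ))) τ
        (ContinuousLinearMap.toSpanSingleton ℝ (0 : ℝ)) := by
      refine h2.congr_mfderiv ?_
      ext1
      change diff (H t) (c.param (pt (y 0) τ)) (c.dparam (pt (y 0) τ) ((1 : ℝ) • pt 0 1)) = (1 : ℝ) • (0 : ℝ)
      rw [one_smul, smul_zero]
      exact h3
    exact hasDerivAt_iff_hasFDerivAt.2 h4.hasFDerivAt
  have h5 := is_const_of_deriv_eq_zero (fun τ => (hder τ).differentiableAt)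
    (fun τ => (hder τ).deriv) (y 1) 0
  simp only [pt_eta] at h5
  exact h5

lemma contDiffOn_profile {H : ℝ → M → ℝ} (hH : IsSmoothTimeFunOn H Zᶜ) :
    ContDiffOn ℝ ∞ (fun q : ℝ × ℝ => c.profile H q.1 q.2) (univ ×ˢ Ioo 0 T.δ) := by
  rw [← contMDiffOn_iff_contDiffOn]
  have h1 : ContMDiff 𝓘(ℝ, ℝ × ℝ) (𝓡 2) ∞ (fun q : ℝ × ℝ => pt q.2 0) :=
    (contDiff_pt.comp (contDiff_snd.prodMk contDiff_const)).contMDiff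
  have hdom : ∀ q : ℝ × ℝ, q ∈ (univ : Set ℝ) ×ˢ Ioo 0 T.δ → pt q.2 0 ∈ dom T := fun q hq =>
    strip_subset_dom le_rfl ⟨hq.2.1, hq.2.2⟩
  have h2 : ContMDiffOn 𝓘(ℝ, ℝ × ℝ) (𝓡 2) ∞ (fun q : ℝ × ℝ => c.param (pt q.2 0))
      (univ ×ˢ Ioo 0 T.δ) := c.contMDiffOn_param.comp h1.contMDiffOn hdom
  have h3 : ContMDiffOn 𝓘(ℝ, ℝ × ℝ) 𝓘(ℝ, ℝ) ∞ (fun q : ℝ × ℝ => q.1) (univ ×ˢ Ioo 0 T.δ) :=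
    contDiff_fst.contMDiff.contMDiffOn
  exact hH.comp (h3.prodMk h2) fun q hq => ⟨mem_univ _, c.notMem_Z (hdom q hq) hq.2.1.ne'⟩

/-- The Hamiltonian in a cap chart. -/
noncomputable def capHam (H : ℝ → M → ℝ) (a κ t : ℝ) (y : Plane) : ℝ :=
  c.profile H t (a + κ * ‖y‖ ^ 2)

variable {a κ : ℝ}

lemma height_mem (ha : 0 < a) (hκ : 0 < κ) {y : Plane} (hy : y ∈ disk (κ⁻¹ * (T.δ - a))) :
    a + κ * ‖y‖ ^ 2 ∈ Ioo 0 T.δ := by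
  refine ⟨by positivity, ?_⟩
  have h : ‖y‖ ^ 2 < κ⁻¹ * (T.δ - a) := hy
  have h2 := mul_lt_mul_of_pos_left h hκ
  rw [← mul_assoc, mul_inv_cancel₀ hκ.ne', one_mul] at h2
  linarith

lemma contDiff_height (a κ : ℝ) : ContDiff ℝ ∞ (fun y : Plane => a + κ * ‖y‖ ^ 2) :=
  contDiff_const.add (contDiff_const.mul (contDiff_norm_sq ℝ))

lemma contDiffOn_capHam {H : ℝ → M → ℝ} (hH : IsSmoothTimeFunOn H Zᶜ) (ha : 0 < a) (hκ : 0 < κ) :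
    ContDiffOn ℝ ∞ (fun q : ℝ × Plane => c.capHam H a κ q.1 q.2)
      (univ ×ˢ disk (κ⁻¹ * (T.δ - a))) :=
  (c.contDiffOn_profile hH).comp
    (contDiff_fst.prodMk ((contDiff_height a κ).comp contDiff_snd)).contDiffOn
    fun _ hq => ⟨mem_univ _, height_mem ha hκ hq.2⟩

/-- The function depends on `y` through |y|² only. At the origin every `v` qualifies, which makes
the centre critical; elsewhere `v` is a rotation vector. -/
lemma fderiv_capHam {H : ℝ → M → ℝ} (hH : IsSmoothTimeFunOn H Zᶜ) (ha : 0 < a) (hκ : 0 < κ)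
    {y : Plane} (hy : y ∈ disk (κ⁻¹ * (T.δ - a))) (t : ℝ) (v : Plane) (hv : inner ℝ y v = 0) :
    fderiv ℝ (c.capHam H a κ t) y v = 0 := by
  have h1 : DifferentiableAt ℝ (c.profile H t) (a + κ * ‖y‖ ^ 2) := by
    have h := ((c.contDiffOn_profile hH).contDiffAt ((isOpen_univ.prod isOpen_Ioo).mem_nhds
      (show ((t, a + κ * ‖y‖ ^ 2) : ℝ × ℝ) ∈ univ ×ˢ Ioo 0 T.δ from
        ⟨mem_univ _, height_mem ha hκ hy⟩))).differentiableAt (by simp)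
    exact h.comp (a + κ * ‖y‖ ^ 2) ((differentiableAt_const t).prodMk differentiableAt_id)
  have h2 : HasFDerivAt (fun y : Plane => a + κ * ‖y‖ ^ 2) (κ • (2 • innerSL ℝ y)) y :=
    ((hasStrictFDerivAt_norm_sq y).hasFDerivAt.const_mul κ).const_add a
  have h3 := (h1.hasFDerivAt.comp y h2).fderiv
  have h4 := congrArg (fun L : Plane →L[ℝ] ℝ => L v) h3
  refine h4.trans ?_
  change fderiv ℝ (c.profile H t) (a + κ * ‖y‖ ^ 2) (κ • (2 • inner ℝ y v)) = 0
  rw [hv, smul_zero, smul_zero, map_zero]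

/-- The density of the symplectic form in a cap chart. -/
noncomputable def capDensity (a κ : ℝ) (y : Plane) : ℝ := 2 * κ * c.action (a + κ * ‖y‖ ^ 2)

lemma contDiffOn_capDensity (ha : 0 < a) (hκ : 0 < κ) :
    ContDiffOn ℝ ∞ (c.capDensity a κ) (disk (κ⁻¹ * (T.δ - a))) :=
  contDiffOn_const.mul (c.contDiffOn_action.comp (contDiff_height a κ).contDiffOn
    fun _ hy => (height_mem ha hκ hy).1.ne')

lemma capDensity_ne_zero (hΩ : IsSymplecticOn Ω Zᶜ) (ha : 0 < a) (hκ : 0 < κ) {y : Plane}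
    (hy : y ∈ disk (κ⁻¹ * (T.δ - a))) : c.capDensity a κ y ≠ 0 := by
  obtain ⟨h1, h2⟩ := height_mem ha hκ hy
  exact mul_ne_zero (by positivity)
    (c.action_ne_zero hΩ (abs_lt.2 ⟨by linarith [T.δ_pos], h2⟩) h1.ne')

lemma eq_capHam (hZ : IsClosed Z) {H : ℝ → M → ℝ} (hH : IsSmoothTimeFunOn H Zᶜ)
    (hR : ∀ t, ∀ x ∈ T.N \ Z, diff (H t) x (T.R x) = 0) (ha : 0 < a) {x : M}
    (hx : x ∈ {x ∈ T.N | T.π x ∈ range c.γ ∧ a < c.σ * T.z x}) {y : Plane}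
    (hxy : c.σ * T.z x = a + κ * ‖y‖ ^ 2) (t : ℝ) : H t x = c.capHam H a κ t y := by
  rw [← c.image_param ha.le] at hx
  obtain ⟨y', hy', rfl⟩ := hx
  have hs := strip_mono ha hy'
  rw [(c.param_spec (strip_subset_dom le_rfl hs)).2.1, ← mul_assoc, c.σσ, one_mul] at hxy
  rw [c.eq_profile hZ hH hR hs, hxy, capHam]

end AdaptedTube.Collar
end CollarHamiltonian

/-! ### Cutting a component at height ε/2 and transferring the Hamiltonian system. -/

section Capping

variable {M : Type u} [TopologicalSpace M] [T2Space M] [CompactSpace M]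
  [ChartedSpace (EuclideanSpace ℝ (Fin 2)) M]
  [IsManifold (𝓡 2) ∞ M] {m : ℕ} {Z : Set M} {Ω : TwoTensor M}

/-- The capping data `D` cut the component `V` at height `ε / 2`, with caps of radius `1`
corresponding to height `ε`. -/
structure AdaptedTube.IsCut (T : AdaptedTube m Z Ω) (V : Set M) (ε : ℝ)
    (c : T.ends V → T.Collar) (D : CapData M (T.ends V)) : Prop where
  σ_eq : ∀ e, (c e).σ = ((e.1.2 : ℤ) : ℝ)
  range_eq : ∀ e, range (c e).γ = e.1.1
  U_eq : D.U = V \ {x ∈ T.N | |T.z x| ≤ ε / 2}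
  r_eq : D.r = (ε / 2)⁻¹ * (T.δ - ε / 2)
  source_eq : ∀ e, (D.φ e).source = T.side e.1 (ε / 2)
  height : ∀ e, ∀ x ∈ (D.φ e).source, ((e.1.2 : ℤ) : ℝ) * T.z x = ε / 2 + ε / 2 * ‖D.φ e x‖ ^ 2
  form : ∀ e, ∀ x ∈ (D.φ e).source, ∀ v w : Plane, Ω x v w =
    (c e).capDensity (ε / 2) (ε / 2) (D.φ e x) * det2 (tder (D.φ e) x v) (tder (D.φ e) x w)
  diff_eq : D.U \ ⋃ e, {x ∈ (D.φ e).source | ‖D.φ e x‖ ^ 2 < 1} = V \ T.nhd ε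

theorem AdaptedTube.exists_cut (T : AdaptedTube m Z Ω) (hZ : IsClosed Z)
    (hΩ : IsSymplecticOn Ω Zᶜ) {V : Set M} (hV : IsComponentOf V Zᶜ) {ε : ℝ} (hε : 0 < ε)
    (hεδ : ε < T.δ) : ∃ c D, T.IsCut V ε c D := by
  have ha : 0 < ε / 2 := by linarith
  have haδ : ε / 2 < T.δ := by linarith
  choose c hσ hγ using fun e : T.ends V => T.exists_collar hZ e.2.1 e.1.2
  -- With both the cutting height and the scale equal to ε/2, the unit circle of a cap lies at
  -- height ε.
  choose φ hs ht h1 h2 h3 h4 using fun e => (c e).exists_capChart hΩ ha haδ ha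
  have hs' : ∀ e, (φ e).source = T.side e.1 (ε / 2) := by
    intro e
    rw [hs, hγ, hσ]
    rfl
  have hside : ∀ e : T.ends V, T.side e.1 (ε / 2) ⊆ T.side e.1 0 := fun e x hx =>
    ⟨hx.1, hx.2.1, ha.trans hx.2.2⟩
  have hheight : ∀ e, ∀ x ∈ (φ e).source,
      ((e.1.2 : ℤ) : ℝ) * T.z x = ε / 2 + ε / 2 * ‖φ e x‖ ^ 2 := by
    intro e x hx
    rw [← h3 e x hx, hσ]
  have habs : ∀ e, ∀ x ∈ (φ e).source, |T.z x| = ε / 2 + ε / 2 * ‖φ e x‖ ^ 2 := by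
    intro e x hx
    rw [← hheight e x hx]
    exact T.abs_of_mem_side ha.le (hs' e ▸ hx)
  have hsub : ∀ e, (φ e).source ⊆ V \ {x ∈ T.N | |T.z x| ≤ ε / 2} := by
    intro e x hx
    have hx' := hx
    rw [hs'] at hx'
    refine ⟨e.2.2 (hside e hx'), fun h => ?_⟩
    have h5 := T.abs_of_mem_side ha.le hx'
    linarith [h.2, hx'.2.2]
  -- Removing the punctured unit caps from the cut component removes precisely the heights between
  -- ε/2 and ε, since every side met by `V` is one of its ends.
  have hdiff : (V \ {x ∈ T.N | |T.z x| ≤ ε / 2}) \ ⋃ e, {x ∈ (φ e).source | ‖φ e x‖ ^ 2 < 1} =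
      V \ T.nhd ε := by
    ext x
    constructor
    · rintro ⟨⟨hx, hxs⟩, hxc⟩
      refine ⟨hx, fun hn => hxc ?_⟩
      obtain ⟨e, he, hxe, heq⟩ := T.exists_side hn.1 (hV.subset_set hx)
      have hmem : e ∈ T.ends V := ⟨he, T.side_subset_component hZ hV he hxe hx⟩
      have hlt : ε / 2 < |T.z x| := by
        by_contra h
        exact hxs ⟨hn.1, not_lt.1 h⟩
      have hsrc : x ∈ (φ ⟨e, hmem⟩).source := by
        rw [hs']
        exact ⟨hn.1, hxe.2.1, heq ▸ hlt⟩
      refine mem_iUnion.2 ⟨⟨e, hmem⟩, hsrc, ?_⟩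
      have h5 := habs _ x hsrc
      have h6 := hn.2
      by_contra h
      nlinarith [not_lt.1 h]
    · rintro ⟨hx, hn⟩
      refine ⟨⟨hx, fun h => hn ⟨h.1, by linarith [h.2]⟩⟩, fun h => ?_⟩
      obtain ⟨e, hxe, hlt⟩ := mem_iUnion.1 h
      have h5 := habs e x hxe
      have hxN : x ∈ T.N := by
        rw [hs'] at hxe
        exact hxe.1
      refine hn ⟨hxN, ?_⟩
      have h6 : ‖φ e x‖ ^ 2 < 1 := hlt
      nlinarith
  have hVo := hV.isOpen hZ.isOpen_compl
  obtain ⟨ψ⟩ := T.exists_homeo_shrunk hZ hV ha (by linarith)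
  have hconn : IsConnected (V \ {x ∈ T.N | |T.z x| ≤ ε / 2}) := by
    have : ConnectedSpace V := isConnected_iff_connectedSpace.1 (IsComponentOf.isConnected hV)
    exact isConnected_iff_connectedSpace.2 (ψ.surjective.connectedSpace ψ.continuous)
  have hclosed : ∀ e, IsClosed ({x ∈ (φ e).source | ‖φ e x‖ ^ 2 ≤ 1} ∪
      (V \ {x ∈ T.N | |T.z x| ≤ ε / 2})ᶜ) := by
    intro e
    -- Modulo the complement of the cut component, the punctured closed cap equals the compact slab
    -- of heights [ε/2, ε]. The extra level ε/2 is harmless because it lies outside the cut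
    -- component.
    have h5 : IsCompact ((fun w : ℝ => (c e).σ * w) '' Icc (ε / 2) ε) :=
      isCompact_Icc.image (by fun_prop)
    have h6 : (fun w : ℝ => (c e).σ * w) '' Icc (ε / 2) ε ⊆ Ioo (-T.δ) T.δ := by
      rintro _ ⟨w, hw, rfl⟩
      exact (c e).mul_mem (abs_lt.2 ⟨by linarith [hw.1], by linarith [hw.2]⟩)
    have hCZ : e.1.1 ⊆ Z := IsComponentOf.subset_set e.2.1
    have hC : IsCompact e.1.1 := by
      obtain ⟨p, hp, hpe⟩ := e.2.1
      rw [hpe]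
      exact (isClosed_connectedComponentIn hZ hp).isCompact
    have h7 := (T.isCompact_slab h5 h6 hC hCZ).isClosed
    have h8 := h7.union (hVo.sdiff (T.isClosed_slab hZ haδ)).isClosed_compl
    convert h8 using 1
    ext x
    by_cases hx : x ∈ (V \ {x ∈ T.N | |T.z x| ≤ ε / 2})ᶜ
    · exact ⟨fun _ => Or.inr hx, fun _ => Or.inr hx⟩
    · constructor
      · rintro (⟨h9, h10⟩ | h9)
        · left
          have h11 := h3 e x h9
          have h12 : ‖φ e x‖ ^ 2 ≤ 1 := h10
          rw [hs'] at h9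
          refine ⟨h9.1, ⟨(c e).σ * T.z x, ⟨?_, ?_⟩, ?_⟩, h9.2.1⟩
          · rw [hσ]
            exact h9.2.2.le
          · rw [h11]
            nlinarith
          · change (c e).σ * ((c e).σ * T.z x) = T.z x
            rw [← mul_assoc, (c e).σσ, one_mul]
        · exact absurd h9 hx
      · rintro (⟨hxN, ⟨w, hw, hwz⟩, hxC⟩ | h9)
        · left
          have hwz' : (c e).σ * w = T.z x := hwz
          have hzw : (c e).σ * T.z x = w := by
            rw [← hwz', ← mul_assoc, (c e).σσ, one_mul]
          have hlt : ε / 2 < w := by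
            rcases hw.1.eq_or_lt with h | h
            · exfalso
              refine (not_not.1 hx).2 ⟨hxN, ?_⟩
              rw [← hwz', abs_mul, (c e).abs_σ, one_mul, ← h, abs_of_pos ha]
            · exact h
          have hsrc : x ∈ (φ e).source := by
            rw [hs']
            refine ⟨hxN, hxC, ?_⟩
            rw [← hσ, hzw]
            exact hlt
          refine ⟨hsrc, ?_⟩
          have h11 := h3 e x hsrc
          rw [hzw] at h11
          have h12 := hw.2
          change ‖φ e x‖ ^ 2 ≤ 1
          by_contra h
          nlinarith [not_le.1 h]
        · exact Or.inr h9
  refine ⟨c, { U := V \ {x ∈ T.N | |T.z x| ≤ ε / 2}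
               base := hconn.nonempty.some
               r := (ε / 2)⁻¹ * (T.δ - ε / 2)
               φ := φ
               isOpen := hVo.sdiff (T.isClosed_slab hZ haδ)
               base_mem := hconn.nonempty.some_mem
               one_lt := ?_
               source_subset := hsub
               target_eq := fun e => ht e
               smooth := h1
               smooth_symm := h2
               disjoint := fun e e' hne => ?_
               closed := hclosed
               compact := ?_
               connected := hconn }, ⟨hσ, hγ, rfl, rfl, hs', hheight, ?_, hdiff⟩⟩
  -- The cap chart reaches height δ, so its disk is larger than the unit disk precisely because ε <
  -- δ.
  · rw [lt_inv_mul_iff₀ ha]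
    linarith
  · change Disjoint (φ e).source (φ e').source
    rw [hs', hs']
    exact (T.side_disjoint e.2.1 e'.2.1 fun h => hne (Subtype.ext h)).mono (hside e) (hside e')
  · rw [hdiff]
    exact (hV.isClosed_diff hZ.isOpen_compl (T.isOpen_nhd ε)
      (by rw [compl_compl]; exact T.subset_nhd hε)).isCompact
  · exact fun e x hx v w => h4 e x hx v w

/-- The original form, Hamiltonian and field are kept on the cut component. The cap data are the
density and the radial profile in the cap charts, both smooth up to the centre because the cutting
height is positive. -/
theorem AdaptedTube.IsCut.exists_ham {T : AdaptedTube m Z Ω} {V : Set M} {ε : ℝ}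
    {c : T.ends V → T.Collar} {D : CapData M (T.ends V)} (h : T.IsCut V ε c D) (hZ : IsClosed Z)
    (hΩ : IsSymplecticOn Ω Zᶜ) (hV : IsComponentOf V Zᶜ) (hε : 0 < ε)
    {H : ℝ → M → ℝ} {X : ℝ → VField M} (hX : IsHamiltonianField Ω Z H X)
    (hH : IsSmoothTimeFunOn H Zᶜ) (hper : ∀ t, H (t + 1) = H t)
    (hR : ∀ t, ∀ x ∈ T.N \ Z, diff (H t) x (T.R x) = 0) :
    ∃ F : D.Ham, F.Ω = Ω ∧ F.X = X := by
  have ha : 0 < ε / 2 := by linarith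
  have hUV : D.U ⊆ Zᶜ := by
    rw [h.U_eq]
    exact sdiff_subset.trans hV.subset_set
  exact ⟨{
    Ω := Ω
    H := H
    X := X
    K := fun e => (c e).capDensity (ε / 2) (ε / 2)
    g := fun e => (c e).capHam H (ε / 2) (ε / 2)
    sympl := ⟨⟨fun x hx => hΩ.1.1 x (hUV hx), hΩ.1.2.mono hUV⟩, fun x hx => hΩ.2 x (hUV hx)⟩
    K_smooth := fun e => h.r_eq ▸ (c e).contDiffOn_capDensity ha ha
    K_ne := fun e y hy => (c e).capDensity_ne_zero hΩ ha ha (h.r_eq ▸ hy)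
    form := h.form
    H_smooth := hH.mono (prod_mono subset_rfl hUV)
    H_per := hper
    g_smooth := fun e => h.r_eq ▸ (c e).contDiffOn_capHam hH ha ha
    g_per := fun e t => by
      funext y
      simp only [AdaptedTube.Collar.capHam, AdaptedTube.Collar.profile, hper]
    g_crit := fun e t => by
      ext1 v
      exact (c e).fderiv_capHam hH ha ha (h.r_eq ▸ D.zero_mem_disk) t v (inner_zero_left _)
    g_rot := fun e t y hy => (c e).fderiv_capHam hH ha ha (h.r_eq ▸ hy) t _ (by
      rw [PiLp.inner_apply, Fin.sum_univ_two]
      simp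
      ring)
    H_eq := fun e x hx t => (c e).eq_capHam hZ hH hR ha (by
      rw [h.source_eq] at hx
      rw [h.range_eq, h.σ_eq]
      exact hx) (by
      rw [h.σ_eq]
      exact h.height e x hx) t
    X_smooth := hX.1.contMDiffOn
    X_eq := fun t x hx w => hX.2 t x (hUV hx) w }, rfl, rfl⟩

end Capping

/-! ### The caps and their boundary circles in terms of the height. -/

section CutProperties

variable {M : Type u} [TopologicalSpace M] [T2Space M] [CompactSpace M]
  [ChartedSpace (EuclideanSpace ℝ (Fin 2)) M]
  [IsManifold (𝓡 2) ∞ M] {m : ℕ} {Z : Set M} {Ω : TwoTensor M} {T : AdaptedTube m Z Ω}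

lemma AdaptedTube.nhd_mono {a b : ℝ} (hab : a ≤ b) : T.nhd a ⊆ T.nhd b := fun _ hx =>
  ⟨hx.1, hx.2.trans_le hab⟩

namespace AdaptedTube.IsCut

variable {V : Set M} {ε : ℝ} {c : T.ends V → T.Collar} {D : CapData M (T.ends V)}

lemma cap_subset_nhd (h : T.IsCut V ε c D) (hε : 0 < ε) (e : T.ends V) :
    {x ∈ (D.φ e).source | ‖D.φ e x‖ ^ 2 < 1} ⊆ T.nhd ε := by
  rintro x ⟨hx, hlt⟩
  have h1 := h.height e x hx
  rw [h.source_eq] at hx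
  refine ⟨hx.1, ?_⟩
  rw [T.abs_of_mem_side (by linarith) hx, h1]
  nlinarith

lemma image_parallel (h : T.IsCut V ε c D) (hε : 0 < ε) (e : T.ends V) :
    D.Φ '' T.parallel e ε = frontier (D.openCap e) := by
  rw [D.frontier_openCap]
  ext s
  constructor
  · rintro ⟨x, ⟨hx1, hx2, hx3⟩, rfl⟩
    have hs : x ∈ (D.φ e).source := by
      rw [h.source_eq]
      exact ⟨hx1, hx2, by rw [hx3]; linarith⟩
    have h1 := h.height e x hs
    rw [hx3] at h1
    refine ⟨D.φ e x, ?_, D.cap_map hs⟩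
    have h2 : ε / 2 * ‖D.φ e x‖ ^ 2 = ε / 2 * 1 := by linarith
    exact mul_left_cancel₀ (by positivity) h2
  · rintro ⟨y, hy, rfl⟩
    have hy' : ‖y‖ ^ 2 = 1 := hy
    have hy0 : y ≠ 0 := by
      rintro rfl
      simp at hy'
    have ht := D.mem_target (e := e) hy0 (D.closed_subset_disk hy'.le)
    have hs := (D.φ e).map_target ht
    have h1 := h.height e _ hs
    rw [(D.φ e).right_inv ht, hy'] at h1
    refine ⟨(D.φ e).symm y, ?_, (D.cap_of_ne _ hy0).symm⟩
    rw [h.source_eq] at hs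
    exact ⟨hs.1, hs.2.1, by rw [h1]; ring⟩

end AdaptedTube.IsCut
end CutProperties
end BmSurface

/-! ### Assembly of the proof. -/

theorem mainTheorem9 {M : Type u} [TopologicalSpace M] [T2Space M] [CompactSpace M]
    [ChartedSpace (EuclideanSpace ℝ (Fin 2)) M] [IsManifold (𝓡 2) ∞ M]
    (_hor : BmSurface.Orientable M)
    (m : ℕ) (_hm : 1 ≤ m) (Z : Set M) (_hZ : BmSurface.IsHypersurface Z)
    (Ω : BmSurface.TwoTensor M) (_hΩ : BmSurface.IsBmSymplectic m Z Ω)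
    (T : BmSurface.AdaptedTube m Z Ω) (Xσ : BmSurface.VField M) (_hXσ : T.IsNormalBmField Xσ)
    (H : ℝ → M → ℝ) (X : ℝ → BmSurface.VField M)
    (_hX : BmSurface.IsHamiltonianField Ω Z H X) (_hH : T.IsAdmissible Xσ H X)
    (V : Set M) (_hV : BmSurface.IsComponentOf V Zᶜ) :
    (T.ends V).Finite ∧
    ∃ ε₀ : ℝ, 0 < ε₀ ∧ ε₀ ≤ T.δ ∧ ∀ ε : ℝ, 0 < ε → ε < ε₀ →
      -- the closed symplectic surface of the same genus
      ∃ (S : Type u) (_ : TopologicalSpace S) (_ : T2Space S) (_ : CompactSpace S)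
        (_ : ConnectedSpace S) (_ : ChartedSpace (EuclideanSpace ℝ (Fin 2)) S)
        (_ : IsManifold (𝓡 2) ∞ S) (ΩS : BmSurface.TwoTensor S),
        BmSurface.IsSymplecticOn ΩS univ ∧
        BmSurface.genus S = BmSurface.genus V ∧
      -- the capping disks, one for each end of `V`
      ∃ D : T.ends V → Set S,
        (∀ e, BmSurface.IsSmoothDisk (D e)) ∧
        Pairwise (fun e e' => Disjoint (closure (D e)) (closure (D e'))) ∧
      -- the symplectomorphism of surfaces with boundary, on an open neighbourhood
      ∃ Φ : OpenPartialHomeomorph M S,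
        V \ T.nhd ε ⊆ Φ.source ∧ Φ.source ⊆ V ∧
        ContMDiffOn (𝓡 2) (𝓡 2) ∞ Φ Φ.source ∧
        ContMDiffOn (𝓡 2) (𝓡 2) ∞ Φ.symm Φ.target ∧
        Φ '' (V \ T.nhd ε) = (⋃ e, D e)ᶜ ∧
        (∀ e : T.ends V, Φ '' T.parallel e ε = frontier (D e)) ∧
        (∀ x ∈ Φ.source, ∀ v w, ΩS (Φ x) (mfderiv (𝓡 2) (𝓡 2) Φ x v)
          (mfderiv (𝓡 2) (𝓡 2) Φ x w) = Ω x v w) ∧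
      -- the smooth Hamiltonian, its vector field and its flow
      ∃ (G : ℝ → S → ℝ) (Y : ℝ → BmSurface.VField S) (ψ : ℝ → S → S),
        (∀ t, G (t + 1) = G t) ∧ BmSurface.IsSmoothTimeFunOn G univ ∧
        BmSurface.IsHamiltonianField ΩS ∅ G Y ∧ BmSurface.IsFlow Y ψ ∧
        (∀ t, ∀ x ∈ V \ T.nhd ε, Y t (Φ x) = mfderiv (𝓡 2) (𝓡 2) Φ x (X t x)) ∧
        (∀ x ∈ V \ T.nhd ε, ∃ γ : ℝ → M, BmSurface.IsOrbit X γ ∧ γ 0 = x ∧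
          ∀ t, γ t ∈ V \ T.nhd ε ∧ Φ (γ t) = ψ t (Φ x)) ∧
      -- exactly one fixed point of the time-one map in each disk, and it is stationary
        (∀ e, ∃ q ∈ D e, (∀ t, ψ t q = q) ∧ ∀ y ∈ D e, ψ 1 y = y → y = q) := by
  have hZ : IsClosed Z := _hZ.1
  have hΩ := _hΩ.1
  obtain ⟨⟨hper, hsm, -⟩, -, hR, W, hW, hZW, hno⟩ := _hH
  have hfin := T.finite_ends hZ V
  have : Finite (T.ends V) := hfin
  -- The width is chosen so that the tube {|z| < ε₀}, and with it every punctured cap, lies in the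
  -- neighbourhood without 1-periodic orbits.
  obtain ⟨ε₀, hε₀, hε₀δ, hnhd⟩ := T.exists_nhd_subset hZ hW hZW
  refine ⟨hfin, ε₀, hε₀, hε₀δ, fun ε hε hεε₀ => ?_⟩
  have hεδ : ε < T.δ := hεε₀.trans_le hε₀δ
  obtain ⟨c, D, hD⟩ := T.exists_cut hZ hΩ _hV hε hεδ
  obtain ⟨F, hFΩ, hFX⟩ := hD.exists_ham hZ hΩ _hV hε _hX hsm hper hR
  obtain ⟨ψ, hψ, horb, hfix⟩ := F.exists_flow (by
    rintro ⟨γ, h1, h2, e, h3⟩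
    refine hno ⟨γ, hFX ▸ h1, h2, fun t => hnhd ?_⟩
    exact BmSurface.AdaptedTube.nhd_mono hεε₀.le (hD.cap_subset_nhd hε e (h3 t)))
  -- Compares the genus of `V` with that of the cut component, which is the capped surface minus its
  -- centres.
  obtain ⟨χ⟩ := T.exists_homeo_shrunk hZ _hV (a := ε / 2) (by linarith) (by linarith)
  have hsub : V \ T.nhd ε ⊆ D.U := hD.diff_eq ▸ sdiff_subset
  refine ⟨D.Capped, inferInstance, inferInstance, inferInstance, inferInstance, inferInstance,
    inferInstance, F.tensor, F.isSymplecticOn_tensor, ?_, D.openCap, D.isSmoothDisk_openCap, ?_,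
    D.Φ, hsub, ?_, D.contMDiffOn_Φ, D.contMDiffOn_Φ_symm, ?_, hD.image_parallel hε, ?_,
    F.ham, F.field, ψ, F.ham_add_one, F.isSmoothTimeFunOn_ham, F.isHamiltonianField, hψ, ?_, ?_, hfix⟩
  · rw [D.genus_capped, hD.U_eq]
    exact BmSurface.genus_congr χ.symm
  · intro e e' hne
    rw [D.closure_openCap, D.closure_openCap]
    exact D.disjoint_closedCap hne
  · rw [D.Φ_source, hD.U_eq]
    exact sdiff_subset
  · rw [← hD.diff_eq]
    exact D.image_Φ_eq_compl_iUnion_openCap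
  · intro x hx v w
    exact (F.tensor_Φ hx v w).trans (congrArg (fun η : BmSurface.TwoTensor M => η x v w) hFΩ)
  · intro t x hx
    rw [← hFX]
    exact F.field_Φ (hsub hx) t
  · intro x hx
    rw [← hD.diff_eq] at hx ⊢
    rw [← hFX]
    exact horb x hx
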